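/- Let $n,k\ge 0$ be integers, let $\mathcal V=\{1,\dots,n\}$, and let $U,L,F\subseteq\mathcal V$ with $U\cup L=\mathcal V$ and $F\subseteq U$. Let $S_1,\dots,S_k\subseteq\mathcal V$ (repetitions allowed). An instance consists of a semiring $(\mathbf D,\oplus,\otimes,\mathbf 0,\mathbf 1)$, a linearly ordered domain $\mathrm{Dom}(X_i)$ for each $i\in\mathcal V$, two factors $\Phi_1:\prod_{i\in U}\mathrm{Dom}(X_i)\to\mathbf D$ and $\Phi_2:\prod_{i\in L}\mathrm{Dom}(X_i)\to\mathbf D$ of finite support, and functions $\theta^{j}_v:\mathrm{Dom}(X_v)\to\mathbb R$ for $j\le k$ and $v\in S_j$. Consider the query $$Q(\mathbf x_F)=\bigoplus_{\mathbf x_{\mathcal V\setminus F}}\Phi_1(\mathbf x_U)\otimes\Phi_2(\mathbf x_L)\otimes\Bigl(\bigotimes_{j=1}^{k}\mathbf 1_{\sum_{v\in S_j}\theta^{j}_v(x_v)\le 0}\Bigr),$$ where the sum is over $\prod_{i\in\mathcal V\setminus F}\mathrm{Dom}(X_i)$ and $\mathbf 1_A$ is $\mathbf 1$ if $A$ holds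 and $\mathbf 0$ otherwise. Let $|\Phi_i|$ be the size of the support of $\Phi_i$ and $N=\max\{|\Phi_1|,|\Phi_2|\}$. Then $Q$ can be answered in time $O\bigl(N\cdot(\log N)^{\max(k-1,1)}\bigr)$ in data complexity. That is, there are a program and a constant $C$, both depending only on $n,k,U,L,F,S_1,\dots,S_k$, such that on every instance the program, given $\Phi_1$ and $\Phi_2$, halts with $Q$ as its output, and it takes at most $C\cdot N\cdot(\log N)^{\max(k-1,1)}$ steps whenever $N\ge 2$. Here a factor (input or output) is stored as a list, in arbitrary order, of the tuples of its support, each exactly once and together with its value. A program is a finite system of first-order recursive functions over immutable cells holding two values each (a machine that a unit-cost random access machine simulates with constant overhead). Each evaluation of a node of the program text costs one step; the available operations are building, reading and testing cells, local definitions, function calls, comparing two values of the same domain, evaluating some $\theta^{j}_v$ at a value, integer constants, addition, subtraction and comparison of real numbers, and $\oplus$, $\otimes$, $\mathbf 0$, $\mathbf 1$ and the test for $\mathbf 0$ in $\mathbf D$. -/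

import Mathlib

universe u v

namespace FAQAI

/-! ### Queries -/

/-- Tuples `x_K = (x_i)_{i ∈ K}` over a set `K` of variables. -/
abbrev Tuple {n : ℕ} (Dom : Fin n → Type v) (K : Finset (Fin n)) : Type v :=
  (i : {i // i ∈ K}) → Dom i.1

/-- The projection of a full tuple to the variables in `K`. -/
def proj {n : ℕ} {Dom : Fin n → Type v} (K : Finset (Fin n)) (x : (i : Fin n) → Dom i) :
    Tuple Dom K :=
  fun i => x i.1

/-- The full tuple made of `x_F` and `x_{V \ F}`. -/
def glue {n : ℕ} {Dom : Fin n → Type v} (F : Finset (Fin n)) (xF : Tuple Dom F)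
    (y : (i : {i // i ∉ F}) → Dom i.1) : (i : Fin n) → Dom i :=
  fun i => if h : i ∈ F then xF ⟨i, h⟩ else y ⟨i, h⟩

open Classical in
/-- The indicator of a proposition in a semiring. -/
noncomputable def ind (D : Type u) [Semiring D] (P : Prop) : D := if P then 1 else 0

/-- The query with skeleton factors `Φ₁(x_U)`, `Φ₂(x_L)` and ligament edges `S 0, …, S (k-1)`:
`Q(x_F) = ⊕_{x_{V \ F}} Φ₁(x_U) ⊗ Φ₂(x_L) ⊗ ⨂_j 1[∑_{v ∈ S j} θ^j_v(x_v) ≤ 0]`.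
When `U ∪ L` is everything and the factors have finite support, only finitely many summands are
nonzero, so that `∑ᶠ` is the genuine sum. -/
noncomputable def query {n k : ℕ} {D : Type u} [Semiring D] {Dom : Fin n → Type v}
    (U L F : Finset (Fin n)) (S : Fin k → Finset (Fin n))
    (Φ₁ : Tuple Dom U → D) (Φ₂ : Tuple Dom L → D)
    (θ : (j : Fin k) → (i : {i // i ∈ S j}) → Dom i.1 → ℝ) (xF : Tuple Dom F) : D :=
  ∑ᶠ y : ((i : {i // i ∉ F}) → Dom i.1),
    Φ₁ (proj U (glue F xF y)) * Φ₂ (proj L (glue F xF y)) *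
      (List.ofFn fun j : Fin k =>
        ind D (∑ i : {i // i ∈ S j}, θ j i (glue F xF y i.1) ≤ 0)).prod

/-- `|Φ|`: the number of tuples in the support of a factor. -/
noncomputable def size {n : ℕ} {D : Type u} [Semiring D] {Dom : Fin n → Type v}
    {K : Finset (Fin n)} (Φ : Tuple Dom K → D) : ℕ :=
  (Function.support Φ).ncard

/-! ### The machine model

First-order recursive programs over immutable cells, with call by value. A value is an atom
(a domain value, a semiring element or a real number), `nil`, or a cell holding two values.
Cells are passed by reference, so each evaluation step is a constant number of operations of a
(real) random access machine. Programs have no arithmetic besides the one on atoms below: no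
integers, no multiplication or rounding of reals. -/

/-- Values. The boolean `false` is `nil`, the boolean `true` is the cell `(nil, nil)`. -/
inductive Val {n : ℕ} (D : Type u) (Dom : Fin n → Type v) : Type (max u v)
  | nil : Val D Dom
  | pair : Val D Dom → Val D Dom → Val D Dom
  | dom : (i : Fin n) → Dom i → Val D Dom
  | sr : D → Val D Dom
  | real : ℝ → Val D Dom

open Classical in
/-- The boolean value of a proposition. -/
noncomputable def Val.ofProp {n : ℕ} {D : Type u} {Dom : Fin n → Type v} (P : Prop) :
    Val D Dom :=
  if P then .pair .nil .nil else .nil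

/-- Expressions, with variables as de Bruijn indices. -/
inductive Expr : Type
  | var : ℕ → Expr
  | letIn : Expr → Expr → Expr
  | call : ℕ → Expr → Expr
  | nil : Expr
  | pair : Expr → Expr → Expr
  | fst : Expr → Expr
  | snd : Expr → Expr
  /-- `ifPair c a b` continues with `a` if `c` is a cell and with `b` otherwise. -/
  | ifPair : Expr → Expr → Expr → Expr
  /-- Compares two values of the same domain. -/
  | domLe : Expr → Expr → Expr
  /-- `theta j e` looks up `θ^j_i` at a value `e` of the domain of variable `i`. -/
  | theta : ℕ → Expr → Expr
  | realConst : ℤ → Expr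
  | realAdd : Expr → Expr → Expr
  | realSub : Expr → Expr → Expr
  | realLe : Expr → Expr → Expr
  | srZero : Expr
  | srOne : Expr
  | srAdd : Expr → Expr → Expr
  | srMul : Expr → Expr → Expr
  | srIsZero : Expr → Expr

/-- A program: finitely many one-argument functions, which may call each other by position,
and a main expression with one variable, the input. -/
structure Program : Type where
  funs : List Expr
  main : Expr

/-- `Eval S θ fs ρ e w t`: in the environment `ρ`, with the functions `fs`, the expression `e`
evaluates to `w` in `t` steps. Every evaluation of a node of the program text is one step.
The rules are deterministic, and an expression that is applied to values of the wrong kind has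
no value. -/
inductive Eval {n k : ℕ} {D : Type u} [Semiring D] {Dom : Fin n → Type v}
    [(i : Fin n) → LinearOrder (Dom i)] (S : Fin k → Finset (Fin n))
    (θ : (j : Fin k) → (i : {i // i ∈ S j}) → Dom i.1 → ℝ) (fs : List Expr) :
    List (Val D Dom) → Expr → Val D Dom → ℕ → Prop
  | var {ρ i w} : ρ[i]? = some w → Eval S θ fs ρ (.var i) w 1
  | letIn {ρ a b x w s t} : Eval S θ fs ρ a x s → Eval S θ fs (x :: ρ) b w t →
      Eval S θ fs ρ (.letIn a b) w (s + t + 1)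
  | call {ρ f a b x w s t} : Eval S θ fs ρ a x s → fs[f]? = some b → Eval S θ fs [x] b w t →
      Eval S θ fs ρ (.call f a) w (s + t + 1)
  | nil {ρ} : Eval S θ fs ρ .nil .nil 1
  | pair {ρ a b x y s t} : Eval S θ fs ρ a x s → Eval S θ fs ρ b y t →
      Eval S θ fs ρ (.pair a b) (.pair x y) (s + t + 1)
  | fst {ρ a x y s} : Eval S θ fs ρ a (.pair x y) s → Eval S θ fs ρ (.fst a) x (s + 1)
  | snd {ρ a x y s} : Eval S θ fs ρ a (.pair x y) s → Eval S θ fs ρ (.snd a) y (s + 1)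
  | ifPair_true {ρ c a b x y w s t} : Eval S θ fs ρ c (.pair x y) s → Eval S θ fs ρ a w t →
      Eval S θ fs ρ (.ifPair c a b) w (s + t + 1)
  | ifPair_false {ρ c a b z w s t} : Eval S θ fs ρ c z s → (∀ x y, z ≠ .pair x y) →
      Eval S θ fs ρ b w t → Eval S θ fs ρ (.ifPair c a b) w (s + t + 1)
  | domLe {ρ a b i} {x y : Dom i} {s t} : Eval S θ fs ρ a (.dom i x) s →
      Eval S θ fs ρ b (.dom i y) t →
      Eval S θ fs ρ (.domLe a b) (Val.ofProp (x ≤ y)) (s + t + 1)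
  | theta {ρ a i} {x : Dom i} {j : Fin k} {s} (h : i ∈ S j) : Eval S θ fs ρ a (.dom i x) s →
      Eval S θ fs ρ (.theta j a) (.real (θ j ⟨i, h⟩ x)) (s + 1)
  | realConst {ρ z} : Eval S θ fs ρ (.realConst z) (.real z) 1
  | realAdd {ρ a b} {x y : ℝ} {s t} : Eval S θ fs ρ a (.real x) s → Eval S θ fs ρ b (.real y) t →
      Eval S θ fs ρ (.realAdd a b) (.real (x + y)) (s + t + 1)
  | realSub {ρ a b} {x y : ℝ} {s t} : Eval S θ fs ρ a (.real x) s → Eval S θ fs ρ b (.real y) t →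
      Eval S θ fs ρ (.realSub a b) (.real (x - y)) (s + t + 1)
  | realLe {ρ a b} {x y : ℝ} {s t} : Eval S θ fs ρ a (.real x) s → Eval S θ fs ρ b (.real y) t →
      Eval S θ fs ρ (.realLe a b) (Val.ofProp (x ≤ y)) (s + t + 1)
  | srZero {ρ} : Eval S θ fs ρ .srZero (.sr 0) 1
  | srOne {ρ} : Eval S θ fs ρ .srOne (.sr 1) 1
  | srAdd {ρ a b} {x y : D} {s t} : Eval S θ fs ρ a (.sr x) s → Eval S θ fs ρ b (.sr y) t →
      Eval S θ fs ρ (.srAdd a b) (.sr (x + y)) (s + t + 1)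
  | srMul {ρ a b} {x y : D} {s t} : Eval S θ fs ρ a (.sr x) s → Eval S θ fs ρ b (.sr y) t →
      Eval S θ fs ρ (.srMul a b) (.sr (x * y)) (s + t + 1)
  | srIsZero {ρ a} {x : D} {s} : Eval S θ fs ρ a (.sr x) s →
      Eval S θ fs ρ (.srIsZero a) (Val.ofProp (x = 0)) (s + 1)

/-- The program `p` maps `input` to `output` in exactly `t` steps. -/
def Program.Runs {n k : ℕ} {D : Type u} [Semiring D] {Dom : Fin n → Type v}
    [(i : Fin n) → LinearOrder (Dom i)] (p : Program) (S : Fin k → Finset (Fin n))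
    (θ : (j : Fin k) → (i : {i // i ∈ S j}) → Dom i.1 → ℝ)
    (input output : Val D Dom) (t : ℕ) : Prop :=
  Eval S θ p.funs [input] p.main output t

/-! ### Representation of factors -/

/-- Lists of values as chains of cells. -/
def Val.ofList {n : ℕ} {D : Type u} {Dom : Fin n → Type v} : List (Val D Dom) → Val D Dom
  | [] => .nil
  | a :: l => .pair a (Val.ofList l)

/-- A tuple is stored as the list of its entries, in the order of the variables. -/
def Val.ofTuple {n : ℕ} {D : Type u} {Dom : Fin n → Type v} {K : Finset (Fin n)}
    (x : Tuple Dom K) : Val D Dom :=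
  Val.ofList ((List.finRange n).filterMap fun i =>
    if h : i ∈ K then some (Val.dom i (x ⟨i, h⟩)) else none)

/-- `IsTable Φ w`: the value `w` stores the factor `Φ` as a list, in any order, of the tuples of
its support, each exactly once and together with the value of `Φ` at it. (Such a `w` exists if
and only if the support is finite.) -/
def IsTable {n : ℕ} {D : Type u} [Semiring D] {Dom : Fin n → Type v} {K : Finset (Fin n)}
    (Φ : Tuple Dom K → D) (w : Val D Dom) : Prop :=
  ∃ l : List (Tuple Dom K), l.Nodup ∧ (∀ x, x ∈ l ↔ Φ x ≠ 0) ∧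
    w = Val.ofList (l.map fun x => Val.pair (Val.ofTuple x) (Val.sr (Φ x)))

end FAQAI

set_option linter.unusedSimpArgs false
set_option linter.unusedSectionVars false

namespace FAQAI

section Calculus

variable {n k : ℕ} {D : Type u} {Dom : Fin n → Type v}

/-! ### A weakest-precondition calculus -/

/-! Call the entries x of Φ₁ queries and the entries y of Φ₂ points. As U ∪ L is everything, a full
tuple is a pair (x, y) that agrees on U ∩ L, and the j-th linear form splits into a part a_j(x) over
U and a part b_j(y) over L \ U, so the j-th inequality reads a_j(x) ≤ -b_j(y). As F ⊆ U, the output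
tuple is a projection of x. Hence Q(f) is the sum, over the queries x above f, of Φ₁(x) times the
total weight of the points that lie in the group of x (same values on U ∩ L) and dominate x in k
real coordinates (`query_eq_sum`). It remains to compute these dominance sums for at most 2N items.
A semiring has no subtraction, so the sums must be assembled from disjoint pieces.

Every sort key ends with a flag, 0 for queries and 1 for points. Then a query and a point never have
equal keys, and `≤` of coordinates becomes `<` of keys (`dominanceKeys_ne`, `dominanceKeys_lt`). One
coordinate costs no logarithm beyond sorting: once the items are sorted by group, first coordinate
and flag, domination in it within a group means standing later in the list (`domSum_eq_strictSum`).
Each of the other k - 1 coordinates is replaced by a binary rank with O(log N) digits (`call_rank`).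

The recursion looks at the first digit of the first rank. An item with digit 1 is dominated only by
items with digit 1. An item with digit 0 is dominated by items with digit 0, compared by the later
digits, and by items with digit 1, for which this rank no longer matters (`domSum_half_true`,
`domSum_half_false`). So an item enters one half and one instance with a rank fewer, and without
ranks one pass of suffix sums inside the groups is enough (`call_suffix`). Each item visits O((log
N)^(k-1)) nodes, with constant work per visit (`visits_le`, `call_solve`). Sorting costs N log N,
which explains the exponent max(k - 1, 1). At the end the sums are multiplied by Φ₁, collected by
output tuple after another sort, and zeros are removed (`wp_pipeline`).

Correctness and time are proved together: `Call` bounds the time of a function on an input and names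
its value, and the `wp` equivalences let `simp` execute a function body up to its next call. -/

/-- The first component of a cell. -/
def Val.fst? : Val D Dom → Option (Val D Dom)
  | .pair x _ => some x
  | _ => none

/-- The second component of a cell. -/
def Val.snd? : Val D Dom → Option (Val D Dom)
  | .pair _ y => some y
  | _ => none

/-- The semiring element stored in a value. -/
def Val.sr? : Val D Dom → Option D
  | .sr x => some x
  | _ => none

/-- The real number stored in a value. -/
def Val.real? : Val D Dom → Option ℝ
  | .real x => some x
  | _ => none

/-- Whether a value is a cell. -/
def Val.IsPair : Val D Dom → Prop
  | .pair _ _ => True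
  | _ => False

/-- The boolean value of a boolean. -/
def Val.ofBool : Bool → Val D Dom
  | true => .pair .nil .nil
  | false => .nil

@[simp] theorem Val.fst?_pair (x y : Val D Dom) : (Val.pair x y).fst? = some x := rfl
@[simp] theorem Val.snd?_pair (x y : Val D Dom) : (Val.pair x y).snd? = some y := rfl
@[simp] theorem Val.sr?_sr (x : D) : (Val.sr x : Val D Dom).sr? = some x := rfl
@[simp] theorem Val.real?_real (x : ℝ) : (Val.real x : Val D Dom).real? = some x := rfl
@[simp] theorem Val.isPair_pair (x y : Val D Dom) : (Val.pair x y).IsPair ↔ True := Iff.rfl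
@[simp] theorem Val.isPair_nil : (Val.nil : Val D Dom).IsPair ↔ False := Iff.rfl
@[simp] theorem Val.isPair_ofBool (b : Bool) : (Val.ofBool b : Val D Dom).IsPair ↔ b = true := by
  cases b <;> simp [Val.ofBool]
@[simp] theorem Val.isPair_ofProp (p : Prop) : (Val.ofProp p : Val D Dom).IsPair ↔ p := by
  by_cases h : p <;> simp [Val.ofProp, h]
@[simp] theorem Val.ofList_nil : Val.ofList ([] : List (Val D Dom)) = .nil := rfl
@[simp] theorem Val.ofList_cons (a : Val D Dom) (l : List (Val D Dom)) :
    Val.ofList (a :: l) = .pair a (Val.ofList l) := rfl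

theorem Val.fst?_eq {v x : Val D Dom} : v.fst? = some x ↔ ∃ y, v = .pair x y := by
  cases v <;> simp [Val.fst?]
theorem Val.snd?_eq {v y : Val D Dom} : v.snd? = some y ↔ ∃ x, v = .pair x y := by
  cases v <;> simp [Val.snd?]
theorem Val.sr?_eq {v : Val D Dom} {x : D} : v.sr? = some x ↔ v = .sr x := by
  cases v <;> simp [Val.sr?]
theorem Val.real?_eq {v : Val D Dom} {x : ℝ} : v.real? = some x ↔ v = .real x := by
  cases v <;> simp [Val.real?]
theorem Val.isPair_iff {v : Val D Dom} : v.IsPair ↔ ∃ x y, v = .pair x y := by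
  cases v <;> simp [Val.IsPair]

variable [(i : Fin n) → LinearOrder (Dom i)]

/-- Two values of the same domain whose comparison satisfies `Q`. -/
def Val.DomCmp (v w : Val D Dom) (Q : Prop → Prop) : Prop :=
  ∃ i, ∃ x y : Dom i, v = .dom i x ∧ w = .dom i y ∧ Q (x ≤ y)

@[simp] theorem Val.domCmp_dom {i : Fin n} {x y : Dom i} {Q : Prop → Prop} :
    (Val.dom i x : Val D Dom).DomCmp (.dom i y) Q ↔ Q (x ≤ y) := by
  constructor
  · rintro ⟨j, x', y', h1, h2, h⟩
    cases h1
    cases h2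
    exact h
  · exact fun h => ⟨_, _, _, rfl, rfl, h⟩

variable [Semiring D] (S : Fin k → Finset (Fin n))
  (θ : (j : Fin k) → (i : {i // i ∈ S j}) → Dom i.1 → ℝ) (fs : List Expr)

/-- `e` has a value and an evaluation time that satisfy `P`. -/
def wp (ρ : List (Val D Dom)) (e : Expr) (P : Val D Dom → ℕ → Prop) : Prop :=
  ∃ w t, Eval S θ fs ρ e w t ∧ P w t

/-- The function `f` has on `x` a value and an evaluation time that satisfy `P`. -/
def wpCall (f : ℕ) (x : Val D Dom) (P : Val D Dom → ℕ → Prop) : Prop :=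
  ∃ b, fs[f]? = some b ∧ wp S θ fs [x] b P

/-- The function `f` maps `x` to `w` in at most `T` steps. -/
def Call (f : ℕ) (x w : Val D Dom) (T : ℕ) : Prop :=
  wpCall S θ fs f x fun v t => v = w ∧ t ≤ T

variable {S θ fs}

theorem wp.mono {ρ : List (Val D Dom)} {e : Expr} {P Q : Val D Dom → ℕ → Prop}
    (h : wp S θ fs ρ e P) (hPQ : ∀ w t, P w t → Q w t) :
    wp S θ fs ρ e Q := by
  obtain ⟨w, t, h1, h2⟩ := h
  exact ⟨w, t, h1, hPQ _ _ h2⟩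

/-- The only fact needed at a call site: the continuation has to accept every time up to the bound,
so exact running times never have to be known. -/
theorem Call.wpCall {f : ℕ} {x w : Val D Dom} {T : ℕ} {P : Val D Dom → ℕ → Prop}
    (h : Call S θ fs f x w T) (hP : ∀ t ≤ T, P w t) : wpCall S θ fs f x P := by
  obtain ⟨b, hb, w', t, h1, rfl, h3⟩ := h
  exact ⟨b, hb, w', t, h1, hP _ h3⟩

theorem Call.mono {f : ℕ} {x w : Val D Dom} {T T' : ℕ}
    (h : Call S θ fs f x w T) (hT : T ≤ T') : Call S θ fs f x w T' :=
  h.wpCall fun _ ht => ⟨rfl, ht.trans hT⟩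

theorem wpCall_of {f : ℕ} {x : Val D Dom} {P : Val D Dom → ℕ → Prop} {b : Expr}
    (hb : fs[f]? = some b) (h : wp S θ fs [x] b P) : wpCall S θ fs f x P := ⟨b, hb, h⟩

theorem Call.of {f : ℕ} {x w : Val D Dom} {T : ℕ} {b : Expr} (hb : fs[f]? = some b)
    (h : wp S θ fs [x] b fun v t => v = w ∧ t ≤ T) : Call S θ fs f x w T := ⟨b, hb, h⟩

variable {ρ : List (Val D Dom)} {P : Val D Dom → ℕ → Prop}

/-! ### Symbolic execution, one equivalence per kind of node -/

theorem wp_var {i} : wp S θ fs ρ (.var i) P ↔ ∃ w, ρ[i]? = some w ∧ P w 1 := by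
  constructor
  · rintro ⟨w, t, h, hP⟩; cases h; exact ⟨_, ‹_›, hP⟩
  · rintro ⟨w, h, hP⟩; exact ⟨_, _, .var h, hP⟩

theorem wp_letIn {a b} : wp S θ fs ρ (.letIn a b) P ↔
    wp S θ fs ρ a fun x s => wp S θ fs (x :: ρ) b fun w t => P w (s + t + 1) := by
  constructor
  · rintro ⟨w, t, h, hP⟩; cases h with | letIn h1 h2 => exact ⟨_, _, h1, _, _, h2, hP⟩
  · rintro ⟨_, _, h1, _, _, h2, hP⟩; exact ⟨_, _, .letIn h1 h2, hP⟩

theorem wp_call {f a} : wp S θ fs ρ (.call f a) P ↔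
    wp S θ fs ρ a fun x s => wpCall S θ fs f x fun w t => P w (s + t + 1) := by
  constructor
  · rintro ⟨w, t, h, hP⟩; cases h with | call h1 h2 h3 => exact ⟨_, _, h1, _, h2, _, _, h3, hP⟩
  · rintro ⟨_, _, h1, _, h2, _, _, h3, hP⟩; exact ⟨_, _, .call h1 h2 h3, hP⟩

theorem wp_nil : wp S θ fs ρ .nil P ↔ P .nil 1 := by
  constructor
  · rintro ⟨w, t, h, hP⟩; cases h; exact hP
  · exact fun h => ⟨_, _, .nil, h⟩

theorem wp_pair {a b} : wp S θ fs ρ (.pair a b) P ↔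
    wp S θ fs ρ a fun x s => wp S θ fs ρ b fun y t => P (.pair x y) (s + t + 1) := by
  constructor
  · rintro ⟨w, t, h, hP⟩; cases h with | pair h1 h2 => exact ⟨_, _, h1, _, _, h2, hP⟩
  · rintro ⟨_, _, h1, _, _, h2, hP⟩; exact ⟨_, _, .pair h1 h2, hP⟩

theorem wp_fst {a} : wp S θ fs ρ (.fst a) P ↔
    wp S θ fs ρ a fun v s => ∃ x, v.fst? = some x ∧ P x (s + 1) := by
  constructor
  · rintro ⟨w, t, h, hP⟩; cases h with | fst h1 => exact ⟨_, _, h1, _, rfl, hP⟩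
  · rintro ⟨_, _, h1, x, h2, hP⟩
    obtain ⟨y, rfl⟩ := Val.fst?_eq.1 h2
    exact ⟨_, _, .fst h1, hP⟩

theorem wp_snd {a} : wp S θ fs ρ (.snd a) P ↔
    wp S θ fs ρ a fun v s => ∃ x, v.snd? = some x ∧ P x (s + 1) := by
  constructor
  · rintro ⟨w, t, h, hP⟩; cases h with | snd h1 => exact ⟨_, _, h1, _, rfl, hP⟩
  · rintro ⟨_, _, h1, x, h2, hP⟩
    obtain ⟨y, rfl⟩ := Val.snd?_eq.1 h2
    exact ⟨_, _, .snd h1, hP⟩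

-- Both evaluation rules of the conditional are merged into one `if`, so that a known test value
-- leaves a single branch to execute.
open Classical in
theorem wp_ifPair {c a b} : wp S θ fs ρ (.ifPair c a b) P ↔
    wp S θ fs ρ c fun v s => if v.IsPair then wp S θ fs ρ a fun w t => P w (s + t + 1)
      else wp S θ fs ρ b fun w t => P w (s + t + 1) := by
  constructor
  · rintro ⟨w, t, h, hP⟩
    cases h with
    | ifPair_true h1 h2 =>
      refine ⟨_, _, h1, ?_⟩
      beta_reduce
      rw [if_pos (by simp)]
      exact ⟨_, _, h2, hP⟩
    | ifPair_false h1 h2 h3 =>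
      refine ⟨_, _, h1, ?_⟩
      beta_reduce
      rw [if_neg (by simpa [Val.isPair_iff] using h2)]
      exact ⟨_, _, h3, hP⟩
  · rintro ⟨v, s, h1, h2⟩
    by_cases hv : v.IsPair
    · rw [if_pos hv] at h2
      obtain ⟨_, _, h2, hP⟩ := h2
      obtain ⟨x, y, rfl⟩ := Val.isPair_iff.1 hv
      exact ⟨_, _, .ifPair_true h1 h2, hP⟩
    · rw [if_neg hv] at h2
      obtain ⟨_, _, h2, hP⟩ := h2
      exact ⟨_, _, .ifPair_false h1 (fun x y h => hv (Val.isPair_iff.2 ⟨x, y, h⟩)) h2, hP⟩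

theorem wp_domLe {a b} : wp S θ fs ρ (.domLe a b) P ↔
    wp S θ fs ρ a fun v s => wp S θ fs ρ b fun w t =>
      v.DomCmp w fun p => P (.ofProp p) (s + t + 1) := by
  constructor
  · rintro ⟨w, t, h, hP⟩
    cases h with | domLe h1 h2 => exact ⟨_, _, h1, _, _, h2, ⟨_, _, _, rfl, rfl, hP⟩⟩
  · rintro ⟨_, _, h1, _, _, h2, ⟨_, _, _, rfl, rfl, hP⟩⟩
    exact ⟨_, _, .domLe h1 h2, hP⟩

theorem wp_realLe {a b} : wp S θ fs ρ (.realLe a b) P ↔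
    wp S θ fs ρ a fun v s => wp S θ fs ρ b fun w t =>
      ∃ x, v.real? = some x ∧ ∃ y, w.real? = some y ∧ P (.ofProp (x ≤ y)) (s + t + 1) := by
  constructor
  · rintro ⟨w, t, h, hP⟩
    cases h with | realLe h1 h2 => exact ⟨_, _, h1, _, _, h2, _, rfl, _, rfl, hP⟩
  · rintro ⟨_, _, h1, _, _, h2, x, hx, y, hy, hP⟩
    rw [Val.real?_eq] at hx hy
    subst hx hy
    exact ⟨_, _, .realLe h1 h2, hP⟩

theorem wp_srZero : wp S θ fs ρ .srZero P ↔ P (.sr 0) 1 := by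
  constructor
  · rintro ⟨w, t, h, hP⟩; cases h; exact hP
  · exact fun h => ⟨_, _, .srZero, h⟩

theorem wp_srAdd {a b} : wp S θ fs ρ (.srAdd a b) P ↔
    wp S θ fs ρ a fun v s => wp S θ fs ρ b fun w t =>
      ∃ x, v.sr? = some x ∧ ∃ y, w.sr? = some y ∧ P (.sr (x + y)) (s + t + 1) := by
  constructor
  · rintro ⟨w, t, h, hP⟩
    cases h with | srAdd h1 h2 => exact ⟨_, _, h1, _, _, h2, _, rfl, _, rfl, hP⟩
  · rintro ⟨_, _, h1, _, _, h2, x, hx, y, hy, hP⟩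
    rw [Val.sr?_eq] at hx hy
    subst hx hy
    exact ⟨_, _, .srAdd h1 h2, hP⟩

theorem wp_srMul {a b} : wp S θ fs ρ (.srMul a b) P ↔
    wp S θ fs ρ a fun v s => wp S θ fs ρ b fun w t =>
      ∃ x, v.sr? = some x ∧ ∃ y, w.sr? = some y ∧ P (.sr (x * y)) (s + t + 1) := by
  constructor
  · rintro ⟨w, t, h, hP⟩
    cases h with | srMul h1 h2 => exact ⟨_, _, h1, _, _, h2, _, rfl, _, rfl, hP⟩
  · rintro ⟨_, _, h1, _, _, h2, x, hx, y, hy, hP⟩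
    rw [Val.sr?_eq] at hx hy
    subst hx hy
    exact ⟨_, _, .srMul h1 h2, hP⟩

theorem wp_srIsZero {a} : wp S θ fs ρ (.srIsZero a) P ↔
    wp S θ fs ρ a fun v s => ∃ x, v.sr? = some x ∧ P (.ofProp (x = 0)) (s + 1) := by
  constructor
  · rintro ⟨w, t, h, hP⟩; cases h with | srIsZero h1 => exact ⟨_, _, h1, _, rfl, hP⟩
  · rintro ⟨_, _, h1, x, h2, hP⟩
    rw [Val.sr?_eq] at h2
    subst h2
    exact ⟨_, _, .srIsZero h1, hP⟩

end Calculus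

/-! ### The program -/

/-- The truth value `true`. -/
abbrev eTrue : Expr := .pair .nil .nil

/-- Lexicographic comparison of two keys. -/
def keyLeE : Expr :=
  .ifPair (.fst (.var 0))
    (.letIn (.fst (.fst (.var 0))) (.letIn (.fst (.snd (.var 1)))
      (.ifPair
        (.ifPair (.fst (.var 1)) (.realLe (.snd (.var 1)) (.snd (.var 0)))
          (.domLe (.snd (.var 1)) (.snd (.var 0))))
        (.ifPair
          (.ifPair (.fst (.var 1)) (.realLe (.snd (.var 0)) (.snd (.var 1)))
            (.domLe (.snd (.var 0)) (.snd (.var 1))))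
          (.call 0 (.pair (.snd (.fst (.var 2))) (.snd (.snd (.var 2)))))
          eTrue)
        .nil)))
    eTrue

/-- Merges two lists of items that are sorted by their first keys. -/
def mergeE : Expr :=
  .ifPair (.fst (.var 0))
    (.ifPair (.snd (.var 0))
      (.ifPair (.call 0 (.pair (.fst (.fst (.fst (.fst (.var 0)))))
          (.fst (.fst (.fst (.snd (.var 0)))))))
        (.pair (.fst (.fst (.var 0))) (.call 1 (.pair (.snd (.fst (.var 0))) (.snd (.var 0)))))
        (.pair (.fst (.snd (.var 0))) (.call 1 (.pair (.fst (.var 0)) (.snd (.snd (.var 0)))))))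
      (.fst (.var 0)))
    (.snd (.var 0))

/-- Deals a list into two halves. -/
def dealE : Expr :=
  .ifPair (.var 0)
    (.letIn (.call 2 (.snd (.var 0)))
      (.pair (.pair (.fst (.var 1)) (.snd (.var 0))) (.fst (.var 0))))
    (.pair .nil .nil)

/-- Merge sort by the first keys. -/
def sortE : Expr :=
  .ifPair (.var 0)
    (.ifPair (.snd (.var 0))
      (.letIn (.call 2 (.var 0))
        (.call 1 (.pair (.call 3 (.fst (.var 0))) (.call 3 (.snd (.var 0))))))
      (.var 0))
    .nil

/-- Increments a binary counter, most significant bit first, and returns the carry with it. -/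
def incE : Expr :=
  .ifPair (.var 0)
    (.letIn (.call 4 (.snd (.var 0)))
      (.ifPair (.fst (.var 0))
        (.ifPair (.fst (.var 1))
          (.pair eTrue (.pair .nil (.snd (.var 0))))
          (.pair .nil (.pair eTrue (.snd (.var 0)))))
        (.pair .nil (.pair (.fst (.var 1)) (.snd (.var 0))))))
    (.pair eTrue .nil)

/-- A zero counter that is long enough to count a list. -/
def zerosE : Expr :=
  .ifPair (.var 0) (.pair .nil (.call 5 (.snd (.call 2 (.var 0))))) .nil

/-- Drops the first keys of the items and attaches the successive values of a counter. -/
def attachE : Expr :=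
  .ifPair (.snd (.var 0))
    (.letIn (.fst (.snd (.var 0)))
      (.pair
        (.pair (.snd (.fst (.var 0)))
          (.pair (.pair (.fst (.var 1)) (.fst (.snd (.var 0)))) (.snd (.snd (.var 0)))))
        (.call 6 (.pair (.snd (.call 4 (.fst (.var 1)))) (.snd (.snd (.var 1)))))))
    .nil

/-- Replaces all keys but the last by ranks, and sorts by the last. -/
def rankE : Expr :=
  .ifPair (.var 0)
    (.letIn (.call 3 (.var 0))
      (.ifPair (.snd (.fst (.fst (.var 0))))
        (.call 7 (.call 6 (.pair (.call 5 (.var 0)) (.var 0))))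
        (.var 0)))
    .nil

/-- The first bit of the first rank of the first item of a list. -/
abbrev headBitE (e : Expr) : Expr := .fst (.fst (.fst (.snd (.fst e))))

/-- Drops the first bit of the first rank of the first item of a list. -/
abbrev popBitE (e : Expr) : Expr :=
  .pair (.fst (.fst e))
    (.pair (.pair (.snd (.fst (.fst (.snd (.fst e))))) (.snd (.fst (.snd (.fst e)))))
      (.snd (.snd (.fst e))))

/-- The items with first bit `false`, which is dropped. -/
def loE : Expr :=
  .ifPair (.var 0)
    (.ifPair (headBitE (.var 0)) (.call 8 (.snd (.var 0)))
      (.pair (popBitE (.var 0)) (.call 8 (.snd (.var 0)))))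
    .nil

/-- The items with first bit `true`, which is dropped. -/
def hiE : Expr :=
  .ifPair (.var 0)
    (.ifPair (headBitE (.var 0)) (.pair (popBitE (.var 0)) (.call 9 (.snd (.var 0))))
      (.call 9 (.snd (.var 0))))
    .nil

/-- Function `f` maps `e` over a list. -/
def mapE (f : ℕ) (e : Expr) : Expr :=
  .ifPair (.var 0) (.pair (.letIn (.fst (.var 0)) e) (.call f (.snd (.var 0)))) .nil

/-- Drops the first rank of an item, and its weight if the first bit is `false`. -/
def crossE : Expr :=
  .pair (.fst (.var 0)) (.pair (.snd (.fst (.snd (.var 0))))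
    (.ifPair (.fst (.fst (.fst (.snd (.var 0))))) (.snd (.snd (.var 0))) .srZero))

/-- Drops the first rank of an item. -/
def popE : Expr :=
  .pair (.fst (.var 0)) (.pair (.snd (.fst (.snd (.var 0)))) (.snd (.snd (.var 0))))

/-- Recombines the results of the three recursive calls. -/
def joinE : Expr :=
  .ifPair (.fst (.var 0))
    (.ifPair (headBitE (.fst (.var 0)))
      (.pair (.fst (.snd (.snd (.snd (.var 0)))))
        (.call 12 (.pair (.snd (.fst (.var 0))) (.pair (.snd (.fst (.snd (.var 0))))
          (.pair (.fst (.snd (.snd (.var 0)))) (.snd (.snd (.snd (.snd (.var 0))))))))))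
      (.pair (.srAdd (.fst (.fst (.snd (.snd (.var 0))))) (.fst (.fst (.snd (.var 0)))))
        (.call 12 (.pair (.snd (.fst (.var 0))) (.pair (.snd (.fst (.snd (.var 0))))
          (.pair (.snd (.fst (.snd (.snd (.var 0))))) (.snd (.snd (.snd (.var 0))))))))))
    .nil

/-- Suffix sums of the weights within the groups. -/
def suffixE : Expr :=
  .ifPair (.var 0)
    (.letIn (.call 13 (.snd (.var 0)))
      (.ifPair (.var 0)
        (.ifPair (.call 0 (.pair (.fst (.fst (.snd (.var 1)))) (.fst (.fst (.var 1)))))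
          (.pair (.srAdd (.snd (.snd (.fst (.var 1)))) (.fst (.var 0))) (.var 0))
          (.pair (.snd (.snd (.fst (.var 1)))) (.var 0)))
        (.pair (.snd (.snd (.fst (.var 1)))) .nil)))
    .nil

/-- Dominance sums by divide and conquer. -/
def solveE : Expr :=
  .ifPair (.var 0)
    (.ifPair (.fst (.snd (.fst (.var 0))))
      (.ifPair (.fst (.fst (.snd (.fst (.var 0)))))
        (.call 12 (.pair (.var 0) (.pair (.call 14 (.call 10 (.var 0)))
          (.pair (.call 14 (.call 8 (.var 0))) (.call 14 (.call 9 (.var 0)))))))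
        (.call 14 (.call 11 (.var 0))))
      (.call 13 (.var 0)))
    .nil

/-- Keeps the group, the ranks and the weight of an item. -/
def stripE : Expr :=
  .pair (.fst (.snd (.snd (.var 0))))
    (.pair (.fst (.snd (.var 0))) (.fst (.snd (.snd (.snd (.var 0))))))

/-- Multiplies the values of the query items by the results. -/
def finishE : Expr :=
  .ifPair (.fst (.var 0))
    (.letIn (.snd (.snd (.snd (.snd (.fst (.fst (.var 0)))))))
      (.ifPair (.var 0)
        (.pair
          (.pair (.pair (.fst (.var 0)) .nil)
            (.pair (.fst (.snd (.var 0))) (.srMul (.snd (.snd (.var 0))) (.fst (.snd (.var 1))))))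
          (.call 16 (.pair (.snd (.fst (.var 1))) (.snd (.snd (.var 1))))))
        (.call 16 (.pair (.snd (.fst (.var 1))) (.snd (.snd (.var 1)))))))
    .nil

/-- Adds up the values of consecutive items with the same key. -/
def combineE : Expr :=
  .ifPair (.var 0)
    (.letIn (.call 17 (.snd (.var 0)))
      (.ifPair (.var 0)
        (.ifPair (.call 0 (.pair (.fst (.fst (.fst (.var 0)))) (.fst (.fst (.fst (.var 1))))))
          (.pair (.pair (.fst (.fst (.var 1))) (.pair (.fst (.snd (.fst (.var 1))))
            (.srAdd (.snd (.snd (.fst (.var 1)))) (.snd (.snd (.fst (.var 0)))))))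
            (.snd (.var 0)))
          (.pair (.fst (.var 1)) (.var 0)))
        (.pair (.fst (.var 1)) .nil)))
    .nil

/-- Drops the keys and the items with value zero. -/
def nonzeroE : Expr :=
  .ifPair (.var 0)
    (.ifPair (.srIsZero (.snd (.snd (.fst (.var 0))))) (.call 18 (.snd (.var 0)))
      (.pair (.snd (.fst (.var 0))) (.call 18 (.snd (.var 0)))))
    .nil

/-- Concatenates two lists. -/
def appendE : Expr :=
  .ifPair (.fst (.var 0))
    (.pair (.fst (.fst (.var 0))) (.call 19 (.pair (.snd (.fst (.var 0))) (.snd (.var 0)))))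
    (.snd (.var 0))

/-- The functions of the program. The expressions `c₁` and `c₂` turn the entries of the input
factors into items. -/
def funs (c₁ c₂ : Expr) : List Expr :=
  [keyLeE, mergeE, dealE, sortE, incE, zerosE, attachE, rankE, loE, hiE, mapE 10 crossE,
    mapE 11 popE, joinE, suffixE, solveE, mapE 15 stripE, finishE, combineE, nonzeroE, appendE,
    mapE 20 c₁, mapE 21 c₂]

/-- The main expression of the program. -/
def mainE : Expr :=
  .letIn (.call 7 (.call 19 (.pair (.call 20 (.fst (.var 0))) (.call 21 (.snd (.var 0))))))
    (.call 18 (.call 17 (.call 3 (.call 16 (.pair (.var 0) (.call 14 (.call 15 (.var 0))))))))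

/-! ### Keys -/

/-- The entries of keys. -/
def Atom {n : ℕ} (Dom : Fin n → Type v) : Type v := (Σₗ i, Dom i) ⊕ₗ ℝ

noncomputable instance {n : ℕ} (Dom : Fin n → Type v) [(i : Fin n) → LinearOrder (Dom i)] :
    LinearOrder (Atom Dom) :=
  inferInstanceAs (LinearOrder ((Σₗ i, Dom i) ⊕ₗ ℝ))

/-- Sort keys. -/
abbrev Key {n : ℕ} (Dom : Fin n → Type v) : Type v := List (Atom Dom)

section Keys

variable {n k : ℕ} {D : Type u} {Dom : Fin n → Type v}

/-- A domain value as an entry of a key. -/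
def Atom.dom (i : Fin n) (x : Dom i) : Atom Dom := toLex (Sum.inl (toLex ⟨i, x⟩))

/-- A real number as an entry of a key. -/
def Atom.real (x : ℝ) : Atom Dom := toLex (Sum.inr x)

/-- The domain that an entry of a key belongs to. -/
def Atom.shape (a : Atom Dom) : Option (Fin n) :=
  Sum.elim (fun p => some (ofLex p).1) (fun _ => none) (ofLex a)

/-- An entry of a key is stored with a tag. -/
def Val.ofAtom (a : Atom Dom) : Val D Dom :=
  Sum.elim (fun p => .pair .nil (.dom (ofLex p).1 (ofLex p).2))
    (fun x => .pair (.pair .nil .nil) (.real x)) (ofLex a)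

/-- A key is stored as a list. -/
def Val.ofKey (a : Key Dom) : Val D Dom := .ofList (a.map Val.ofAtom)

/-- Two keys are comparable. -/
def SameShape (a b : Key Dom) : Prop := a.map Atom.shape = b.map Atom.shape

theorem Atom.cases (a : Atom Dom) : (∃ i x, a = Atom.dom i x) ∨ ∃ x, a = Atom.real x := by
  rcases a with ⟨i, x⟩ | x
  · exact .inl ⟨i, x, rfl⟩
  · exact .inr ⟨x, rfl⟩

@[simp] theorem Val.ofAtom_dom (i : Fin n) (x : Dom i) :
    (Val.ofAtom (Atom.dom i x) : Val D Dom) = .pair .nil (.dom i x) := rfl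
@[simp] theorem Val.ofAtom_real (x : ℝ) :
    (Val.ofAtom (Atom.real x : Atom Dom) : Val D Dom) = .pair (.pair .nil .nil) (.real x) := rfl
@[simp] theorem Atom.shape_dom (i : Fin n) (x : Dom i) : (Atom.dom i x).shape = some i := rfl
@[simp] theorem Atom.shape_real (x : ℝ) : (Atom.real x : Atom Dom).shape = none := rfl
@[simp] theorem Val.ofKey_nil : (Val.ofKey ([] : Key Dom) : Val D Dom) = .nil := rfl
@[simp] theorem Val.ofKey_cons (a : Atom Dom) (l : Key Dom) :
    (Val.ofKey (a :: l) : Val D Dom) = .pair (.ofAtom a) (.ofKey l) := rfl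

theorem Atom.dom_injective {i : Fin n} {x y : Dom i} (h : Atom.dom i x = Atom.dom i y) :
    x = y := by
  have h : (⟨i, x⟩ : Sigma Dom) = ⟨i, y⟩ := Sum.inl_injective h
  simpa using h

variable [Semiring D] [(i : Fin n) → LinearOrder (Dom i)]
  {S : Fin k → Finset (Fin n)} {θ : (j : Fin k) → (i : {i // i ∈ S j}) → Dom i.1 → ℝ}

theorem Atom.dom_le {i : Fin n} {x y : Dom i} : Atom.dom i x ≤ Atom.dom i y ↔ x ≤ y := by
  refine (Sum.Lex.inl_le_inl_iff (α := Σₗ i, Dom i) (β := ℝ)).trans (Sigma.Lex.le_def.trans ?_)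
  change i < i ∨ (∃ h : i = i, h ▸ x ≤ y) ↔ _
  simp

theorem Atom.real_le {x y : ℝ} : (Atom.real x : Atom Dom) ≤ Atom.real y ↔ x ≤ y :=
  Sum.Lex.inr_le_inr_iff

/-- The program has no equality test on entries. It compares them in both directions and goes on to
the tails only if both comparisons succeed; this is the lexicographic order in exactly that form. -/
theorem key_cons_le {α : Type*} [LinearOrder α] {x y : α} {a b : List α} :
    x :: a ≤ y :: b ↔ x ≤ y ∧ (y ≤ x → a ≤ b) := by
  rw [← not_lt, List.cons_lt_cons_iff, not_or, not_lt]
  refine and_congr_right fun h => ⟨fun h1 h2 => ?_, fun h1 h2 => ?_⟩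
  · exact not_lt.1 fun h3 => h1 ⟨h2.antisymm h, h3⟩
  · exact (h1 h2.1.le).not_gt h2.2

/-- An upper bound for the time of a comparison of keys of length at most `B`. -/
def keyCost (B : ℕ) : ℕ := 60 * B + 10

/-- `SameShape` keeps the evaluation from getting stuck, as values of different domains cannot be
compared. It also forces equal lengths, so testing only the first key for emptiness is enough. -/
theorem call_keyLe {c₁ c₂ : Expr} {B : ℕ} {a b : Key Dom} (hab : SameShape a b)
    (hB : a.length ≤ B) :
    Call S θ (funs c₁ c₂) 0 (.pair (.ofKey a) (.ofKey b) : Val D Dom) (.ofProp (a ≤ b))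
      (keyCost B) := by
  induction a generalizing b B with
  | nil =>
    refine .of rfl ?_
    simp only [wp_ifPair, wp_fst, wp_snd, wp_letIn, wp_var, wp_pair, wp_nil, wp_call,
      List.getElem?_cons_zero, List.getElem?_cons_succ, Option.some.injEq, exists_eq_left',
      Val.fst?_pair, Val.snd?_pair, Val.isPair_pair, Val.isPair_nil, if_true, if_false,
      keyLeE, Val.ofKey_nil]
    exact ⟨by simp [Val.ofProp], by unfold keyCost; omega⟩
  | cons x a ih =>
    obtain _ | ⟨y, b⟩ := b
    · simp [SameShape] at hab
    obtain ⟨hxy, hab⟩ : x.shape = y.shape ∧ SameShape a b := by simpa [SameShape] using hab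
    obtain _ | B := B
    · simp at hB
    have ih := ih hab (B := B) (by simpa using hB)
    refine .of rfl ?_
    rw [key_cons_le]
    rcases x.cases with ⟨i, x, rfl⟩ | ⟨x, rfl⟩ <;> rcases y.cases with ⟨j, y, rfl⟩ | ⟨y, rfl⟩
    · simp only [Atom.shape_dom, Option.some.injEq] at hxy
      subst hxy
      simp only [wp_ifPair, wp_fst, wp_snd, wp_letIn, wp_var, wp_pair, wp_nil, wp_call,
        List.getElem?_cons_zero, List.getElem?_cons_succ, Option.some.injEq, exists_eq_left',
        Val.fst?_pair, Val.snd?_pair, Val.isPair_pair, Val.isPair_nil, if_true, if_false,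
        keyLeE, Val.ofKey_cons, Val.ofAtom_dom, wp_domLe, Val.domCmp_dom, Val.isPair_ofProp]
      rw [Atom.dom_le, Atom.dom_le]
      split_ifs with h1 h2
      · exact ih.wpCall fun t ht => ⟨by simp [h1, h2], by unfold keyCost at *; omega⟩
      · exact ⟨by simp [h1, h2, Val.ofProp], by unfold keyCost; omega⟩
      · exact ⟨by simp [h1, Val.ofProp], by unfold keyCost; omega⟩
    · simp at hxy
    · simp at hxy
    · simp only [wp_ifPair, wp_fst, wp_snd, wp_letIn, wp_var, wp_pair, wp_nil, wp_call,
      List.getElem?_cons_zero, List.getElem?_cons_succ, Option.some.injEq, exists_eq_left',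
      Val.fst?_pair, Val.snd?_pair, Val.isPair_pair, Val.isPair_nil, if_true, if_false,
      keyLeE, Val.ofKey_cons, Val.ofAtom_real, wp_realLe, Val.real?_real, Val.isPair_ofProp]
      rw [Atom.real_le, Atom.real_le]
      split_ifs with h1 h2
      · exact ih.wpCall fun t ht => ⟨by simp [h1, h2], by unfold keyCost at *; omega⟩
      · exact ⟨by simp [h1, h2, Val.ofProp], by unfold keyCost; omega⟩
      · exact ⟨by simp [h1, Val.ofProp], by unfold keyCost; omega⟩

end Keys

/-! ### Sorting -/

section Sorting

variable {n k : ℕ} {D : Type u} {Dom : Fin n → Type v}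
  [Semiring D] [(i : Fin n) → LinearOrder (Dom i)]
  {S : Fin k → Finset (Fin n)} {θ : (j : Fin k) → (i : {i // i ∈ S j}) → Dom i.1 → ℝ}
  {c₁ c₂ : Expr} {α : Type*}

/-- An item with its first key, its further keys and its other data. -/
def Val.ofItem (key : α → Key Dom) (s r : α → Val D Dom) (x : α) : Val D Dom :=
  .pair (.pair (.ofKey (key x)) (s x)) (r x)

/-- Each step moves one item from either list after one comparison of keys, hence the nested
induction. The cost of a comparison is bounded by the length of its first key, which always comes
from `l`. -/
theorem call_merge (key : α → Key Dom) (s r : α → Val D Dom) {B : ℕ} (l m : List α)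
    (hs : ∀ x ∈ l, ∀ y ∈ m, SameShape (key x) (key y)) (hB : ∀ x ∈ l, (key x).length ≤ B) :
    Call S θ (funs c₁ c₂) 1
      (.pair (.ofList (l.map (Val.ofItem key s r))) (.ofList (m.map (Val.ofItem key s r))))
      (.ofList ((l.merge m fun x y => decide (key x ≤ key y)).map (Val.ofItem key s r)))
      ((keyCost B + 60) * (l.length + m.length) + 10) := by
  induction l generalizing m with
  | nil =>
    refine .of rfl ?_
    simp only [wp_ifPair, wp_fst, wp_snd, wp_letIn, wp_var, wp_pair, wp_nil, wp_call,
      List.getElem?_cons_zero, List.getElem?_cons_succ, Option.some.injEq, exists_eq_left',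
      Val.fst?_pair, Val.snd?_pair, Val.isPair_pair, Val.isPair_nil, if_true, if_false,
      mergeE, List.map_nil, Val.ofList_nil, List.nil_merge]
    exact ⟨trivial, by omega⟩
  | cons x l ihl =>
    induction m with
    | nil =>
      refine .of rfl ?_
      simp only [wp_ifPair, wp_fst, wp_snd, wp_letIn, wp_var, wp_pair, wp_nil, wp_call,
        List.getElem?_cons_zero, List.getElem?_cons_succ, Option.some.injEq, exists_eq_left',
        Val.fst?_pair, Val.snd?_pair, Val.isPair_pair, Val.isPair_nil, if_true, if_false,
        mergeE, List.map_nil, List.map_cons, Val.ofList_nil, Val.ofList_cons,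
        List.merge_right]
      exact ⟨trivial, by omega⟩
    | cons y m ihm =>
      refine .of rfl ?_
      simp only [wp_ifPair, wp_fst, wp_snd, wp_letIn, wp_var, wp_pair, wp_nil, wp_call,
        List.getElem?_cons_zero, List.getElem?_cons_succ, Option.some.injEq, exists_eq_left',
        Val.fst?_pair, Val.snd?_pair, Val.isPair_pair, Val.isPair_nil, if_true, if_false,
        mergeE, List.map_cons, Val.ofList_cons, Val.ofItem]
      refine (call_keyLe (hs x (by simp) y (by simp)) (hB x (by simp))).wpCall fun t ht => ?_
      simp only [Val.isPair_ofProp]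
      rw [List.cons_merge_cons]
      simp only [decide_eq_true_eq]
      split_ifs with h
      · refine (ihl (y :: m) (fun x' hx' => hs x' (by simp [hx']))
          fun x' hx' => hB x' (by simp [hx'])).wpCall fun t' ht' => ⟨rfl, ?_⟩
        simp only [List.length_cons] at *
        ring_nf at *
        omega
      · refine (ihm fun x' hx' y' hy' => hs x' hx' y' (by simp [hy'])).wpCall
          fun t' ht' => ⟨rfl, ?_⟩
        simp only [List.length_cons] at *
        ring_nf at *
        omega

/-- Deals a list into two halves. -/
def deal : List α → List α × List α
  | [] => ([], [])
  | x :: l => (x :: (deal l).2, (deal l).1)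

theorem deal_perm (l : List α) : ((deal l).1 ++ (deal l).2).Perm l := by
  induction l with
  | nil => simp [deal]
  | cons x l ih => simpa [deal] using (List.perm_append_comm.trans ih)

theorem deal_length (l : List α) :
    (deal l).1.length = (l.length + 1) / 2 ∧ (deal l).2.length = l.length / 2 := by
  induction l with
  | nil => simp [deal]
  | cons x l ih => simp only [deal, List.length_cons]; omega

theorem call_deal (f : α → Val D Dom) (l : List α) :
    Call S θ (funs c₁ c₂) 2 (.ofList (l.map f))
      (.pair (.ofList ((deal l).1.map f)) (.ofList ((deal l).2.map f))) (20 * l.length + 10) := by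
  induction l with
  | nil =>
    refine .of rfl ?_
    simp only [wp_ifPair, wp_fst, wp_snd, wp_letIn, wp_var, wp_pair, wp_nil, wp_call,
      List.getElem?_cons_zero, List.getElem?_cons_succ, Option.some.injEq, exists_eq_left',
      Val.fst?_pair, Val.snd?_pair, Val.isPair_pair, Val.isPair_nil, if_true, if_false,
      dealE, List.map_nil, Val.ofList_nil, deal]
    exact ⟨trivial, by omega⟩
  | cons x l ih =>
    refine .of rfl ?_
    simp only [wp_ifPair, wp_fst, wp_snd, wp_letIn, wp_var, wp_pair, wp_nil, wp_call,
      List.getElem?_cons_zero, List.getElem?_cons_succ, Option.some.injEq, exists_eq_left',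
      Val.fst?_pair, Val.snd?_pair, Val.isPair_pair, Val.isPair_nil, if_true, if_false,
      dealE, List.map_cons, Val.ofList_cons]
    refine ih.wpCall fun t ht => ?_
    simp only [wp_ifPair, wp_fst, wp_snd, wp_letIn, wp_var, wp_pair, wp_nil, wp_call,
      List.getElem?_cons_zero, List.getElem?_cons_succ, Option.some.injEq, exists_eq_left',
      Val.fst?_pair, Val.snd?_pair, Val.isPair_pair, Val.isPair_nil, if_true, if_false,
      deal, List.map_cons, Val.ofList_cons, List.length_cons]
    exact ⟨trivial, by omega⟩

/-- The constant in the time of sorting. -/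
def sortConst (B : ℕ) : ℕ := 2 * keyCost B + 300

theorem exists_pair_of_two_le (f : α → Val D Dom) {l : List α} (hl : 2 ≤ l.length) :
    ∃ v w, Val.ofList (l.map f) = Val.pair v w ∧ w.IsPair := by
  match l, hl with
  | x :: y :: l, _ => exact ⟨_, _, rfl, by simp⟩

theorem call_sort_of_length_le_one (f : α → Val D Dom) (l : List α) (hl : l.length ≤ 1) :
    Call S θ (funs c₁ c₂) 3 (.ofList (l.map f)) (.ofList (l.map f)) 10 := by
  refine .of rfl ?_
  match l, hl with
  | [], _ =>
    simp only [wp_ifPair, wp_fst, wp_snd, wp_letIn, wp_var, wp_pair, wp_nil, wp_call,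
      List.getElem?_cons_zero, List.getElem?_cons_succ, Option.some.injEq, exists_eq_left',
      Val.fst?_pair, Val.snd?_pair, Val.isPair_pair, Val.isPair_nil, if_true, if_false,
      sortE, List.map_nil, Val.ofList_nil]
    norm_num
  | [x], _ =>
    simp only [wp_ifPair, wp_fst, wp_snd, wp_letIn, wp_var, wp_pair, wp_nil, wp_call,
      List.getElem?_cons_zero, List.getElem?_cons_succ, Option.some.injEq, exists_eq_left',
      Val.fst?_pair, Val.snd?_pair, Val.isPair_pair, Val.isPair_nil, if_true, if_false,
      sortE, List.map_cons, List.map_nil, Val.ofList_nil, Val.ofList_cons]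
    norm_num

/-- Merge sort of depth `h`. Dealing reorders ties, so the result is described only as some sorted
permutation, which is all that later steps use. -/
theorem call_sort (key : α → Key Dom) (s r : α → Val D Dom) {B : ℕ} (h : ℕ) (L : List α)
    (hl : L.length ≤ 2 ^ h)
    (hs : ∀ x ∈ L, ∀ y ∈ L, SameShape (key x) (key y)) (hB : ∀ x ∈ L, (key x).length ≤ B) :
    ∃ l' : List α, l'.Perm L ∧ l'.Pairwise (fun x y => key x ≤ key y) ∧
      Call S θ (funs c₁ c₂) 3
        (.ofList (L.map (Val.ofItem key s r))) (.ofList (l'.map (Val.ofItem key s r)))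
        (sortConst B * (L.length * (h + 1) + 1)) := by
  have hshort : ∀ l : List α, l.length ≤ 1 → ∀ N, ∃ l' : List α, l'.Perm l ∧
      l'.Pairwise (fun x y => key x ≤ key y) ∧ Call S θ (funs c₁ c₂) 3
        (.ofList (l.map (Val.ofItem key s r))) (.ofList (l'.map (Val.ofItem key s r)))
        (sortConst B * (N + 1)) := by
    intro l hl N
    refine ⟨l, .refl _, ?_, (call_sort_of_length_le_one _ l hl).mono ?_⟩
    · match l, hl with
      | [], _ => exact .nil
      | [x], _ => simp
    · have : 300 ≤ sortConst B := by unfold sortConst; omega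
      nlinarith [Nat.zero_le (sortConst B * N)]
  induction h generalizing L with
  | zero => exact hshort L (by simpa using hl) _
  | succ h ih =>
    rcases Nat.lt_or_ge L.length 2 with hlen | hlen
    · exact hshort L (by omega) _
    · obtain ⟨h1, h2⟩ := deal_length L
      have h3 : 2 ≤ L.length := hlen
      have hp := deal_perm L
      have hm1 : ∀ z ∈ (deal L).1, z ∈ L := fun z hz => hp.subset (by simp [hz])
      have hm2 : ∀ z ∈ (deal L).2, z ∈ L := fun z hz => hp.subset (by simp [hz])
      rw [pow_succ] at hl
      obtain ⟨l₁, hp₁, hs₁, hc₁⟩ := ih (deal L).1 (by omega)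
        (fun x hx y hy => hs x (hm1 x hx) y (hm1 y hy)) (fun x hx => hB x (hm1 x hx))
      obtain ⟨l₂, hp₂, hs₂, hc₂⟩ := ih (deal L).2 (by omega)
        (fun x hx y hy => hs x (hm2 x hx) y (hm2 y hy)) (fun x hx => hB x (hm2 x hx))
      refine ⟨l₁.merge l₂ fun x y => decide (key x ≤ key y),
        (List.merge_perm_append _).trans ((hp₁.append hp₂).trans hp), ?_, .of rfl ?_⟩
      · have := List.pairwise_merge (le := fun x y => decide (key x ≤ key y))
          (fun a b c h1 h2 => by simp only [decide_eq_true_eq] at *; exact h1.trans h2)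
          (fun a b => by simpa using le_total _ _) l₁ l₂ (by simpa using hs₁) (by simpa using hs₂)
        simpa using this
      · have hd := call_deal (S := S) (θ := θ) (c₁ := c₁) (c₂ := c₂) (Val.ofItem key s r) L
        have hmg := call_merge (S := S) (θ := θ) (c₁ := c₁) (c₂ := c₂) key s r (B := B) l₁ l₂
          (fun x hx y hy => hs x (hm1 x (hp₁.subset hx)) y (hm2 y (hp₂.subset hy)))
          (fun x hx => hB x (hm1 x (hp₁.subset hx)))
        obtain ⟨v, w, e1, e2⟩ := exists_pair_of_two_le (Val.ofItem key s r) h3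
        rw [e1] at hd ⊢
        simp only [wp_ifPair, wp_fst, wp_snd, wp_letIn, wp_var, wp_pair, wp_nil, wp_call,
          List.getElem?_cons_zero, List.getElem?_cons_succ, Option.some.injEq, exists_eq_left',
          Val.fst?_pair, Val.snd?_pair, Val.isPair_pair, Val.isPair_nil, if_true, if_false,
          sortE, e2]
        refine hd.wpCall fun t ht => ?_
        simp only [wp_ifPair, wp_fst, wp_snd, wp_letIn, wp_var, wp_pair, wp_nil, wp_call,
          List.getElem?_cons_zero, List.getElem?_cons_succ, Option.some.injEq, exists_eq_left',
          Val.fst?_pair, Val.snd?_pair, Val.isPair_pair, Val.isPair_nil, if_true, if_false,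
          ]
        refine hc₁.wpCall fun t₁ ht₁ => ?_
        refine hc₂.wpCall fun t₂ ht₂ => ?_
        refine hmg.wpCall fun t₃ ht₃ => ⟨rfl, ?_⟩
        rw [hp₁.length_eq, hp₂.length_eq] at ht₃
        have h4 : (deal L).1.length + (deal L).2.length = L.length := by omega
        rw [h4] at ht₃
        -- With at least two items, `L.length - 1` is at least half of `L.length`. The factor two in
        -- `sortConst` thus pays for the linear work of this level and for the additive constant of
        -- the second recursive call.
        have h5 : sortConst B + (keyCost B + 80) * L.length + 60 ≤ sortConst B * L.length := by
          unfold sortConst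
          nlinarith [Nat.mul_le_mul_left (keyCost B) h3]
        have h6 : sortConst B * (L.length * (h + 1 + 1) + 1) =
            sortConst B * ((deal L).1.length * (h + 1) + 1) +
            sortConst B * ((deal L).2.length * (h + 1)) + sortConst B * L.length := by
          rw [← h4]; ring
        have h7 : sortConst B * ((deal L).2.length * (h + 1) + 1) =
            sortConst B * ((deal L).2.length * (h + 1)) + sortConst B := by ring
        have h8 : (keyCost B + 80) * L.length = (keyCost B + 60) * L.length + 20 * L.length := by
          ring
        omega

end Sorting

/-! ### Ranks -/

/-- The number with given binary digits, most significant digit first. -/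
def bitsVal : List Bool → ℕ
  | [] => 0
  | b :: l => (if b then 2 ^ l.length else 0) + bitsVal l

theorem bitsVal_lt (l : List Bool) : bitsVal l < 2 ^ l.length := by
  induction l with
  | nil => simp [bitsVal]
  | cons b l ih => cases b <;> simp [bitsVal, pow_succ] <;> omega

/-- Increments a binary counter; the first component is the carry. -/
def inc : List Bool → Bool × List Bool
  | [] => (true, [])
  | b :: l => if (inc l).1 then (b, (!b) :: (inc l).2) else (false, b :: (inc l).2)

@[simp] theorem inc_length (l : List Bool) : (inc l).2.length = l.length := by
  induction l with
  | nil => rfl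
  | cons b l ih => unfold inc; split_ifs <;> simpa using ih

/-- The carry stands for the lost power of two, which gives an invariant that also covers overflow.
-/
theorem bitsVal_inc (l : List Bool) :
    bitsVal (inc l).2 + (if (inc l).1 then 2 ^ l.length else 0) = bitsVal l + 1 := by
  induction l with
  | nil => rfl
  | cons b l ih =>
    unfold inc
    split_ifs at ih ⊢ <;> cases b <;> simp_all [bitsVal, pow_succ] <;> omega

theorem bitsVal_inc_of_lt {l : List Bool} (h : bitsVal l + 1 < 2 ^ l.length) :
    bitsVal (inc l).2 = bitsVal l + 1 := by
  have := bitsVal_inc l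
  split_ifs at this <;> omega

theorem bitsVal_replicate (h : ℕ) : bitsVal (List.replicate h false) = 0 := by
  induction h with
  | zero => rfl
  | succ h ih => simpa [bitsVal, List.replicate_succ] using ih

/-- Componentwise comparison of lists of ranks. -/
def RankLe (a b : List (List Bool)) : Prop :=
  List.Forall₂ (fun x y => bitsVal x ≤ bitsVal y) a b

section Ranks

variable {n k : ℕ} {D : Type u} {Dom : Fin n → Type v}

/-- A rank is stored as a list of booleans. -/
def Val.ofBits (l : List Bool) : Val D Dom := .ofList (l.map .ofBool)

/-- Lists of ranks are stored as lists. -/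
def Val.ofRanks (l : List (List Bool)) : Val D Dom := .ofList (l.map .ofBits)

@[simp] theorem Val.ofBits_nil : (Val.ofBits [] : Val D Dom) = .nil := rfl
@[simp] theorem Val.ofBits_cons (b : Bool) (l : List Bool) :
    (Val.ofBits (b :: l) : Val D Dom) = .pair (.ofBool b) (.ofBits l) := rfl
@[simp] theorem Val.ofRanks_nil : (Val.ofRanks [] : Val D Dom) = .nil := rfl
@[simp] theorem Val.ofRanks_cons (b : List Bool) (l : List (List Bool)) :
    (Val.ofRanks (b :: l) : Val D Dom) = .pair (.ofBits b) (.ofRanks l) := rfl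

variable [Semiring D] [(i : Fin n) → LinearOrder (Dom i)]
  {S : Fin k → Finset (Fin n)} {θ : (j : Fin k) → (i : {i // i ∈ S j}) → Dom i.1 → ℝ}
  {c₁ c₂ : Expr} {α : Type*}

theorem call_inc (l : List Bool) :
    Call S θ (funs c₁ c₂) 4 (.ofBits l : Val D Dom)
      (.pair (.ofBool (inc l).1) (.ofBits (inc l).2)) (40 * l.length + 10) := by
  induction l with
  | nil =>
    refine .of rfl ?_
    simp only [wp_ifPair, wp_fst, wp_snd, wp_letIn, wp_var, wp_pair, wp_nil, wp_call,
      List.getElem?_cons_zero, List.getElem?_cons_succ, Option.some.injEq, exists_eq_left',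
      Val.fst?_pair, Val.snd?_pair, Val.isPair_pair, Val.isPair_nil, if_true, if_false,
      incE, Val.ofBits_nil, inc, Val.ofBool]
    exact ⟨trivial, by omega⟩
  | cons b l ih =>
    refine .of rfl ?_
    simp only [wp_ifPair, wp_fst, wp_snd, wp_letIn, wp_var, wp_pair, wp_nil, wp_call,
      List.getElem?_cons_zero, List.getElem?_cons_succ, Option.some.injEq, exists_eq_left',
      Val.fst?_pair, Val.snd?_pair, Val.isPair_pair, Val.isPair_nil, if_true, if_false,
      incE, Val.ofBits_cons]
    refine ih.wpCall fun t ht => ?_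
    simp only [wp_ifPair, wp_fst, wp_snd, wp_letIn, wp_var, wp_pair, wp_nil, wp_call,
      List.getElem?_cons_zero, List.getElem?_cons_succ, Option.some.injEq, exists_eq_left',
      Val.fst?_pair, Val.snd?_pair, Val.isPair_pair, Val.isPair_nil, if_true, if_false,
      inc, Val.isPair_ofBool, List.length_cons]
    rcases h1 : (inc l).1 <;> rcases b <;> simp [Val.ofBool, h1] <;> omega

/-- There are no integers on the machine, so the list itself is halved until it is empty, and each
halving contributes one digit. The costs form a geometric series. The bound `H` on the number of
digits later controls the depth of the recursion. -/
theorem call_zeros (f : α → Val D Dom) (H : ℕ) (l : List α) (hl : l.length < 2 ^ H) :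
    ∃ h ≤ H, l.length < 2 ^ h ∧
      Call S θ (funs c₁ c₂) 5 (.ofList (l.map f)) (.ofBits (List.replicate h false))
        (100 * l.length + 10) := by
  induction H generalizing l with
  | zero =>
    obtain rfl : l = [] := by simpa using hl
    refine ⟨0, le_rfl, by simp, .of rfl ?_⟩
    simp only [wp_ifPair, wp_fst, wp_snd, wp_letIn, wp_var, wp_pair, wp_nil, wp_call,
      List.getElem?_cons_zero, List.getElem?_cons_succ, Option.some.injEq, exists_eq_left',
      Val.fst?_pair, Val.snd?_pair, Val.isPair_pair, Val.isPair_nil, if_true, if_false,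
      zerosE, List.map_nil, Val.ofList_nil, List.replicate_zero, Val.ofBits_nil]
    exact ⟨trivial, by omega⟩
  | succ H ih =>
    obtain _ | ⟨x, l⟩ := l
    · refine ⟨0, by omega, by simp, .of rfl ?_⟩
      simp only [wp_ifPair, wp_fst, wp_snd, wp_letIn, wp_var, wp_pair, wp_nil, wp_call,
        List.getElem?_cons_zero, List.getElem?_cons_succ, Option.some.injEq, exists_eq_left',
        Val.fst?_pair, Val.snd?_pair, Val.isPair_pair, Val.isPair_nil, if_true, if_false,
        zerosE, List.map_nil, Val.ofList_nil, List.replicate_zero, Val.ofBits_nil]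
      exact ⟨trivial, by omega⟩
    · have h2 := (deal_length (x :: l)).2
      have hd := call_deal (S := S) (θ := θ) (c₁ := c₁) (c₂ := c₂) f (x :: l)
      rw [pow_succ] at hl
      obtain ⟨h, hH, hlt, hc⟩ := ih (deal (x :: l)).2 (by omega)
      refine ⟨h + 1, by omega, by rw [pow_succ]; omega, .of rfl ?_⟩
      rw [List.map_cons, Val.ofList_cons] at hd ⊢
      simp only [wp_ifPair, wp_fst, wp_snd, wp_letIn, wp_var, wp_pair, wp_nil, wp_call,
        List.getElem?_cons_zero, List.getElem?_cons_succ, Option.some.injEq, exists_eq_left',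
        Val.fst?_pair, Val.snd?_pair, Val.isPair_pair, Val.isPair_nil, if_true, if_false,
        zerosE]
      refine hd.wpCall fun t ht => ?_
      simp only [wp_ifPair, wp_fst, wp_snd, wp_letIn, wp_var, wp_pair, wp_nil, wp_call,
        List.getElem?_cons_zero, List.getElem?_cons_succ, Option.some.injEq, exists_eq_left',
        Val.fst?_pair, Val.snd?_pair, Val.isPair_pair, Val.isPair_nil, if_true, if_false,
        ]
      refine hc.wpCall fun t' ht' => ⟨by simp [List.replicate_succ, Val.ofBool], ?_⟩
      rw [h2] at ht'
      simp only [List.length_cons] at *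
      omega

/-- An item with its keys, its ranks and its other data. -/
def Val.ofRanked (key : α → Key Dom) (ks : List (α → Key Dom)) (bs : α → List (List Bool))
    (r : α → Val D Dom) : α → Val D Dom :=
  .ofItem key (fun x => .ofList (ks.map fun f => .ofKey (f x)))
    fun x => .pair (.ofRanks (bs x)) (r x)

/-- Ranks are a function on items, which is why the list must not have repetitions. They increase
strictly along the list, even between items with equal keys. -/
theorem call_attach (key key' : α → Key Dom) (ks : List (α → Key Dom))
    (bs : α → List (List Bool)) (r : α → Val D Dom) {h : ℕ} (l : List α) (hl : l.Nodup)
    (b : List Bool) (hb : b.length = h) (hlt : bitsVal b + l.length ≤ 2 ^ h) :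
    ∃ bits : α → List Bool, (∀ x ∈ l, (bits x).length = h ∧ bitsVal b ≤ bitsVal (bits x)) ∧
      l.Pairwise (fun x y => bitsVal (bits x) < bitsVal (bits y)) ∧
      Call S θ (funs c₁ c₂) 6
        (.pair (.ofBits b) (.ofList (l.map (Val.ofRanked key (key' :: ks) bs r))))
        (.ofList (l.map (Val.ofRanked key' ks (fun x => bits x :: bs x) r)))
        ((40 * h + 70) * l.length + 10) := by
  classical
  induction l generalizing b with
  | nil =>
    refine ⟨fun _ => [], by simp, .nil, .of rfl ?_⟩
    simp only [wp_ifPair, wp_fst, wp_snd, wp_letIn, wp_var, wp_pair, wp_nil, wp_call,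
      List.getElem?_cons_zero, List.getElem?_cons_succ, Option.some.injEq, exists_eq_left',
      Val.fst?_pair, Val.snd?_pair, Val.isPair_pair, Val.isPair_nil, if_true, if_false,
      attachE, List.map_nil, Val.ofList_nil]
    exact ⟨trivial, by omega⟩
  | cons x l ih =>
    rw [List.nodup_cons] at hl
    have hinc := call_inc (S := S) (θ := θ) (c₁ := c₁) (c₂ := c₂) (D := D) (Dom := Dom) b
    rw [hb] at hinc
    rw [List.length_cons] at hlt
    -- The last item is treated apart: the counter may overflow after it, but the new value only
    -- reaches the call on the empty list, which ignores it.
    rcases l.eq_nil_or_concat with rfl | hne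
    · refine ⟨fun _ => b, by simp [hb], by simp, .of rfl ?_⟩
      simp only [wp_ifPair, wp_fst, wp_snd, wp_letIn, wp_var, wp_pair, wp_nil, wp_call,
        List.getElem?_cons_zero, List.getElem?_cons_succ, Option.some.injEq, exists_eq_left',
        Val.fst?_pair, Val.snd?_pair, Val.isPair_pair, Val.isPair_nil, if_true, if_false,
        attachE, List.map_nil, Val.ofList_nil, Val.ofList_cons, List.map_cons,
        Val.ofRanked, Val.ofItem]
      refine hinc.wpCall fun t ht => ?_
      simp only [wp_ifPair, wp_fst, wp_snd, wp_letIn, wp_var, wp_pair, wp_nil, wp_call,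
        List.getElem?_cons_zero, List.getElem?_cons_succ, Option.some.injEq, exists_eq_left',
        Val.fst?_pair, Val.snd?_pair, Val.isPair_pair, Val.isPair_nil, if_true, if_false,
        ]
      refine wpCall_of rfl ?_
      simp only [wp_ifPair, wp_fst, wp_snd, wp_letIn, wp_var, wp_pair, wp_nil, wp_call,
        List.getElem?_cons_zero, List.getElem?_cons_succ, Option.some.injEq, exists_eq_left',
        Val.fst?_pair, Val.snd?_pair, Val.isPair_pair, Val.isPair_nil, if_true, if_false,
        attachE, Val.ofRanks_cons]
      simp only [List.length_cons, List.length_nil]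
      exact ⟨trivial, by omega⟩
    · have hpos : 0 < l.length := by
        obtain ⟨_, _, rfl⟩ := hne; simp
      have hv : bitsVal (inc b).2 = bitsVal b + 1 := bitsVal_inc_of_lt (by rw [hb]; omega)
      obtain ⟨bits, h1, h2, h3⟩ := ih hl.2 (inc b).2 (by simp [hb]) (by omega)
      have hx : ∀ y ∈ l, Function.update bits x b y = bits y := fun y hy =>
        Function.update_of_ne (by rintro rfl; exact hl.1 hy) _ _
      refine ⟨Function.update bits x b, ?_, ?_, .of rfl ?_⟩
      · intro y hy
        rcases List.mem_cons.1 hy with rfl | hy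
        · simp [hb]
        · rw [hx y hy]
          have := h1 y hy
          exact ⟨this.1, by omega⟩
      · refine List.pairwise_cons.2 ⟨fun y hy => ?_, h2.imp_of_mem fun {y z} hy hz hyz => ?_⟩
        · rw [hx y hy, Function.update_self]
          have := (h1 y hy).2
          omega
        · rwa [hx y hy, hx z hz]
      · simp only [wp_ifPair, wp_fst, wp_snd, wp_letIn, wp_var, wp_pair, wp_nil, wp_call,
        List.getElem?_cons_zero, List.getElem?_cons_succ, Option.some.injEq, exists_eq_left',
        Val.fst?_pair, Val.snd?_pair, Val.isPair_pair, Val.isPair_nil, if_true, if_false,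
        attachE, Val.ofList_cons, List.map_cons, Val.ofRanked, Val.ofItem]
        refine hinc.wpCall fun t ht => ?_
        simp only [wp_ifPair, wp_fst, wp_snd, wp_letIn, wp_var, wp_pair, wp_nil, wp_call,
          List.getElem?_cons_zero, List.getElem?_cons_succ, Option.some.injEq, exists_eq_left',
          Val.fst?_pair, Val.snd?_pair, Val.isPair_pair, Val.isPair_nil, if_true, if_false,
          ]
        refine h3.wpCall fun t' ht' => ⟨?_, ?_⟩
        · congr 1
          · simp
          · congr 1
            refine List.map_congr_left fun y hy => ?_
            simp only [Val.ofRanked, Val.ofItem, hx y hy]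
        · simp only [List.length_cons, mul_add]
          omega

/-- The constant in the time of ranking. -/
def rankConst (B : ℕ) : ℕ := sortConst B + 500

/-- Sorting by a key and numbering the list turns the key into a rank; the last key is kept and
determines the final order. Items with equal keys get different ranks in arbitrary order, so ranks
are informative only for pairs that differ in these keys, and there `≤` of ranks is `<` of keys. All
items share the digit counts `hs'`, which the recursion over digits relies on. -/
theorem call_rank (r : α → Val D Dom) {B H : ℕ} (ks : List (α → Key Dom)) (key : α → Key Dom)
    (bs : α → List (List Bool)) (hs : List ℕ) (l : List α) (hl : l.Nodup)
    (hlH : l.length < 2 ^ H)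
    (hshape : ∀ f ∈ key :: ks, ∀ x ∈ l, ∀ y ∈ l, SameShape (f x) (f y))
    (hB : ∀ f ∈ key :: ks, ∀ x ∈ l, (f x).length ≤ B)
    (hhs : ∀ x ∈ l, (bs x).map List.length = hs) (hhsH : ∀ h ∈ hs, h ≤ H) :
    ∃ (l' : List α) (bs' : α → List (List Bool)) (hs' : List ℕ), l'.Perm l ∧
      l'.Pairwise (fun x y => (key :: ks).getLast (by simp) x ≤ (key :: ks).getLast (by simp) y) ∧
      (∀ x ∈ l, (bs' x).map List.length = hs') ∧ (∀ h ∈ hs', h ≤ H) ∧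
      hs'.length = ks.length + hs.length ∧
      (∀ x ∈ l, ∀ y ∈ l, (∀ f ∈ (key :: ks).dropLast, f x ≠ f y) →
        (RankLe (bs' x) (bs' y) ↔
          (∀ f ∈ (key :: ks).dropLast, f x < f y) ∧ RankLe (bs x) (bs y))) ∧
      Call S θ (funs c₁ c₂) 7 (.ofList (l.map (Val.ofRanked key ks bs r)))
        (.ofList (l'.map (Val.ofRanked ((key :: ks).getLast (by simp)) [] bs' r)))
        ((ks.length + 1) * (rankConst B * (l.length * (H + 1) + 1))) := by
  have hK : rankConst B * (l.length * (H + 1) + 1) =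
      sortConst B * (l.length * (H + 1) + 1) + 500 * l.length * H + 500 * l.length + 500 := by
    unfold rankConst; ring
  have hlh : l.length ≤ l.length * (H + 1) := Nat.le_mul_of_pos_right _ (by omega)
  induction ks generalizing key bs hs l with
  | nil =>
    obtain ⟨l', hp, hsort, hc⟩ := call_sort (S := S) (θ := θ) (c₁ := c₁) (c₂ := c₂) key
      (fun x => .ofList (([] : List (α → Key Dom)).map fun f => .ofKey (f x)))
      (fun x => .pair (.ofRanks (bs x)) (r x)) (B := B) H l hlH.le (hshape _ (by simp))
      (hB _ (by simp))
    refine ⟨l', bs, hs, hp, hsort, hhs, hhsH, by simp, by simp, .of rfl ?_⟩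
    obtain _ | ⟨x, l⟩ := l
    · obtain rfl : l' = [] := by simpa using hp
      simp only [wp_ifPair, wp_fst, wp_snd, wp_letIn, wp_var, wp_pair, wp_nil, wp_call,
        List.getElem?_cons_zero, List.getElem?_cons_succ, Option.some.injEq, exists_eq_left',
        Val.fst?_pair, Val.snd?_pair, Val.isPair_pair, Val.isPair_nil, if_true, if_false,
        rankE, List.map_nil, Val.ofList_nil]
      refine ⟨trivial, ?_⟩
      simp only [List.length_nil] at *
      omega
    · obtain _ | ⟨x', l'⟩ := l'
      · simpa using hp.length_eq
      · change Call S θ _ _ (Val.ofList (List.map (Val.ofRanked key [] bs r) (x :: l))) _ _ at hc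
        change wp S θ _ _ _ fun w t => w = Val.ofList (List.map (Val.ofRanked key [] bs r) _) ∧ _
        change Call S θ _ _ _ (Val.ofList (List.map (Val.ofRanked key [] bs r) _)) _ at hc
        rw [List.map_cons, Val.ofList_cons, List.map_cons, Val.ofList_cons] at hc ⊢
        simp only [wp_ifPair, wp_fst, wp_snd, wp_letIn, wp_var, wp_pair, wp_nil, wp_call,
          List.getElem?_cons_zero, List.getElem?_cons_succ, Option.some.injEq, exists_eq_left',
          Val.fst?_pair, Val.snd?_pair, Val.isPair_pair, Val.isPair_nil, if_true, if_false,
          rankE]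
        refine hc.wpCall fun t ht => ?_
        simp only [wp_ifPair, wp_fst, wp_snd, wp_letIn, wp_var, wp_pair, wp_nil, wp_call,
          List.getElem?_cons_zero, List.getElem?_cons_succ, Option.some.injEq, exists_eq_left',
          Val.fst?_pair, Val.snd?_pair, Val.isPair_pair, Val.isPair_nil, if_true, if_false,
          Val.ofRanked, Val.ofItem, List.map_nil, Val.ofList_nil]
        refine ⟨trivial, ?_⟩
        simp only [List.length_nil] at *
        omega
  | cons key' ks ih =>
    obtain ⟨l₁, hp, hsort, hc⟩ := call_sort (S := S) (θ := θ) (c₁ := c₁) (c₂ := c₂) key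
      (fun x => .ofList ((key' :: ks).map fun f => .ofKey (f x)))
      (fun x => .pair (.ofRanks (bs x)) (r x)) (B := B) H l hlH.le (hshape _ (by simp))
      (hB _ (by simp))
    have hlen := hp.length_eq
    obtain ⟨h, hhH, hlh', hz⟩ := call_zeros (S := S) (θ := θ) (c₁ := c₁) (c₂ := c₂)
      (Val.ofRanked key (key' :: ks) bs r) H l₁ (by rw [hlen]; exact hlH)
    obtain ⟨bits, hbits, hmono, ha⟩ := call_attach (S := S) (θ := θ) (c₁ := c₁) (c₂ := c₂)
      key key' ks bs r (h := h) l₁ (hp.nodup_iff.2 hl) (List.replicate h false) (by simp)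
      (by rw [bitsVal_replicate]; omega)
    have hmem : ∀ x, x ∈ l₁ ↔ x ∈ l := fun x => hp.mem_iff
    obtain ⟨l', bs', hs', hp', hsort', hbs', hhs', hlen', hdom, hc'⟩ := ih key'
      (fun x => bits x :: bs x) (h :: hs) l₁ (hp.nodup_iff.2 hl) (by rw [hlen]; exact hlH)
      (fun f hf x hx y hy => hshape f (by simp [hf]) x ((hmem x).1 hx) y ((hmem y).1 hy))
      (fun f hf x hx => hB f (by simp [hf]) x ((hmem x).1 hx))
      (fun x hx => by simp [hbits x hx, hhs x ((hmem x).1 hx)])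
      (by simpa using ⟨hhH, hhsH⟩) (by rw [hlen]; exact hK) (by rw [hlen]; exact hlh)
    refine ⟨l', bs', hs', hp'.trans hp, hsort', fun x hx => hbs' x ((hmem x).2 hx), hhs',
      by simp [hlen']; omega, ?_, .of rfl ?_⟩
    · intro x hx y hy hne
      rw [hdom x ((hmem x).2 hx) y ((hmem y).2 hy)
        (fun f hf => hne f (List.dropLast_cons_cons ▸ List.mem_cons_of_mem _ hf))]
      simp only [List.dropLast_cons_cons, List.forall_mem_cons] at hne ⊢
      have hkey : bitsVal (bits x) ≤ bitsVal (bits y) ↔ key x < key y := by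
        have hxy : ∀ x ∈ l₁, ∀ y ∈ l₁, key x < key y → bitsVal (bits x) < bitsVal (bits y) := by
          intro x hx y hy hlt
          have hx' : x ≠ y := by rintro rfl; exact lt_irrefl _ hlt
          -- Going from `List.Pairwise` to arbitrary pairs requires a symmetric relation. The
          -- statement is symmetrised, and the alternative in the wrong direction contradicts `key x
          -- < key y`.
          have hsymm : Std.Symm fun x y =>
              (key x ≤ key y ∧ bitsVal (bits x) < bitsVal (bits y)) ∨
              (key y ≤ key x ∧ bitsVal (bits y) < bitsVal (bits x)) := ⟨fun _ _ h => h.symm⟩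
          have := ((hsort.and hmono).imp fun h => Or.inl h).forall (R := fun x y =>
              (key x ≤ key y ∧ bitsVal (bits x) < bitsVal (bits y)) ∨
              (key y ≤ key x ∧ bitsVal (bits y) < bitsVal (bits x))) hx hy hx'
          exact (this.resolve_right fun h => h.1.not_gt hlt).2
        refine ⟨fun h => ?_, fun h => (hxy x ((hmem x).2 hx) y ((hmem y).2 hy) h).le⟩
        exact (lt_or_gt_of_ne hne.1).resolve_right
          fun h' => h.not_gt (hxy y ((hmem y).2 hy) x ((hmem x).2 hx) h')
      rw [RankLe, List.forall₂_cons, hkey]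
      unfold RankLe
      tauto
    · obtain _ | ⟨x, l⟩ := l
      · obtain rfl : l₁ = [] := by simpa using hp
        obtain rfl : l' = [] := by simpa using hp'
        simp only [wp_ifPair, wp_fst, wp_snd, wp_letIn, wp_var, wp_pair, wp_nil, wp_call,
          List.getElem?_cons_zero, List.getElem?_cons_succ, Option.some.injEq, exists_eq_left',
          Val.fst?_pair, Val.snd?_pair, Val.isPair_pair, Val.isPair_nil, if_true, if_false,
          rankE, List.map_nil, Val.ofList_nil]
        refine ⟨trivial, ?_⟩
        simp only [List.length_nil, List.length_cons] at *
        nlinarith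
      · obtain _ | ⟨x', l₁⟩ := l₁
        · simpa using hp.length_eq
        · change Call S θ _ _ (Val.ofList (List.map (Val.ofRanked key (key' :: ks) bs r) (x :: l)))
            (Val.ofList (List.map (Val.ofRanked key (key' :: ks) bs r) _)) _ at hc
          rw [List.map_cons, Val.ofList_cons, List.map_cons, Val.ofList_cons] at hc
          rw [List.map_cons, Val.ofList_cons] at hz
          rw [List.map_cons (f := Val.ofRanked key (key' :: ks) bs r), Val.ofList_cons] at ha
          rw [List.map_cons, Val.ofList_cons]
          simp only [wp_ifPair, wp_fst, wp_snd, wp_letIn, wp_var, wp_pair, wp_nil, wp_call,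
            List.getElem?_cons_zero, List.getElem?_cons_succ, Option.some.injEq, exists_eq_left',
            Val.fst?_pair, Val.snd?_pair, Val.isPair_pair, Val.isPair_nil, if_true, if_false,
            rankE]
          refine hc.wpCall fun t ht => ?_
          -- Only the shape of the first item matters here: its list of further keys is nonempty, so
          -- the test in `rankE` succeeds.
          have hi : ∃ v w z u, Val.ofRanked key (key' :: ks) bs r x' =
            Val.pair (Val.pair z (Val.pair v w)) u := ⟨_, _, _, _, rfl⟩
          obtain ⟨v, w, z, u, hi⟩ := hi
          rw [hi] at hz ha ⊢
          simp only [wp_ifPair, wp_fst, wp_snd, wp_letIn, wp_var, wp_pair, wp_nil, wp_call,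
            List.getElem?_cons_zero, List.getElem?_cons_succ, Option.some.injEq, exists_eq_left',
            Val.fst?_pair, Val.snd?_pair, Val.isPair_pair, Val.isPair_nil, if_true, if_false,
            ]
          refine hz.wpCall fun t₁ ht₁ => ?_
          refine ha.wpCall fun t₂ ht₂ => ?_
          refine hc'.wpCall fun t₃ ht₃ => ⟨rfl, ?_⟩
          rw [hlen] at ht₁ ht₂ ht₃
          have h3 : (40 * h + 70) * (x :: l).length ≤ (40 * H + 70) * (x :: l).length :=
            Nat.mul_le_mul_right _ (by omega)
          have h4 : (40 * H + 70) * (x :: l).length =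
            40 * ((x :: l).length * H) + 70 * (x :: l).length := by ring
          have h5 : 500 * (x :: l).length * H = 500 * ((x :: l).length * H) := by ring
          have h6 : ((key' :: ks).length + 1) * (rankConst B * ((x :: l).length * (H + 1) + 1)) =
            (ks.length + 1) * (rankConst B * ((x :: l).length * (H + 1) + 1)) +
            rankConst B * ((x :: l).length * (H + 1) + 1) := by
            rw [List.length_cons]; ring
          omega

end Ranks

/-! ### Dominance sums -/

/-- Items of the divide-and-conquer algorithm: a group, ranks and a weight. -/
structure Weighted {n : ℕ} (D : Type u) (Dom : Fin n → Type v) : Type (max u v) where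
  /-- the group -/
  g : Key Dom
  /-- the ranks -/
  bs : List (List Bool)
  /-- the weight -/
  w : D

/-- An upper bound for the number of nodes that an item visits in the recursion over the binary
digits of ranks of the given lengths. -/
def visits : List ℕ → ℕ
  | [] => 1
  | h :: hs => (h + 1) * (visits hs + 1)

/-- The summand 1 on the left makes the induction close: (x + 1)(v + 1) + 1 ≤ (H + 2)(v + 1) for x ≤
H. -/
theorem visits_le {H : ℕ} (hs : List ℕ) (h : ∀ x ∈ hs, x ≤ H) :
    visits hs + 1 ≤ 2 * (H + 2) ^ hs.length := by
  induction hs with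
  | nil => simp [visits]
  | cons x hs ih =>
    have h1 := ih fun y hy => h y (by simp [hy])
    have h2 : x ≤ H := h x (by simp)
    rw [visits, List.length_cons, pow_succ]
    nlinarith [Nat.mul_le_mul h1 h2, Nat.mul_le_mul h1 (le_refl H)]

section Dominance

variable {n k : ℕ} {D : Type u} {Dom : Fin n → Type v} [Semiring D]

/-- The encoding of weighted items. -/
def Val.ofWeighted (a : Weighted D Dom) : Val D Dom :=
  .pair (.ofKey a.g) (.pair (.ofRanks a.bs) (.sr a.w))

/-- Lists of semiring elements are stored as lists. -/
def Val.ofSrs (l : List D) : Val D Dom := .ofList (l.map .sr)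

@[simp] theorem Val.ofSrs_nil : (Val.ofSrs [] : Val D Dom) = .nil := rfl
@[simp] theorem Val.ofSrs_cons (x : D) (l : List D) :
    (Val.ofSrs (x :: l) : Val D Dom) = .pair (.sr x) (.ofSrs l) := rfl

@[simp] theorem ind_true : ind D True = 1 := if_pos trivial

@[simp] theorem ind_false : ind D False = 0 := if_neg id

/-- The weight `w` if `g'` is the group `g` and the ranks `t` dominate `s`. -/
noncomputable def contrib (g : Key Dom) (s : List (List Bool)) (g' : Key Dom)
    (t : List (List Bool)) (w : D) : D :=
  ind D (g' = g ∧ RankLe s t) * w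

/-- The total weight of the items in the group of `a` that dominate `a`. -/
noncomputable def domSum (a : Weighted D Dom) (l : List (Weighted D Dom)) : D :=
  (l.map fun b => contrib a.g a.bs b.g b.bs b.w).sum

@[simp] theorem domSum_nil (a : Weighted D Dom) : domSum a [] = 0 := rfl

@[simp] theorem domSum_cons (a b : Weighted D Dom) (l : List (Weighted D Dom)) :
    domSum a (b :: l) = contrib a.g a.bs b.g b.bs b.w + domSum a l := by
  simp [domSum]

/-- For each item of a list, the total weight of the items from there on that dominate it. -/
noncomputable def domSums : List (Weighted D Dom) → List D
  | [] => []
  | a :: l => domSum a (a :: l) :: domSums l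

/-- The first digit of the first rank. -/
def Weighted.headBit (a : Weighted D Dom) : Bool := (a.bs.headD []).headD false

/-- Drops the first digit of the first rank. -/
def Weighted.popBit (a : Weighted D Dom) : Weighted D Dom :=
  ⟨a.g, (a.bs.headD []).tail :: a.bs.tail, a.w⟩

/-- Drops the first rank. -/
def Weighted.popRank (a : Weighted D Dom) : Weighted D Dom := ⟨a.g, a.bs.tail, a.w⟩

/-- Drops the first rank, and the weight if the first digit is `false`. -/
def Weighted.cross (a : Weighted D Dom) : Weighted D Dom :=
  ⟨a.g, a.bs.tail, if a.headBit then a.w else 0⟩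

/-- The items with first digit `b`, which is dropped. -/
def half (b : Bool) (l : List (Weighted D Dom)) : List (Weighted D Dom) :=
  (l.filter fun a => a.headBit == b).map Weighted.popBit

theorem exists_of_shape {a : Weighted D Dom} {h : ℕ} {hs : List ℕ}
    (ha : a.bs.map List.length = (h + 1) :: hs) :
    ∃ b x s, a = ⟨a.g, (b :: x) :: s, a.w⟩ ∧ x.length = h ∧ s.map List.length = hs := by
  obtain ⟨g, bs, w⟩ := a
  match bs, ha with
  | (b :: x) :: s, ha => exact ⟨b, x, s, rfl, by simpa using ha⟩

theorem half_cons (b : Bool) (a : Weighted D Dom) (l : List (Weighted D Dom)) :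
    half b (a :: l) = if a.headBit = b then a.popBit :: half b l else half b l := by
  by_cases h : a.headBit = b <;> simp [half, h]

theorem headBit_mk (g : Key Dom) (b : Bool) (x : List Bool) (s : List (List Bool)) (w : D) :
    Weighted.headBit ⟨g, (b :: x) :: s, w⟩ = b := rfl

theorem popBit_mk (g : Key Dom) (b : Bool) (x : List Bool) (s : List (List Bool)) (w : D) :
    Weighted.popBit ⟨g, (b :: x) :: s, w⟩ = ⟨g, x :: s, w⟩ := rfl

theorem cross_mk (g : Key Dom) (b : Bool) (x : List Bool) (s : List (List Bool)) (w : D) :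
    Weighted.cross ⟨g, (b :: x) :: s, w⟩ = ⟨g, s, if b then w else 0⟩ := rfl

theorem popRank_mk (g : Key Dom) (x : List Bool) (s : List (List Bool)) (w : D) :
    Weighted.popRank ⟨g, x :: s, w⟩ = ⟨g, s, w⟩ := rfl

theorem rankLe_cons {x y : List Bool} {s t : List (List Bool)} :
    RankLe (x :: s) (y :: t) ↔ bitsVal x ≤ bitsVal y ∧ RankLe s t := List.forall₂_cons

/-! ### How the leading digit decides the comparison of two ranks -/

section Contrib

variable {g g' : Key Dom} {w : D} {x y : List Bool} {s t : List (List Bool)}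

theorem contrib_zero : contrib g s g' t (0 : D) = 0 := by simp [contrib]

theorem contrib_nil : contrib g ([] :: s) g' ([] :: t) w = contrib g s g' t w := by
  simp [contrib, rankLe_cons]

theorem contrib_same (b : Bool) (h : x.length = y.length) :
    contrib g ((b :: x) :: s) g' ((b :: y) :: t) w = contrib g (x :: s) g' (y :: t) w := by
  simp [contrib, rankLe_cons, bitsVal, h]

/-- A leading 1 outweighs all later digits of a number of the same length, so the comparison in this
rank is settled and the whole rank can be dropped. -/
theorem contrib_false_true (h : x.length = y.length) :
    contrib g ((false :: x) :: s) g' ((true :: y) :: t) w = contrib g s g' t w := by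
  have := bitsVal_lt x
  have : bitsVal x ≤ 2 ^ y.length + bitsVal y := by rw [h] at this; omega
  simp [contrib, rankLe_cons, bitsVal, this]

theorem contrib_true_false (h : x.length = y.length) :
    contrib g ((true :: x) :: s) g' ((false :: y) :: t) w = 0 := by
  have := bitsVal_lt y
  have : ¬ 2 ^ x.length + bitsVal x ≤ bitsVal y := by rw [h]; omega
  simp [contrib, rankLe_cons, bitsVal, this]

end Contrib

/-- No item with leading digit 0 dominates one with leading digit 1, and between items with digit 1
the digit cancels. -/
theorem domSum_half_true {h : ℕ} {hs : List ℕ} (l : List (Weighted D Dom))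
    (hl : ∀ b ∈ l, b.bs.map List.length = (h + 1) :: hs) (g : Key Dom) (x : List Bool)
    (s : List (List Bool)) (w : D) (hx : x.length = h) :
    domSum ⟨g, x :: s, w⟩ (half true l) = domSum ⟨g, (true :: x) :: s, w⟩ l := by
  induction l with
  | nil => rfl
  | cons b l ih =>
    have ih := ih fun b hb => hl b (by simp [hb])
    obtain ⟨c, y, t, hb, hy, ht⟩ := exists_of_shape (hl b (by simp))
    rw [hb, half_cons, headBit_mk, popBit_mk, domSum_cons, ← ih]
    cases c
    · simp [contrib_true_false (hx.trans hy.symm)]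
    · simp [contrib_same _ (hx.trans hy.symm)]

/-- The dominating items split into two disjoint classes. Those with digit 0 are compared by the
later digits inside the lower half. Those with digit 1 already win in this rank and are counted
without it, the other weights being erased by `cross`. The weights `w` and `w'` are arbitrary
because a dominance sum does not look at the weight of its first argument. -/
theorem domSum_half_false {h : ℕ} {hs : List ℕ} (l : List (Weighted D Dom))
    (hl : ∀ b ∈ l, b.bs.map List.length = (h + 1) :: hs) (g : Key Dom) (x : List Bool)
    (s : List (List Bool)) (w w' : D) (hx : x.length = h) :
    domSum ⟨g, x :: s, w⟩ (half false l) + domSum ⟨g, s, w'⟩ (l.map Weighted.cross) =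
      domSum ⟨g, (false :: x) :: s, w⟩ l := by
  induction l with
  | nil => simp [half]
  | cons b l ih =>
    have ih := ih fun b hb => hl b (by simp [hb])
    obtain ⟨c, y, t, hb, hy, ht⟩ := exists_of_shape (hl b (by simp))
    rw [hb, half_cons, headBit_mk, popBit_mk, domSum_cons, ← ih, List.map_cons, cross_mk]
    cases c
    · simp [contrib_same _ (hx.trans hy.symm), contrib_zero, add_assoc]
    · simp [contrib_false_true (hx.trans hy.symm), add_left_comm]

/-- A rank without digits has value zero for every item and imposes no condition. -/
theorem domSum_popRank {hs : List ℕ} (l : List (Weighted D Dom))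
    (hl : ∀ b ∈ l, b.bs.map List.length = 0 :: hs) (a : Weighted D Dom)
    (ha : a.bs.map List.length = 0 :: hs) :
    domSum a.popRank (l.map Weighted.popRank) = domSum a l := by
  unfold domSum
  rw [List.map_map]
  congr 1
  refine List.map_congr_left fun b hb => ?_
  have hb := hl b hb
  obtain ⟨g, bs, w⟩ := a
  obtain ⟨g', bs', w'⟩ := b
  match bs, ha, bs', hb with
  | [] :: s, _, [] :: t, _ => simp [popRank_mk, contrib_nil]

theorem domSums_popRank {hs : List ℕ} (l : List (Weighted D Dom))
    (hl : ∀ b ∈ l, b.bs.map List.length = 0 :: hs) :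
    domSums (l.map Weighted.popRank) = domSums l := by
  induction l with
  | nil => rfl
  | cons a l ih =>
    rw [List.map_cons, domSums, domSums, ← List.map_cons, domSum_popRank _ hl _ (hl a (by simp)),
      ih fun b hb => hl b (by simp [hb])]

variable [(i : Fin n) → LinearOrder (Dom i)]

/-- The invariant of the divide-and-conquer algorithm. -/
structure IsInstance (B : ℕ) (hs : List ℕ) (l : List (Weighted D Dom)) : Prop where
  shape : ∀ x ∈ l, ∀ y ∈ l, SameShape x.g y.g
  length_le : ∀ x ∈ l, x.g.length ≤ B
  sorted : l.Pairwise fun x y => x.g ≤ y.g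
  ranks : ∀ x ∈ l, x.bs.map List.length = hs

theorem IsInstance.tail {B : ℕ} {hs : List ℕ} {a : Weighted D Dom} {l : List (Weighted D Dom)}
    (h : IsInstance B hs (a :: l)) : IsInstance B hs l :=
  ⟨fun x hx y hy => h.shape x (by simp [hx]) y (by simp [hy]),
    fun x hx => h.length_le x (by simp [hx]), (List.pairwise_cons.1 h.sorted).2,
    fun x hx => h.ranks x (by simp [hx])⟩

theorem IsInstance.map {B : ℕ} {hs hs' : List ℕ} {l : List (Weighted D Dom)}
    (h : IsInstance B hs l) (f : Weighted D Dom → Weighted D Dom) (hf : ∀ x, (f x).g = x.g)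
    (hf' : ∀ x ∈ l, (f x).bs.map List.length = hs') : IsInstance B hs' (l.map f) where
  shape := by simpa [hf] using h.shape
  length_le := by simpa [hf] using h.length_le
  sorted := by simpa [List.pairwise_map, hf] using h.sorted
  ranks := by simpa using hf'

theorem IsInstance.filter {B : ℕ} {hs : List ℕ} {l : List (Weighted D Dom)}
    (h : IsInstance B hs l) (p : Weighted D Dom → Bool) : IsInstance B hs (l.filter p) :=
  ⟨fun x hx y hy => h.shape x (List.mem_of_mem_filter hx) y (List.mem_of_mem_filter hy),
    fun x hx => h.length_le x (List.mem_of_mem_filter hx), h.sorted.filter _,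
    fun x hx => h.ranks x (List.mem_of_mem_filter hx)⟩

theorem IsInstance.half {B h : ℕ} {hs : List ℕ} {l : List (Weighted D Dom)}
    (hl : IsInstance B ((h + 1) :: hs) l) (b : Bool) : IsInstance B (h :: hs) (half b l) := by
  refine (hl.filter _).map _ (fun _ => rfl) fun x hx => ?_
  obtain ⟨c, y, t, hx', hy, ht⟩ := exists_of_shape (hl.ranks x (List.mem_of_mem_filter hx))
  rw [hx']
  simp [Weighted.popBit, hy, ht]

theorem half_length_add (l : List (Weighted D Dom)) :
    (half false l).length + (half true l).length = l.length := by
  induction l with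
  | nil => rfl
  | cons a l ih =>
    unfold FAQAI.half at *
    rcases h : a.headBit <;> simp_all <;> omega

/-! ### The recursion as run by the machine -/

variable {S : Fin k → Finset (Fin n)} {θ : (j : Fin k) → (i : {i // i ∈ S j}) → Dom i.1 → ℝ}
  {c₁ c₂ : Expr} {α : Type*}

/-- The environment `ρ` is arbitrary because `e` runs under a `letIn`, with the remaining input
still below the item. -/
theorem call_map {f : ℕ} {e : Expr} (hf : (funs c₁ c₂)[f]? = some (mapE f e))
    (enc enc' : α → Val D Dom) (c : ℕ) (l : List α)
    (h : ∀ x ∈ l, ∀ ρ, wp S θ (funs c₁ c₂) (enc x :: ρ) e fun w t => w = enc' x ∧ t ≤ c) :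
    Call S θ (funs c₁ c₂) f (.ofList (l.map enc)) (.ofList (l.map enc'))
      ((c + 15) * l.length + 5) := by
  induction l with
  | nil =>
    refine .of hf ?_
    simp only [wp_ifPair, wp_fst, wp_snd, wp_letIn, wp_var, wp_pair, wp_nil, wp_call,
      List.getElem?_cons_zero, List.getElem?_cons_succ, Option.some.injEq, exists_eq_left',
      Val.fst?_pair, Val.snd?_pair, Val.isPair_pair, Val.isPair_nil, if_true, if_false,
      mapE, List.map_nil, Val.ofList_nil]
    exact ⟨trivial, by omega⟩
  | cons x l ih =>
    have ih := ih fun y hy => h y (by simp [hy])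
    refine .of hf ?_
    simp only [wp_ifPair, wp_fst, wp_snd, wp_letIn, wp_var, wp_pair, wp_nil, wp_call,
      List.getElem?_cons_zero, List.getElem?_cons_succ, Option.some.injEq, exists_eq_left',
      Val.fst?_pair, Val.snd?_pair, Val.isPair_pair, Val.isPair_nil, if_true, if_false,
      mapE, List.map_cons, Val.ofList_cons]
    refine (h x (by simp) _).mono fun w t hw => ?_
    obtain ⟨rfl, ht⟩ := hw
    refine ih.wpCall fun t' ht' => ⟨rfl, ?_⟩
    rw [List.length_cons, mul_add]
    omega

theorem call_half (b : Bool) {B h : ℕ} {hs : List ℕ} (l : List (Weighted D Dom))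
    (hl : IsInstance B ((h + 1) :: hs) l) :
    Call S θ (funs c₁ c₂) (cond b 9 8) (.ofList (l.map Val.ofWeighted))
      (.ofList ((half b l).map Val.ofWeighted)) (60 * l.length + 10) := by
  induction l with
  | nil =>
    cases b <;> refine .of rfl ?_
    · simp only [wp_ifPair, wp_fst, wp_snd, wp_letIn, wp_var, wp_pair, wp_nil, wp_call,
      List.getElem?_cons_zero, List.getElem?_cons_succ, Option.some.injEq, exists_eq_left',
      Val.fst?_pair, Val.snd?_pair, Val.isPair_pair, Val.isPair_nil, if_true, if_false,
      loE, List.map_nil, Val.ofList_nil, half, List.filter_nil]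
      exact ⟨trivial, by omega⟩
    · simp only [wp_ifPair, wp_fst, wp_snd, wp_letIn, wp_var, wp_pair, wp_nil, wp_call,
      List.getElem?_cons_zero, List.getElem?_cons_succ, Option.some.injEq, exists_eq_left',
      Val.fst?_pair, Val.snd?_pair, Val.isPair_pair, Val.isPair_nil, if_true, if_false,
      hiE, List.map_nil, Val.ofList_nil, half, List.filter_nil]
      exact ⟨trivial, by omega⟩
  | cons a l ih =>
    have ih := ih hl.tail
    obtain ⟨c, y, t, ha, hy, ht⟩ := exists_of_shape (hl.ranks a (by simp))
    rw [ha]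
    cases b <;> refine .of rfl ?_
    · simp only [wp_ifPair, wp_fst, wp_snd, wp_letIn, wp_var, wp_pair, wp_nil, wp_call,
      List.getElem?_cons_zero, List.getElem?_cons_succ, Option.some.injEq, exists_eq_left',
      Val.fst?_pair, Val.snd?_pair, Val.isPair_pair, Val.isPair_nil, if_true, if_false,
      loE, List.map_cons, Val.ofList_cons, Val.ofWeighted, Val.ofRanks_cons,
        Val.ofBits_cons, Val.isPair_ofBool]
      cases c
      · simp only [Bool.false_eq_true, if_false]
        refine ih.wpCall fun t ht => ⟨?_, ?_⟩
        · simp [half_cons, headBit_mk, popBit_mk, Val.ofWeighted]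
        · rw [List.length_cons]
          omega
      · simp only [if_true]
        refine ih.wpCall fun t ht => ⟨?_, ?_⟩
        · simp [half_cons, headBit_mk]
        · rw [List.length_cons]
          omega
    · simp only [wp_ifPair, wp_fst, wp_snd, wp_letIn, wp_var, wp_pair, wp_nil, wp_call,
      List.getElem?_cons_zero, List.getElem?_cons_succ, Option.some.injEq, exists_eq_left',
      Val.fst?_pair, Val.snd?_pair, Val.isPair_pair, Val.isPair_nil, if_true, if_false,
      hiE, List.map_cons, Val.ofList_cons, Val.ofWeighted, Val.ofRanks_cons,
        Val.ofBits_cons, Val.isPair_ofBool]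
      cases c
      · simp only [Bool.false_eq_true, if_false]
        refine ih.wpCall fun t ht => ⟨?_, ?_⟩
        · simp [half_cons, headBit_mk]
        · rw [List.length_cons]
          omega
      · simp only [if_true]
        refine ih.wpCall fun t ht => ⟨?_, ?_⟩
        · simp [half_cons, headBit_mk, popBit_mk, Val.ofWeighted]
        · rw [List.length_cons]
          omega

theorem call_cross {B h : ℕ} {hs : List ℕ} (l : List (Weighted D Dom))
    (hl : IsInstance B ((h + 1) :: hs) l) :
    Call S θ (funs c₁ c₂) 10 (.ofList (l.map Val.ofWeighted))
      (.ofList ((l.map Weighted.cross).map Val.ofWeighted)) (45 * l.length + 5) := by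
  rw [List.map_map]
  refine call_map rfl _ _ 30 l fun a ha ρ => ?_
  obtain ⟨c, y, t, ha, hy, ht⟩ := exists_of_shape (hl.ranks a ha)
  rw [ha]
  simp only [wp_ifPair, wp_fst, wp_snd, wp_letIn, wp_var, wp_pair, wp_nil, wp_call,
    List.getElem?_cons_zero, List.getElem?_cons_succ, Option.some.injEq, exists_eq_left',
    Val.fst?_pair, Val.snd?_pair, Val.isPair_pair, Val.isPair_nil, if_true, if_false,
    crossE, Val.ofWeighted, Val.ofRanks_cons, Val.ofBits_cons, Val.isPair_ofBool, wp_srZero]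
  cases c <;> simp [Weighted.cross, Val.ofWeighted, Weighted.headBit]

theorem call_pop {B h : ℕ} {hs : List ℕ} (l : List (Weighted D Dom))
    (hl : IsInstance B (h :: hs) l) :
    Call S θ (funs c₁ c₂) 11 (.ofList (l.map Val.ofWeighted))
      (.ofList ((l.map Weighted.popRank).map Val.ofWeighted)) (45 * l.length + 5) := by
  rw [List.map_map]
  refine call_map rfl _ _ 30 l fun a ha ρ => ?_
  have ha := hl.ranks a ha
  obtain ⟨g, bs, w⟩ := a
  match bs, ha with
  | y :: s, _ =>
    simp only [wp_ifPair, wp_fst, wp_snd, wp_letIn, wp_var, wp_pair, wp_nil, wp_call,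
      List.getElem?_cons_zero, List.getElem?_cons_succ, Option.some.injEq, exists_eq_left',
      Val.fst?_pair, Val.snd?_pair, Val.isPair_pair, Val.isPair_nil, if_true, if_false,
      popE, Val.ofWeighted, Val.ofRanks_cons]
    simp [Weighted.popRank, Val.ofWeighted]

/-- All three result lists keep the order of the items, so one walk recombines them: the cross
results advance at every item, those of a half only at its own items. The cross result of an item
with digit 1 is computed but discarded. -/
theorem call_join {B h : ℕ} {hs : List ℕ} (l : List (Weighted D Dom))
    (hl : IsInstance B ((h + 1) :: hs) l) :
    Call S θ (funs c₁ c₂) 12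
      (.pair (.ofList (l.map Val.ofWeighted)) (.pair (.ofSrs (domSums (l.map Weighted.cross)))
        (.pair (.ofSrs (domSums (half false l))) (.ofSrs (domSums (half true l))))))
      (.ofSrs (domSums l)) (90 * l.length + 10) := by
  induction l with
  | nil =>
    refine .of rfl ?_
    simp only [wp_ifPair, wp_fst, wp_snd, wp_letIn, wp_var, wp_pair, wp_nil, wp_call,
      List.getElem?_cons_zero, List.getElem?_cons_succ, Option.some.injEq, exists_eq_left',
      Val.fst?_pair, Val.snd?_pair, Val.isPair_pair, Val.isPair_nil, if_true, if_false,
      joinE, List.map_nil, Val.ofList_nil, domSums, Val.ofSrs_nil]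
    exact ⟨trivial, by omega⟩
  | cons a l ih =>
    have ih := ih hl.tail
    obtain ⟨c, y, s, ha, hy, hs'⟩ := exists_of_shape (hl.ranks a (by simp))
    refine .of rfl ?_
    cases c
    -- The `0` is the weight that `cross` leaves to an item with digit 0.
    · have hsum := domSum_half_false _ hl.ranks a.g y s a.w 0 hy
      rw [← ha] at hsum
      have h1 : half false (a :: l) = ⟨a.g, y :: s, a.w⟩ :: half false l := by
        rw [ha]; simp [half_cons, headBit_mk, popBit_mk]
      have h2 : half true (a :: l) = half true l := by
        rw [ha]; simp [half_cons, headBit_mk]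
      have h3 : a.cross = ⟨a.g, s, 0⟩ := by
        rw [ha]; simp [cross_mk]
      rw [List.map_cons (f := Weighted.cross), h1, h2, h3, domSums, domSums, domSums,
        ← hsum, h1, List.map_cons (f := Weighted.cross), h3, List.map_cons, ha]
      simp only [wp_ifPair, wp_fst, wp_snd, wp_letIn, wp_var, wp_pair, wp_nil, wp_call,
        List.getElem?_cons_zero, List.getElem?_cons_succ, Option.some.injEq, exists_eq_left',
        Val.fst?_pair, Val.snd?_pair, Val.isPair_pair, Val.isPair_nil, if_true, if_false,
        joinE, Val.ofList_cons, Val.ofSrs_cons, Val.ofWeighted, Val.ofRanks_cons,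
        Val.ofBits_cons, Val.isPair_ofBool, wp_srAdd, Val.sr?_sr, Bool.false_eq_true]
      refine ih.wpCall fun t ht => ⟨rfl, ?_⟩
      rw [List.length_cons]
      omega
    · have hsum := domSum_half_true _ hl.ranks a.g y s a.w hy
      rw [← ha] at hsum
      have h1 : half true (a :: l) = ⟨a.g, y :: s, a.w⟩ :: half true l := by
        rw [ha]; simp [half_cons, headBit_mk, popBit_mk]
      have h2 : half false (a :: l) = half false l := by
        rw [ha]; simp [half_cons, headBit_mk]
      rw [List.map_cons (f := Weighted.cross), h1, h2, domSums, domSums, domSums,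
        ← hsum, h1, List.map_cons, ha]
      simp only [wp_ifPair, wp_fst, wp_snd, wp_letIn, wp_var, wp_pair, wp_nil, wp_call,
        List.getElem?_cons_zero, List.getElem?_cons_succ, Option.some.injEq, exists_eq_left',
        Val.fst?_pair, Val.snd?_pair, Val.isPair_pair, Val.isPair_nil, if_true, if_false,
        joinE, Val.ofList_cons, Val.ofSrs_cons, Val.ofWeighted, Val.ofRanks_cons,
        Val.ofBits_cons, Val.isPair_ofBool]
      refine ih.wpCall fun t ht => ⟨rfl, ?_⟩
      rw [List.length_cons]
      omega

/-- Without ranks, an item is dominated by exactly the items of its group. Groups are contiguous in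
the sorted list, so its sum is its own weight, plus the sum of the next item if that one is in the
same group. By sortedness a single `≤` tests this. -/
theorem call_suffix {B : ℕ} (l : List (Weighted D Dom)) (hl : IsInstance B [] l) :
    Call S θ (funs c₁ c₂) 13 (.ofList (l.map Val.ofWeighted)) (.ofSrs (domSums l))
      ((keyCost B + 60) * l.length + 10) := by
  have hbs : ∀ x ∈ l, x.bs = [] := fun x hx => by simpa using hl.ranks x hx
  induction l with
  | nil =>
    refine .of rfl ?_
    simp only [wp_ifPair, wp_fst, wp_snd, wp_letIn, wp_var, wp_pair, wp_nil, wp_call,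
      List.getElem?_cons_zero, List.getElem?_cons_succ, Option.some.injEq, exists_eq_left',
      Val.fst?_pair, Val.snd?_pair, Val.isPair_pair, Val.isPair_nil, if_true, if_false,
      suffixE, List.map_nil, Val.ofList_nil, domSums, Val.ofSrs_nil]
    exact ⟨trivial, by omega⟩
  | cons a l ih =>
    have ih := ih hl.tail fun x hx => hbs x (by simp [hx])
    refine .of rfl ?_
    have ha := hbs a (by simp)
    have hself : ∀ g : Key Dom, ∀ w : D, contrib g [] g [] w = w := fun g w => by
      simp [contrib, RankLe]
    simp only [wp_ifPair, wp_fst, wp_snd, wp_letIn, wp_var, wp_pair, wp_nil, wp_call,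
      List.getElem?_cons_zero, List.getElem?_cons_succ, Option.some.injEq, exists_eq_left',
      Val.fst?_pair, Val.snd?_pair, Val.isPair_pair, Val.isPair_nil, if_true, if_false,
      suffixE, List.map_cons, Val.ofList_cons]
    refine ih.wpCall fun t ht => ?_
    obtain _ | ⟨b, l⟩ := l
    · simp only [wp_ifPair, wp_fst, wp_snd, wp_letIn, wp_var, wp_pair, wp_nil, wp_call,
      List.getElem?_cons_zero, List.getElem?_cons_succ, Option.some.injEq, exists_eq_left',
      Val.fst?_pair, Val.snd?_pair, Val.isPair_pair, Val.isPair_nil, if_true, if_false,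
      domSums, Val.ofSrs_nil, Val.ofWeighted]
      refine ⟨by simp [ha, hself], ?_⟩
      simp only [List.length_cons, List.length_nil, mul_add] at *
      omega
    · have hb := hbs b (by simp)
      have hle : a.g ≤ b.g := (List.pairwise_cons.1 hl.sorted).1 b (by simp)
      simp only [wp_ifPair, wp_fst, wp_snd, wp_letIn, wp_var, wp_pair, wp_nil, wp_call,
        List.getElem?_cons_zero, List.getElem?_cons_succ, Option.some.injEq, exists_eq_left',
        Val.fst?_pair, Val.snd?_pair, Val.isPair_pair, Val.isPair_nil, if_true, if_false,
        domSums, Val.ofSrs_cons, Val.ofWeighted, List.map_cons, Val.ofList_cons]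
      refine (call_keyLe (hl.shape b (by simp) a (by simp)) (hl.length_le b (by simp))).wpCall
        fun t' ht' => ?_
      simp only [wp_ifPair, wp_fst, wp_snd, wp_letIn, wp_var, wp_pair, wp_nil, wp_call,
        List.getElem?_cons_zero, List.getElem?_cons_succ, Option.some.injEq, exists_eq_left',
        Val.fst?_pair, Val.snd?_pair, Val.isPair_pair, Val.isPair_nil, if_true, if_false,
        Val.isPair_ofProp, wp_srAdd, Val.sr?_sr]
      have hcost : (keyCost B + 60) * (a :: b :: l).length + 10 =
          (keyCost B + 60) * (b :: l).length + 10 + (keyCost B + 60) := by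
        simp only [List.length_cons]; ring
      rw [hcost]
      split_ifs with h
      · have hab : a.g = b.g := le_antisymm hle h
        refine ⟨?_, by omega⟩
        congr 2
        rw [domSum_cons a a, ha, hself]
        simp only [domSum, hab, ha, hb]
      · refine ⟨?_, by omega⟩
        congr 2
        rw [domSum_cons a a, ha, hself, domSum, List.sum_eq_zero, add_zero]
        simp only [List.mem_map]
        rintro _ ⟨c, hc, rfl⟩
        rw [contrib, ind, if_neg, zero_mul]
        intro h'
        refine h ?_
        rw [← h'.1]
        rcases List.mem_cons.1 hc with rfl | hc
        · exact le_rfl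
        · exact (List.pairwise_cons.1 (List.pairwise_cons.1 hl.sorted).2).1 c hc

/-- The constant in the time of the divide-and-conquer algorithm. -/
def solveConst (B : ℕ) : ℕ := keyCost B + 600

/-- Outer induction on the number of ranks, for the cross instance and exhausted ranks; inner
induction on the digits of the first rank, for the two halves. The halves partition the items, so a
cost proportional to their number does not multiply. -/
theorem call_solve {B : ℕ} (hs : List ℕ) (l : List (Weighted D Dom)) (hl : IsInstance B hs l) :
    Call S θ (funs c₁ c₂) 14 (.ofList (l.map Val.ofWeighted)) (.ofSrs (domSums l))
      (solveConst B * (l.length * visits hs) + 10) := by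
  -- A half may be empty; the additive `10` of the bound pays for the call on it.
  have hnil : ∀ N : ℕ, Call S θ (funs c₁ c₂) 14 (.nil : Val D Dom) .nil (N + 10) := fun N => by
    refine .of rfl ?_
    simp only [wp_ifPair, wp_fst, wp_snd, wp_letIn, wp_var, wp_pair, wp_nil, wp_call,
      List.getElem?_cons_zero, List.getElem?_cons_succ, Option.some.injEq, exists_eq_left',
      Val.fst?_pair, Val.snd?_pair, Val.isPair_pair, Val.isPair_nil, if_true, if_false,
      solveE]
    exact ⟨trivial, by omega⟩
  induction hs generalizing l with
  | nil =>
    have hb := call_suffix (S := S) (θ := θ) (c₁ := c₁) (c₂ := c₂) l hl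
    obtain _ | ⟨a, l⟩ := l
    · exact hnil _
    · refine .of rfl ?_
      have ha : a.bs = [] := by simpa using hl.ranks a (by simp)
      rw [List.map_cons, Val.ofList_cons, Val.ofWeighted] at hb ⊢
      simp only [wp_ifPair, wp_fst, wp_snd, wp_letIn, wp_var, wp_pair, wp_nil, wp_call,
        List.getElem?_cons_zero, List.getElem?_cons_succ, Option.some.injEq, exists_eq_left',
        Val.fst?_pair, Val.snd?_pair, Val.isPair_pair, Val.isPair_nil, if_true, if_false,
        solveE, ha, Val.ofRanks_nil]
      rw [ha] at hb
      refine hb.wpCall fun t ht => ⟨rfl, ?_⟩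
      simp only [visits, solveConst, List.length_cons, mul_one] at *
      ring_nf at *
      omega
  | cons h hs ih =>
    induction h generalizing l with
    | zero =>
      have hp := call_pop (S := S) (θ := θ) (c₁ := c₁) (c₂ := c₂) l hl
      have hr := ih (l.map Weighted.popRank) (hl.map _ (fun _ => rfl) fun x hx => by
        have := hl.ranks x hx
        simp [Weighted.popRank, List.map_tail, this])
      rw [domSums_popRank _ hl.ranks] at hr
      obtain _ | ⟨a, l⟩ := l
      · exact hnil _
      · refine .of rfl ?_
        have ha : ∃ s, a.bs = [] :: s := by
          have h := hl.ranks a (by simp)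
          revert h
          rcases a.bs with _ | ⟨x, s⟩ <;> simp +contextual
        obtain ⟨s, ha⟩ := ha
        rw [List.map_cons (f := Val.ofWeighted), Val.ofList_cons, Val.ofWeighted, ha] at hp
        rw [List.map_cons (f := Val.ofWeighted), Val.ofList_cons, Val.ofWeighted, ha]
        simp only [wp_ifPair, wp_fst, wp_snd, wp_letIn, wp_var, wp_pair, wp_nil, wp_call,
          List.getElem?_cons_zero, List.getElem?_cons_succ, Option.some.injEq, exists_eq_left',
          Val.fst?_pair, Val.snd?_pair, Val.isPair_pair, Val.isPair_nil, if_true, if_false,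
          solveE, Val.ofRanks_cons, Val.ofBits_nil] at hp ⊢
        refine hp.wpCall fun t ht => ?_
        refine hr.wpCall fun t' ht' => ⟨rfl, ?_⟩
        rw [List.length_map] at ht'
        have e : solveConst B * ((a :: l).length * visits (0 :: hs)) =
            solveConst B * ((a :: l).length * visits hs) + solveConst B * (a :: l).length := by
          simp only [visits]; ring
        have e' : 600 * (a :: l).length ≤ solveConst B * (a :: l).length :=
          Nat.mul_le_mul_right _ (by unfold solveConst; omega)
        rw [e]
        simp only [List.length_cons] at *
        omega
    | succ h ih' =>
      have hlo := call_half (S := S) (θ := θ) (c₁ := c₁) (c₂ := c₂) false l hl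
      have hhi := call_half (S := S) (θ := θ) (c₁ := c₁) (c₂ := c₂) true l hl
      have hcr := call_cross (S := S) (θ := θ) (c₁ := c₁) (c₂ := c₂) l hl
      have hj := call_join (S := S) (θ := θ) (c₁ := c₁) (c₂ := c₂) l hl
      have h0 := ih' _ (hl.half false)
      have h1 := ih' _ (hl.half true)
      have h2 := ih (l.map Weighted.cross) (hl.map _ (fun _ => rfl) fun x hx => by
        have := hl.ranks x hx
        simp [Weighted.cross, List.map_tail, this])
      have hlen := half_length_add l
      -- The recurrence behind `visits`: per item, one cross instance, one half and one unit of
      -- local work.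
      have e : ∀ l : List (Weighted D Dom), solveConst B * (l.length * visits ((h + 1) :: hs)) =
          solveConst B * (l.length * visits hs) + solveConst B * (l.length * visits (h :: hs)) +
          solveConst B * l.length := fun l => by
        simp only [visits]; ring
      have e' : 600 * l.length ≤ solveConst B * l.length :=
        Nat.mul_le_mul_right _ (by unfold solveConst; omega)
      have e'' : solveConst B * (l.length * visits (h :: hs)) =
          solveConst B * ((half false l).length * visits (h :: hs)) +
          solveConst B * ((half true l).length * visits (h :: hs)) := by
        rw [← hlen]; ring
      rw [List.length_map] at h2
      by_cases hne : l = []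
      · subst hne
        exact hnil _
      · obtain ⟨a, l', hl'⟩ := List.exists_cons_of_ne_nil hne
        refine .of rfl ?_
        obtain ⟨v, w, x, z, u, hv⟩ : ∃ v w x z u, Val.ofList (l.map Val.ofWeighted) =
            .pair (.pair v (.pair (.pair (.pair x w) z) u)) (Val.ofList (l'.map Val.ofWeighted)) := by
          obtain ⟨c, y, s, ha, hy, hs'⟩ := exists_of_shape (hl.ranks a (by simp [hl']))
          rw [hl', ha]
          exact ⟨_, _, _, _, _, rfl⟩
        -- Since the list is nonempty, the term linear in its length also absorbs the fixed
        -- overheads of the seven calls.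
        have hpos : 1 ≤ l.length := by simp [hl']
        rw [hv] at hcr hlo hhi hj ⊢
        simp only [wp_ifPair, wp_fst, wp_snd, wp_letIn, wp_var, wp_pair, wp_nil, wp_call,
          List.getElem?_cons_zero, List.getElem?_cons_succ, Option.some.injEq, exists_eq_left',
          Val.fst?_pair, Val.snd?_pair, Val.isPair_pair, Val.isPair_nil, if_true, if_false,
          solveE]
        refine hcr.wpCall fun t₁ ht₁ => ?_
        refine h2.wpCall fun t₂ ht₂ => ?_
        refine hlo.wpCall fun t₃ ht₃ => ?_
        refine h0.wpCall fun t₄ ht₄ => ?_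
        refine hhi.wpCall fun t₅ ht₅ => ?_
        refine h1.wpCall fun t₆ ht₆ => ?_
        refine hj.wpCall fun t₇ ht₇ => ⟨rfl, ?_⟩
        rw [e]
        omega

end Dominance

/-! ### From items to the output table -/

section Output

variable {n k : ℕ} {D : Type u} {Dom : Fin n → Type v} [Semiring D] {α : Type*} {τ : Type*}

/-- An item for the output, with its key. -/
def Val.ofEntry (fk : τ → Key Dom) (raw : τ → Val D Dom) : τ × D → Val D Dom :=
  .ofItem (fun e => fk e.1) (fun _ => .nil) fun e => .pair (raw e.1) (.sr e.2)

/-- The total value of the entries with a given key. -/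
noncomputable def total (E : List (τ × D)) (f : τ) : D := (E.map fun e => ind D (e.1 = f) * e.2).sum

@[simp] theorem total_nil (f : τ) : total ([] : List (τ × D)) f = 0 := rfl

@[simp] theorem total_cons (e : τ × D) (E : List (τ × D)) (f : τ) :
    total (e :: E) f = ind D (e.1 = f) * e.2 + total E f := by
  simp [total]

theorem total_perm {E E' : List (τ × D)} (h : E.Perm E') (f : τ) : total E f = total E' f :=
  (h.map _).sum_eq

open Classical in
/-- Adds an entry to a list of entries, at the head if the key is the same. -/
noncomputable def addEntry (e : τ × D) : List (τ × D) → List (τ × D)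
  | [] => [e]
  | e' :: l => if e'.1 = e.1 then (e.1, e.2 + e'.2) :: l else e :: e' :: l

/-- Adds up consecutive entries with the same key. -/
noncomputable def combine (E : List (τ × D)) : List (τ × D) := E.foldr addEntry []

theorem total_addEntry (e : τ × D) (E : List (τ × D)) (f : τ) :
    total (addEntry e E) f = ind D (e.1 = f) * e.2 + total E f := by
  obtain _ | ⟨e', E⟩ := E
  · simp [addEntry]
  · rw [addEntry]
    split_ifs with h
    · simp [h, mul_add, add_assoc]
    · simp

theorem total_combine (E : List (τ × D)) (f : τ) : total (combine E) f = total E f := by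
  induction E with
  | nil => rfl
  | cons e E ih => rw [combine, List.foldr_cons, total_addEntry, total_cons, ← ih, combine]

theorem mem_addEntry {e : τ × D} {E : List (τ × D)} {x : τ × D} (hx : x ∈ addEntry e E) :
    x.1 = e.1 ∨ x ∈ E := by
  obtain _ | ⟨e', E⟩ := E
  · left
    rw [addEntry, List.mem_singleton] at hx
    rw [hx]
  · rw [addEntry] at hx
    split_ifs at hx with h
    · rcases List.mem_cons.1 hx with rfl | hx
      · exact .inl rfl
      · exact .inr (by simp [hx])
    · rcases List.mem_cons.1 hx with rfl | hx
      · exact .inl rfl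
      · exact .inr hx

theorem exists_of_mem_combine {E : List (τ × D)} {x : τ × D} (hx : x ∈ combine E) :
    ∃ e ∈ E, e.1 = x.1 := by
  induction E with
  | nil => simp [combine] at hx
  | cons e E ih =>
    rw [combine, List.foldr_cons] at hx
    rcases mem_addEntry hx with h | h
    · exact ⟨e, by simp, h.symm⟩
    · obtain ⟨e', h1, h2⟩ := ih h
      exact ⟨e', by simp [h1], h2⟩

theorem total_eq_of_mem {E : List (τ × D)} (hE : (E.map Prod.fst).Nodup) {e : τ × D} (he : e ∈ E) :
    total E e.1 = e.2 := by
  induction E with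
  | nil => simp at he
  | cons e' E ih =>
    rw [List.map_cons, List.nodup_cons] at hE
    rw [total_cons]
    rcases List.mem_cons.1 he with rfl | he
    · have : total E e.1 = 0 := by
        refine List.sum_eq_zero fun x hx => ?_
        obtain ⟨y, hy, rfl⟩ := List.mem_map.1 hx
        have : y.1 ≠ e.1 := fun h => hE.1 (h ▸ List.mem_map_of_mem hy)
        simp [this]
      simp [this]
    · have : e'.1 ≠ e.1 := fun h => hE.1 (h ▸ List.mem_map_of_mem he)
      simp [this, ih hE.2 he]

theorem mem_of_total_ne_zero {E : List (τ × D)} {f : τ} (h : total E f ≠ 0) :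
    ∃ e ∈ E, e.1 = f := by
  by_contra! hE
  refine h (List.sum_eq_zero fun x hx => ?_)
  obtain ⟨y, hy, rfl⟩ := List.mem_map.1 hx
  simp [hE y hy]

variable [(i : Fin n) → LinearOrder (Dom i)]
  {S : Fin k → Finset (Fin n)} {θ : (j : Fin k) → (i : {i // i ∈ S j}) → Dom i.1 → ℝ}
  {c₁ c₂ : Expr}

theorem addEntry_sorted {fk : τ → Key Dom} (hfk : fk.Injective) {e : τ × D} {E : List (τ × D)}
    (he : ∀ x ∈ E, fk e.1 ≤ fk x.1) (hE : E.Pairwise fun x y => fk x.1 < fk y.1) :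
    (addEntry e E).Pairwise fun x y => fk x.1 < fk y.1 := by
  obtain _ | ⟨e', E⟩ := E
  · simp [addEntry]
  · rw [addEntry]
    have hE' := List.pairwise_cons.1 hE
    split_ifs with h
    · refine List.pairwise_cons.2 ⟨fun x hx => ?_, hE'.2⟩
      rw [← h]
      exact hE'.1 x hx
    · have hlt : fk e.1 < fk e'.1 := (he e' (by simp)).lt_of_ne fun h' => h (hfk h').symm
      refine List.pairwise_cons.2 ⟨fun x hx => ?_, hE⟩
      rcases List.mem_cons.1 hx with rfl | hx
      · exact hlt
      · exact hlt.trans (hE'.1 x hx)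

/-- In a sorted list equal keys are adjacent, so merging neighbours leaves strictly increasing keys.
In particular no output tuple occurs twice. -/
theorem combine_sorted {fk : τ → Key Dom} (hfk : fk.Injective) {E : List (τ × D)}
    (hE : E.Pairwise fun x y => fk x.1 ≤ fk y.1) :
    (combine E).Pairwise fun x y => fk x.1 < fk y.1 := by
  induction E with
  | nil => exact .nil
  | cons e E ih =>
    rw [List.pairwise_cons] at hE
    refine addEntry_sorted hfk (fun x hx => ?_) (ih hE.2)
    obtain ⟨e', h1, h2⟩ := exists_of_mem_combine hx
    rw [← h2]
    exact hE.1 e' h1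

theorem call_combine {fk : τ → Key Dom} (raw : τ → Val D Dom) {B : ℕ} (hfk : fk.Injective)
    (hs : ∀ x y, SameShape (fk x) (fk y)) (hB : ∀ x, (fk x).length ≤ B) (E : List (τ × D))
    (hE : E.Pairwise fun x y => fk x.1 ≤ fk y.1) :
    Call S θ (funs c₁ c₂) 17 (.ofList (E.map (Val.ofEntry fk raw)))
      (.ofList ((combine E).map (Val.ofEntry fk raw))) ((keyCost B + 80) * E.length + 10) := by
  induction E with
  | nil =>
    refine .of rfl ?_
    simp only [wp_ifPair, wp_fst, wp_snd, wp_letIn, wp_var, wp_pair, wp_nil, wp_call,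
      List.getElem?_cons_zero, List.getElem?_cons_succ, Option.some.injEq, exists_eq_left',
      Val.fst?_pair, Val.snd?_pair, Val.isPair_pair, Val.isPair_nil, if_true, if_false,
      combineE, List.map_nil, Val.ofList_nil, combine, List.foldr_nil]
    exact ⟨trivial, by omega⟩
  | cons e E ih =>
    have hE' := List.pairwise_cons.1 hE
    refine .of rfl ?_
    simp only [wp_ifPair, wp_fst, wp_snd, wp_letIn, wp_var, wp_pair, wp_nil, wp_call,
      List.getElem?_cons_zero, List.getElem?_cons_succ, Option.some.injEq, exists_eq_left',
      Val.fst?_pair, Val.snd?_pair, Val.isPair_pair, Val.isPair_nil, if_true, if_false,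
      combineE, List.map_cons, Val.ofList_cons]
    refine (ih hE'.2).wpCall fun t ht => ?_
    have hmem : ∀ x ∈ combine E, fk e.1 ≤ fk x.1 := fun x hx => by
      obtain ⟨e', h1, h2⟩ := exists_of_mem_combine hx
      rw [← h2]
      exact hE'.1 e' h1
    have hc : combine (e :: E) = addEntry e (combine E) := rfl
    rw [hc]
    rw [List.length_cons, mul_add, mul_one]
    rcases hcE : combine E with _ | ⟨e', E'⟩
    · simp only [wp_ifPair, wp_fst, wp_snd, wp_letIn, wp_var, wp_pair, wp_nil, wp_call,
      List.getElem?_cons_zero, List.getElem?_cons_succ, Option.some.injEq, exists_eq_left',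
      Val.fst?_pair, Val.snd?_pair, Val.isPair_pair, Val.isPair_nil, if_true, if_false,
      List.map_nil, Val.ofList_nil, addEntry]
      exact ⟨rfl, by omega⟩
    · simp only [wp_ifPair, wp_fst, wp_snd, wp_letIn, wp_var, wp_pair, wp_nil, wp_call,
      List.getElem?_cons_zero, List.getElem?_cons_succ, Option.some.injEq, exists_eq_left',
      Val.fst?_pair, Val.snd?_pair, Val.isPair_pair, Val.isPair_nil, if_true, if_false,
      List.map_cons, Val.ofList_cons, addEntry, Val.ofEntry, Val.ofItem]
      refine (call_keyLe (hs _ _) (hB _)).wpCall fun t' ht' => ?_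
      simp only [wp_ifPair, wp_fst, wp_snd, wp_letIn, wp_var, wp_pair, wp_nil, wp_call,
        List.getElem?_cons_zero, List.getElem?_cons_succ, Option.some.injEq, exists_eq_left',
        Val.fst?_pair, Val.snd?_pair, Val.isPair_pair, Val.isPair_nil, if_true, if_false,
        Val.isPair_ofProp, wp_srAdd, Val.sr?_sr]
      -- The head of the combined tail is never below `e`, so one `≤` decides equality.
      have hiff : fk e'.1 ≤ fk e.1 ↔ e'.1 = e.1 :=
        ⟨fun h => hfk (h.antisymm (hmem e' (by simp [hcE]))), fun h => h ▸ le_rfl⟩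
      by_cases h : e'.1 = e.1
      · rw [if_pos (hiff.2 h), if_pos h]
        exact ⟨rfl, by omega⟩
      · rw [if_neg (hiff.not.2 h), if_neg h]
        exact ⟨rfl, by omega⟩

/-- A table lists the support only, while sums and products of nonzero elements of a semiring may
vanish; zeros must be filtered out. -/
theorem call_nonzero {fk : τ → Key Dom} (raw : τ → Val D Dom) (E : List (τ × D)) :
    ∃ E' : List (τ × D), E'.Sublist E ∧ (∀ e, e ∈ E' ↔ e ∈ E ∧ e.2 ≠ 0) ∧
      Call S θ (funs c₁ c₂) 18 (.ofList (E.map (Val.ofEntry fk raw)))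
        (.ofList (E'.map fun e => .pair (raw e.1) (.sr e.2))) (40 * E.length + 10) := by
  induction E with
  | nil =>
    refine ⟨[], .slnil, by simp, .of rfl ?_⟩
    simp only [wp_ifPair, wp_fst, wp_snd, wp_letIn, wp_var, wp_pair, wp_nil, wp_call,
      List.getElem?_cons_zero, List.getElem?_cons_succ, Option.some.injEq, exists_eq_left',
      Val.fst?_pair, Val.snd?_pair, Val.isPair_pair, Val.isPair_nil, if_true, if_false,
      nonzeroE, List.map_nil, Val.ofList_nil]
    exact ⟨trivial, by omega⟩
  | cons e E ih =>
    obtain ⟨E', h1, h2, h3⟩ := ih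
    by_cases he : e.2 = 0
    · refine ⟨E', h1.cons _, fun x => ?_, .of rfl ?_⟩
      · rw [h2, List.mem_cons]
        refine ⟨fun h => ⟨.inr h.1, h.2⟩, fun h => ⟨h.1.resolve_left ?_, h.2⟩⟩
        rintro rfl
        exact h.2 he
      · simp only [wp_ifPair, wp_fst, wp_snd, wp_letIn, wp_var, wp_pair, wp_nil, wp_call,
        List.getElem?_cons_zero, List.getElem?_cons_succ, Option.some.injEq, exists_eq_left',
        Val.fst?_pair, Val.snd?_pair, Val.isPair_pair, Val.isPair_nil, if_true, if_false,
        nonzeroE, List.map_cons, Val.ofList_cons, Val.ofEntry, Val.ofItem, wp_srIsZero,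
          Val.sr?_sr, Val.isPair_ofProp, he]
        refine h3.wpCall fun t ht => ⟨rfl, ?_⟩
        rw [List.length_cons]
        omega
    · refine ⟨e :: E', h1.cons_cons _, fun x => ?_, .of rfl ?_⟩
      · simp only [List.mem_cons, h2]
        constructor
        · rintro (rfl | h)
          · exact ⟨.inl rfl, he⟩
          · exact ⟨.inr h.1, h.2⟩
        · rintro ⟨rfl | h, h'⟩
          · exact .inl rfl
          · exact .inr ⟨h, h'⟩
      · simp only [wp_ifPair, wp_fst, wp_snd, wp_letIn, wp_var, wp_pair, wp_nil, wp_call,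
        List.getElem?_cons_zero, List.getElem?_cons_succ, Option.some.injEq, exists_eq_left',
        Val.fst?_pair, Val.snd?_pair, Val.isPair_pair, Val.isPair_nil, if_true, if_false,
        nonzeroE, List.map_cons, Val.ofList_cons, Val.ofEntry, Val.ofItem, wp_srIsZero,
          Val.sr?_sr, Val.isPair_ofProp, he]
        refine h3.wpCall fun t ht => ⟨rfl, ?_⟩
        rw [List.length_cons]
        omega

theorem call_append (a b : List (Val D Dom)) :
    Call S θ (funs c₁ c₂) 19 (.pair (.ofList a) (.ofList b)) (.ofList (a ++ b))
      (30 * a.length + 10) := by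
  induction a with
  | nil =>
    refine .of rfl ?_
    simp only [wp_ifPair, wp_fst, wp_snd, wp_letIn, wp_var, wp_pair, wp_nil, wp_call,
      List.getElem?_cons_zero, List.getElem?_cons_succ, Option.some.injEq, exists_eq_left',
      Val.fst?_pair, Val.snd?_pair, Val.isPair_pair, Val.isPair_nil, if_true, if_false,
      appendE, Val.ofList_nil, List.nil_append]
    exact ⟨trivial, by omega⟩
  | cons x a ih =>
    refine .of rfl ?_
    simp only [wp_ifPair, wp_fst, wp_snd, wp_letIn, wp_var, wp_pair, wp_nil, wp_call,
      List.getElem?_cons_zero, List.getElem?_cons_succ, Option.some.injEq, exists_eq_left',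
      Val.fst?_pair, Val.snd?_pair, Val.isPair_pair, Val.isPair_nil, if_true, if_false,
      appendE, Val.ofList_cons, List.cons_append]
    refine ih.wpCall fun t ht => ⟨rfl, ?_⟩
    rw [List.length_cons]
    omega

/-- The data of an item besides its keys and ranks. -/
def Val.ofData (fk : τ → Key Dom) (raw : τ → Val D Dom) (g : α → Key Dom) (w : α → D)
    (pay : α → Option (τ × D)) (x : α) : Val D Dom :=
  .pair (.ofKey (g x)) (.pair (.sr (w x))
    ((pay x).elim .nil fun e => .pair (.ofKey (fk e.1)) (.pair (raw e.1) (.sr e.2))))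

theorem call_strip (key : α → Key Dom) (ks : List (α → Key Dom)) (bs : α → List (List Bool))
    (fk : τ → Key Dom) (raw : τ → Val D Dom) (g : α → Key Dom) (w : α → D)
    (pay : α → Option (τ × D)) (l : List α) :
    Call S θ (funs c₁ c₂) 15
      (.ofList (l.map (Val.ofRanked key ks bs (Val.ofData fk raw g w pay))))
      (.ofList ((l.map fun x => (⟨g x, bs x, w x⟩ : Weighted D Dom)).map Val.ofWeighted))
      (45 * l.length + 5) := by
  rw [List.map_map]
  refine call_map rfl _ _ 30 l fun a ha ρ => ?_
  simp only [wp_ifPair, wp_fst, wp_snd, wp_letIn, wp_var, wp_pair, wp_nil, wp_call,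
    List.getElem?_cons_zero, List.getElem?_cons_succ, Option.some.injEq, exists_eq_left',
    Val.fst?_pair, Val.snd?_pair, Val.isPair_pair, Val.isPair_nil, if_true, if_false,
    stripE, Val.ofRanked, Val.ofItem, Val.ofData]
  exact ⟨rfl, by omega⟩

/-- Results have to be correct only at items with a payload, the queries; those at points are thrown
away. The sum multiplies from the right, since `D` need not be commutative. -/
theorem call_finish (key : α → Key Dom) (ks : List (α → Key Dom)) (bs : α → List (List Bool))
    (fk : τ → Key Dom) (raw : τ → Val D Dom) (g : α → Key Dom) (w : α → D)
    (pay : α → Option (τ × D)) (G : α → D) (l : List α) (R : List D)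
    (hR : List.Forall₂ (fun x r => ∀ e, pay x = some e → r = G x) l R) :
    Call S θ (funs c₁ c₂) 16
      (.pair (.ofList (l.map (Val.ofRanked key ks bs (Val.ofData fk raw g w pay)))) (.ofSrs R))
      (.ofList ((l.filterMap fun x => (pay x).map fun e => (e.1, e.2 * G x)).map
        (Val.ofEntry fk raw))) (60 * l.length + 10) := by
  induction hR with
  | nil =>
    refine .of rfl ?_
    simp only [wp_ifPair, wp_fst, wp_snd, wp_letIn, wp_var, wp_pair, wp_nil, wp_call,
      List.getElem?_cons_zero, List.getElem?_cons_succ, Option.some.injEq, exists_eq_left',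
      Val.fst?_pair, Val.snd?_pair, Val.isPair_pair, Val.isPair_nil, if_true, if_false,
      finishE, List.map_nil, Val.ofList_nil, List.filterMap_nil]
    exact ⟨trivial, by omega⟩
  | @cons x r l R h _ ih =>
    refine .of rfl ?_
    rw [List.length_cons, List.filterMap_cons]
    rcases hx : pay x with _ | e
    · simp only [wp_ifPair, wp_fst, wp_snd, wp_letIn, wp_var, wp_pair, wp_nil, wp_call,
      List.getElem?_cons_zero, List.getElem?_cons_succ, Option.some.injEq, exists_eq_left',
      Val.fst?_pair, Val.snd?_pair, Val.isPair_pair, Val.isPair_nil, if_true, if_false,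
      finishE, List.map_cons, Val.ofList_cons, Val.ofRanked, Val.ofItem, Val.ofData, hx,
        Option.elim_none, Option.map_none, Val.ofSrs_cons]
      exact ih.wpCall fun t ht => ⟨rfl, by omega⟩
    · simp only [wp_ifPair, wp_fst, wp_snd, wp_letIn, wp_var, wp_pair, wp_nil, wp_call,
      List.getElem?_cons_zero, List.getElem?_cons_succ, Option.some.injEq, exists_eq_left',
      Val.fst?_pair, Val.snd?_pair, Val.isPair_pair, Val.isPair_nil, if_true, if_false,
      finishE, List.map_cons, Val.ofList_cons, Val.ofRanked, Val.ofItem, Val.ofData, hx,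
        Option.elim_some, Option.map_some, wp_srMul, Val.sr?_sr, Val.ofSrs_cons]
      refine ih.wpCall fun t ht => ⟨?_, by omega⟩
      rw [h e hx]
      rfl

/-! ### The pipeline from keyed items to the output table -/

/-- The part of the main expression after ranking. -/
def tailE : Expr :=
  .call 18 (.call 17 (.call 3 (.call 16 (.pair (.var 0) (.call 14 (.call 15 (.var 0)))))))

/-- The constant in the time after the conversion of the input. -/
def pipeConst (B d : ℕ) : ℕ :=
  (d + 1) * rankConst B + 2 * solveConst B + sortConst B + keyCost B + 1000

/-- The total weight of the items that dominate an item strictly in all keys. -/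
noncomputable def strictSum (keys : List (α → Key Dom)) (g : α → Key Dom) (w : α → D) (l : List α)
    (x : α) : D :=
  (l.map fun y => ind D (g y = g x ∧ ∀ f ∈ keys, f x < f y) * w y).sum

/-- Position in the list replaces the last key. Items before `x` are not above it in the last key
and cannot dominate strictly. Items after `x` with nonzero weight differ from it in that key and are
therefore above. The item `x` is in its own suffix but weighs nothing. -/
theorem domSum_eq_strictSum {key : α → Key Dom} {ks : List (α → Key Dom)}
    {bs : α → List (List Bool)} {g : α → Key Dom} {w : α → D} {pre post : List α} {x : α}
    (hx : w x = 0)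
    (hsort : (pre ++ x :: post).Pairwise fun x y =>
      (key :: ks).getLast (by simp) x ≤ (key :: ks).getLast (by simp) y)
    (hne : ∀ y ∈ pre ++ x :: post, w y ≠ 0 → ∀ f ∈ key :: ks, f x ≠ f y)
    (hdom : ∀ y ∈ pre ++ x :: post, (∀ f ∈ (key :: ks).dropLast, f x ≠ f y) →
      (RankLe (bs x) (bs y) ↔ ∀ f ∈ (key :: ks).dropLast, f x < f y)) :
    domSum (⟨g x, bs x, w x⟩ : Weighted D Dom)
        ((x :: post).map fun x => (⟨g x, bs x, w x⟩ : Weighted D Dom)) =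
      strictSum (key :: ks) g w (pre ++ x :: post) x := by
  rw [List.pairwise_append] at hsort
  obtain ⟨_, hpost, hpre⟩ := hsort
  rw [List.pairwise_cons] at hpost
  have hmemlast : (key :: ks).getLast (by simp) ∈ key :: ks := List.getLast_mem _
  have h1 : (pre.map fun y => ind D (g y = g x ∧ ∀ f ∈ key :: ks, f x < f y) * w y).sum = 0 := by
    refine List.sum_eq_zero fun z hz => ?_
    obtain ⟨y, hy, rfl⟩ := List.mem_map.1 hz
    have : ¬ (g y = g x ∧ ∀ f ∈ key :: ks, f x < f y) := fun h =>
      (h.2 _ hmemlast).not_ge (hpre y hy x (by simp))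
    rw [ind, if_neg this, zero_mul]
  rw [strictSum, List.map_append, List.sum_append, h1, zero_add, domSum, List.map_map]
  congr 1
  refine List.map_congr_left fun y hy => ?_
  by_cases hw : w y = 0
  · simp [contrib, hw]
  · have hy' : y ∈ post := by
      rcases List.mem_cons.1 hy with rfl | h
      · exact absurd hx hw
      · exact h
    have hy'' : y ∈ pre ++ x :: post := by simp [hy']
    have hney := hne y hy'' hw
    have hsplit := List.dropLast_append_getLast (l := key :: ks) (by simp)
    have hR := hdom y hy'' fun f hf => hney f (List.mem_of_mem_dropLast hf)
    have hlast : (key :: ks).getLast (by simp) x < (key :: ks).getLast (by simp) y :=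
      (hpost.1 y hy').lt_of_ne (hney _ hmemlast)
    have : (∀ f ∈ key :: ks, f x < f y) ↔ RankLe (bs x) (bs y) := by
      rw [hR]
      refine ⟨fun h f hf => h f (List.mem_of_mem_dropLast hf), fun h f hf => ?_⟩
      rw [← hsplit, List.mem_append, List.mem_singleton] at hf
      rcases hf with hf | rfl
      · exact h f hf
      · exact hlast
    simp only [Function.comp, contrib, this]

/-- The ranked list is known only to exist, hence the form of a call followed by a continuation.
Through `hg` the final order is also an order by groups, as the suffix sums require. -/
theorem wp_pipeline (fk : τ → Key Dom) (raw : τ → Val D Dom) {B H : ℕ} (hfk : fk.Injective)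
    (hfks : ∀ x y, SameShape (fk x) (fk y)) (hfkB : ∀ x, (fk x).length ≤ B)
    (g : α → Key Dom) (w : α → D) (pay : α → Option (τ × D))
    (key : α → Key Dom) (ks : List (α → Key Dom)) (l : List α) (hl : l.Nodup)
    (hlH : l.length < 2 ^ H)
    (hshape : ∀ f ∈ g :: key :: ks, ∀ x y, SameShape (f x) (f y))
    (hB : ∀ f ∈ g :: key :: ks, ∀ x, (f x).length ≤ B)
    (hw : ∀ x e, pay x = some e → w x = 0)
    (hne : ∀ x y e, pay x = some e → w y ≠ 0 → ∀ f ∈ key :: ks, f x ≠ f y)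
    (hg : ∀ x y, (key :: ks).getLast (by simp) x ≤ (key :: ks).getLast (by simp) y → g x ≤ g y)
    (ρ : List (Val D Dom)) :
    wpCall S θ (funs c₁ c₂) 7
      (.ofList (l.map (Val.ofRanked key ks (fun _ => []) (Val.ofData fk raw g w pay))))
      fun y t => wp S θ (funs c₁ c₂) (y :: ρ) tailE fun out s =>
        (∃ E : List (τ × D), (E.map Prod.fst).Nodup ∧
          (∀ e, e ∈ E ↔ e.2 ≠ 0 ∧ e.2 = total (l.filterMap fun x => (pay x).map fun e =>
            (e.1, e.2 * strictSum (key :: ks) g w l x)) e.1) ∧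
          out = .ofList (E.map fun e => .pair (raw e.1) (.sr e.2))) ∧
        t + s + 1 ≤ pipeConst B ks.length * (l.length * (H + 2) ^ max ks.length 1 + 1) := by
  obtain ⟨l', bs, hs, hp, hsort, hbs, hhs, hlen, hdom, hc⟩ :=
    call_rank (S := S) (θ := θ) (c₁ := c₁) (c₂ := c₂) (Val.ofData fk raw g w pay) (B := B) (H := H)
      ks key (fun _ => []) [] l hl hlH
      (fun f hf x _ y _ => hshape f (by simp only [List.mem_cons] at hf ⊢; tauto) x y)
      (fun f hf x _ => hB f (by simp only [List.mem_cons] at hf ⊢; tauto) x) (by simp) (by simp)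
  have hlen' := hp.length_eq
  refine hc.wpCall fun t ht => ?_
  set W : α → Weighted D Dom := fun x => ⟨g x, bs x, w x⟩ with hW
  have hinst : IsInstance B hs (l'.map W) := by
    refine ⟨?_, ?_, ?_, ?_⟩
    · simpa [hW] using fun x _ y _ => hshape g (by simp) x y
    · simpa [hW] using fun x _ => hB g (by simp) x
    · rw [List.pairwise_map]
      exact hsort.imp fun {x y} h => hg x y h
    · simpa [hW] using fun x hx => hbs x (hp.mem_iff.1 hx)
  have hstrip := call_strip (S := S) (θ := θ) (c₁ := c₁) (c₂ := c₂)
    ((key :: ks).getLast (by simp)) [] bs fk raw g w pay l'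
  have hsolve := call_solve (S := S) (θ := θ) (c₁ := c₁) (c₂ := c₂) hs (l'.map W) hinst
  set G := strictSum (key :: ks) g w l with hG
  have hGp : strictSum (key :: ks) g w l' = G := by
    funext x
    exact (hp.map _).sum_eq
  -- Induction over suffixes with the prefix carried along, because a dominance sum sees only a
  -- suffix and `strictSum` the whole list.
  have hfor : ∀ post pre : List α, l' = pre ++ post →
      List.Forall₂ (fun x r => ∀ e, pay x = some e → r = G x) post (domSums (post.map W)) := by
    intro post
    induction post with
    | nil => exact fun _ _ => .nil
    | cons x post ih =>
      intro pre hpre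
      refine .cons (fun e he => ?_) (ih (pre ++ [x]) (by simp [hpre]))
      rw [← hGp, hpre]
      have hmem : ∀ y ∈ pre ++ x :: post, y ∈ l := fun y hy => hp.mem_iff.1 (hpre ▸ hy)
      refine domSum_eq_strictSum (hw x e he) (hpre ▸ hsort) (fun y _ hy f hf =>
        hne x y e he hy f hf) fun y hy hney => ?_
      rw [hdom x (hmem x (by simp)) y (hmem y hy) hney, RankLe]
      simp
  have hfinish := call_finish (S := S) (θ := θ) (c₁ := c₁) (c₂ := c₂)
    ((key :: ks).getLast (by simp)) [] bs fk raw g w pay G l' _ (hfor l' [] rfl)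
  set E₁ := l'.filterMap fun x => (pay x).map fun e => (e.1, e.2 * G x) with hE₁
  have hE₁l : E₁.length ≤ l'.length := List.length_filterMap_le _ _
  have hE₁p : E₁.Perm (l.filterMap fun x => (pay x).map fun e => (e.1, e.2 * G x)) :=
    hp.filterMap _
  obtain ⟨E₂, hE₂, hE₂s, hsortc⟩ := call_sort (S := S) (θ := θ) (c₁ := c₁) (c₂ := c₂)
    (fun e : τ × D => fk e.1) (fun _ => .nil) (fun e => .pair (raw e.1) (.sr e.2)) (B := B) H E₁
    (by omega) (fun x _ y _ => hfks _ _) (fun x _ => hfkB _)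
  have hcomb := call_combine (S := S) (θ := θ) (c₁ := c₁) (c₂ := c₂) raw hfk hfks hfkB E₂ hE₂s
  obtain ⟨E₃, hsub, hE₃, hnz⟩ := call_nonzero (S := S) (θ := θ) (c₁ := c₁) (c₂ := c₂) (fk := fk)
    raw (combine E₂)
  have hstrict := combine_sorted hfk hE₂s
  have hnd : ((combine E₂).map Prod.fst).Nodup := by
    rw [List.Nodup, List.pairwise_map]
    exact hstrict.imp fun {x y} h h' => h.ne (by rw [h'])
  have hclen : (combine E₂).length ≤ E₂.length := by
    clear * -
    induction E₂ with
    | nil => simp [combine]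
    | cons e E ih =>
      rw [combine, List.foldr_cons, ← combine, List.length_cons]
      rcases hcE : combine E with _ | ⟨e', E'⟩
      · simp [addEntry]
      · rw [addEntry]
        rw [hcE] at ih
        split_ifs <;> simp only [List.length_cons] at * <;> omega
  rw [tailE]
  simp only [wp_ifPair, wp_fst, wp_snd, wp_letIn, wp_var, wp_pair, wp_nil, wp_call,
    List.getElem?_cons_zero, List.getElem?_cons_succ, Option.some.injEq, exists_eq_left',
    Val.fst?_pair, Val.snd?_pair, Val.isPair_pair, Val.isPair_nil, if_true, if_false,
    ]
  refine hstrip.wpCall fun t₁ ht₁ => ?_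
  refine hsolve.wpCall fun t₂ ht₂ => ?_
  refine hfinish.wpCall fun t₃ ht₃ => ?_
  refine hsortc.wpCall fun t₄ ht₄ => ?_
  refine hcomb.wpCall fun t₅ ht₅ => ?_
  refine hnz.wpCall fun t₆ ht₆ => ⟨⟨E₃, hnd.sublist (hsub.map _), fun e => ?_, rfl⟩, ?_⟩
  · have htot : ∀ f, total (combine E₂) f = total (l.filterMap fun x => (pay x).map fun e =>
        (e.1, e.2 * G x)) f := fun f => by
      rw [total_combine, total_perm hE₂, total_perm hE₁p]
    rw [hE₃, ← htot]
    constructor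
    · rintro ⟨h1, h2⟩
      exact ⟨h2, (total_eq_of_mem hnd h1).symm⟩
    · rintro ⟨h1, h2⟩
      obtain ⟨e', h3, h4⟩ := mem_of_total_ne_zero (h2 ▸ h1)
      have : e' = e := Prod.ext h4 (by rw [h2, ← h4, total_eq_of_mem hnd h3])
      exact ⟨this ▸ h3, h1⟩
  · rw [List.length_map] at ht₂
    have hE₂l := hE₂.length_eq
    set m := l.length
    set P := (H + 2) ^ max ks.length 1 with hP
    -- Here the exponent must be at least 1: sorting costs a factor `H + 1` even if there are no
    -- ranks.
    have hP1 : H + 2 ≤ P := by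
      calc H + 2 = (H + 2) ^ 1 := (pow_one _).symm
        _ ≤ _ := Nat.pow_le_pow_right (by omega) (le_max_right _ _)
    have hP2 : visits hs ≤ 2 * P := by
      have h1 := visits_le hs hhs
      have h2 : (H + 2) ^ hs.length ≤ P :=
        Nat.pow_le_pow_right (by omega) (by rw [hlen]; simp)
      omega
    have hX : m * (H + 1) + 1 ≤ m * P + 1 := by
      have := Nat.mul_le_mul_left m (show H + 1 ≤ P by omega)
      omega
    have hmP : m ≤ m * P := Nat.le_mul_of_pos_right _ (by omega)
    have b1 : (ks.length + 1) * (rankConst B * (m * (H + 1) + 1)) ≤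
        (ks.length + 1) * rankConst B * (m * P + 1) := by
      rw [mul_assoc]
      gcongr
    have b2 : solveConst B * (l'.length * visits hs) ≤ 2 * solveConst B * (m * P) := by
      rw [hlen']
      calc solveConst B * (m * visits hs) ≤ solveConst B * (m * (2 * P)) := by gcongr
        _ = _ := by ring
    have b3 : sortConst B * (E₁.length * (H + 1) + 1) ≤ sortConst B * (m * P + 1) := by
      refine Nat.mul_le_mul_left _ (le_trans ?_ hX)
      gcongr
      omega
    have b4 : (keyCost B + 80) * E₂.length ≤ (keyCost B + 80) * (m * P) :=
      Nat.mul_le_mul_left _ (by omega)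
    have e1 : pipeConst B ks.length * (m * P + 1) =
        (ks.length + 1) * rankConst B * (m * P + 1) + 2 * solveConst B * (m * P) +
        2 * solveConst B + sortConst B * (m * P + 1) + (keyCost B + 80) * (m * P) + keyCost B +
        920 * (m * P) + 1000 := by
      unfold pipeConst; ring
    rw [e1]
    omega

end Output

/-! ### Comparison keys for dominance -/

theorem append_lt_append_left_iff {α : Type*} [LinearOrder α] (a : List α) {b c : List α} :
    a ++ b < a ++ c ↔ b < c := by
  induction a with
  | nil => rfl
  | cons x a ih => simp [List.cons_lt_cons_iff, ih]

/-- With equal lengths `a` is not a proper prefix of `b`, so the first difference lies inside both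
and the suffixes are irrelevant. -/
theorem append_lt_append_of_lt {α : Type*} [LinearOrder α] {a b : List α}
    (hab : a.length = b.length) (h : a < b) (c d : List α) : a ++ c < b ++ d := by
  induction a generalizing b with
  | nil =>
    obtain rfl : b = [] := by simpa using hab.symm
    exact absurd h (lt_irrefl _)
  | cons x a ih =>
    obtain _ | ⟨y, b⟩ := b
    · simp at hab
    rw [List.cons_lt_cons_iff] at h
    rw [List.cons_append, List.cons_append, List.cons_lt_cons_iff]
    exact h.imp id fun h => ⟨h.1, ih (by simpa using hab) h.2⟩

section DominanceKeys

variable {n k : ℕ} {Dom : Fin n → Type v} {α : Type*}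

/-- The key for a coordinate; the flag breaks ties. -/
noncomputable def coordKey (cs : Fin k → α → ℝ) (fl : α → ℝ) (j : Fin k) (x : α) : Key Dom :=
  [.real (cs j x), .real (fl x)]

/-- The key for the group and the first coordinate. -/
noncomputable def groupKey (cs : Fin k → α → ℝ) (fl : α → ℝ) (g : α → Key Dom) (x : α) : Key Dom :=
  g x ++ ((List.finRange k).head?.toList.map (fun j => .real (cs j x)) ++ [.real (fl x)])

/-- The list of all keys. -/
noncomputable def dominanceKeys (cs : Fin k → α → ℝ) (fl : α → ℝ) (g : α → Key Dom) :
    List (α → Key Dom) :=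
  (List.finRange k).tail.map (coordKey cs fl) ++ [groupKey cs fl g]

variable {cs : Fin k → α → ℝ} {fl : α → ℝ} {g : α → Key Dom}

theorem dominanceKeys_length : (dominanceKeys cs fl g).length = k - 1 + 1 := by
  simp [dominanceKeys]

theorem forall_mem_dominanceKeys {P : (α → Key Dom) → Prop} :
    (∀ f ∈ dominanceKeys cs fl g, P f) ↔
      (∀ j ∈ (List.finRange k).tail, P (coordKey cs fl j)) ∧ P (groupKey cs fl g) := by
  simp only [dominanceKeys, List.mem_append, List.mem_map, List.mem_singleton, or_imp, forall_and,
    forall_eq, forall_exists_index, and_imp, forall_apply_eq_imp_iff₂]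

/-- The flag is the last entry of every key and separates two items whatever their coordinates. -/
theorem dominanceKeys_ne {x y : α} (h : fl x ≠ fl y) : ∀ f ∈ dominanceKeys cs fl g, f x ≠ f y := by
  have hne : (Atom.real (fl x) : Atom Dom) ≠ .real (fl y) := fun h' => h (Sum.inr_injective h')
  rw [forall_mem_dominanceKeys]
  refine ⟨fun j _ h' => hne ?_, fun h' => hne ?_⟩
  · simpa [coordKey] using (List.cons.inj h').2
  · rw [groupKey, groupKey, ← List.append_assoc, ← List.append_assoc] at h'
    simpa using (List.append_inj' h' rfl).2

theorem dominanceKeys_shape (hg : ∀ x y, SameShape (g x) (g y)) :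
    ∀ f ∈ dominanceKeys cs fl g, ∀ x y, SameShape (f x) (f y) := by
  rw [forall_mem_dominanceKeys]
  refine ⟨fun j _ x y => rfl, fun x y => ?_⟩
  have := hg x y
  unfold SameShape groupKey at *
  rw [List.map_append, List.map_append, this, List.map_append, List.map_append, List.map_map,
    List.map_map]
  rfl

theorem dominanceKeys_length_le {B : ℕ} (hg : ∀ x, (g x).length ≤ B) :
    ∀ f ∈ dominanceKeys cs fl g, ∀ x, (f x).length ≤ B + 2 := by
  rw [forall_mem_dominanceKeys]
  refine ⟨fun j _ x => by simp [coordKey], fun x => ?_⟩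
  have h1 := hg x
  have h2 : (List.finRange k).head?.toList.length ≤ 1 := by
    cases (List.finRange k).head? <;> simp
  rw [groupKey, List.length_append, List.length_append, List.length_map, List.length_singleton]
  omega

variable [(i : Fin n) → LinearOrder (Dom i)]

theorem Atom.real_lt {x y : ℝ} : (Atom.real x : Atom Dom) < .real y ↔ x < y := by
  rw [← not_le, Atom.real_le, not_le]

/-- A tie of coordinates is decided by the flags, so the strict order of keys is the weak order of
coordinates. -/
theorem coordKey_lt {x y : α} (h : fl x < fl y) (j : Fin k) :
    (coordKey cs fl j x : Key Dom) < coordKey cs fl j y ↔ cs j x ≤ cs j y := by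
  have h1 : (Atom.real (cs j x) : Atom Dom) = .real (cs j y) ↔ cs j x = cs j y :=
    ⟨fun h => Sum.inr_injective h, fun h => by rw [h]⟩
  have h2 : ([Atom.real (fl x)] : Key Dom) < [.real (fl y)] := by
    rw [List.cons_lt_cons_iff, Atom.real_lt]
    exact .inl h
  rw [coordKey, coordKey, List.cons_lt_cons_iff, Atom.real_lt, h1, le_iff_lt_or_eq]
  simp only [h2, and_true]

/-- Inside a group the common prefix of the group keys cancels, leaving the first coordinate and the
flag; the coordinate keys cover the remaining indices. For `k = 0` only the flags are left, and they
compare as required. -/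
theorem dominanceKeys_lt {x y : α} (h : fl x < fl y) (hg : g y = g x) :
    (∀ f ∈ dominanceKeys cs fl g, f x < f y) ↔ ∀ j, cs j x ≤ cs j y := by
  have hgroup : groupKey cs fl g x < groupKey cs fl g y ↔
      ∀ j ∈ (List.finRange k).head?, cs j x ≤ cs j y := by
    rw [groupKey, groupKey, hg, append_lt_append_left_iff]
    rcases (List.finRange k).head? with _ | j
    · have : ([Atom.real (fl x)] : Key Dom) < [.real (fl y)] := by
        rw [List.cons_lt_cons_iff, Atom.real_lt]
        exact .inl h
      simpa using this
    · have := coordKey_lt (Dom := Dom) (cs := cs) h j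
      simpa [coordKey] using this
  rw [forall_mem_dominanceKeys, hgroup]
  simp only [coordKey_lt h]
  have hcases : ∀ (l : List (Fin k)) (j), j ∈ l → j ∈ l.head? ∨ j ∈ l.tail := fun l j hj => by
    rcases l with _ | ⟨a, l⟩
    · simp at hj
    · simpa [eq_comm] using hj
  have hmem : ∀ j, j ∈ (List.finRange k).head? ∨ j ∈ (List.finRange k).tail := fun j =>
    hcases _ j (List.mem_finRange j)
  exact ⟨fun h j => (hmem j).elim (h.2 j) (h.1 j), fun h => ⟨fun j _ => h j, fun j _ => h j⟩⟩

theorem dominanceKeys_getLast {x y : α} (hg : (g x).length = (g y).length) {l : List (α → Key Dom)}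
    (hl : l = dominanceKeys cs fl g) (hne : l ≠ []) (h : l.getLast hne x ≤ l.getLast hne y) :
    g x ≤ g y := by
  subst hl
  simp only [dominanceKeys, List.getLast_append_singleton] at h
  by_contra! h'
  exact (append_lt_append_of_lt hg.symm h' _ _).not_ge h

end DominanceKeys

/-! ### Conversion of the input -/

/-- The number of nodes of an expression without function calls. -/
def Expr.size : Expr → ℕ
  | .pair a b | .realAdd a b | .realSub a b => a.size + b.size + 1
  | .fst a | .snd a | .theta _ a => a.size + 1
  -- Correct for leaves. For the other constructors, such as conditionals and calls, it is a dummy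
  -- value; the conversion expressions contain none of them.
  | _ => 1

/-- Builds a list. -/
def listE : List Expr → Expr
  | [] => .nil
  | e :: l => .pair e (listE l)

/-- The entry at a position of a list. -/
def getE : ℕ → Expr → Expr
  | 0, e => .fst e
  | p + 1, e => getE p (.snd e)

section Conversion

variable {n k : ℕ}

/-- The position of a variable among the variables in `K`, in the order of a list. -/
def position (K : Finset (Fin n)) (i : Fin n) : List (Fin n) → ℕ
  | [] => 0
  | a :: l => if a = i then 0 else (if a ∈ K then 1 else 0) + position K i l

/-- The value of a variable in an input tuple over `K`. -/
def varE (K : Finset (Fin n)) (i : Fin n) : Expr :=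
  getE (position K i (List.finRange n)) (.fst (.var 0))

/-- The list of the values of the variables in `K'`, wrapped by `f`. -/
def tupleE (K K' : Finset (Fin n)) (f : Expr → Expr) : List Expr :=
  ((List.finRange n).filter (· ∈ K')).map fun i => f (varE K i)

/-- The sum of the functions `θ j` over the variables in `P`. -/
def sumE (S : Fin k → Finset (Fin n)) (K P : Finset (Fin n)) (j : Fin k) : Expr :=
  (List.finRange n).foldr
    (fun i e => if i ∈ S j ∧ i ∈ P then .realAdd (.theta j (varE K i)) e else e) (.realConst 0)

/-- A real number as an entry of a key. -/
def realAtomE (e : Expr) : Expr := .pair eTrue e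

/-- A domain value as an entry of a key. -/
def domAtomE (e : Expr) : Expr := .pair .nil e

/-- The list of all keys. -/
def dominanceKeysE (c : Fin k → Expr) (fl : ℤ) (g : List Expr) : Expr :=
  listE ((List.finRange k).tail.map
      (fun j => listE [realAtomE (c j), realAtomE (.realConst fl)]) ++
    [listE (g ++ ((List.finRange k).head?.toList.map (fun j => realAtomE (c j)) ++
      [realAtomE (.realConst fl)]))])

/-- The conversion of the entries of the first factor. -/
def queryItemE (S : Fin k → Finset (Fin n)) (U L F : Finset (Fin n)) : Expr :=
  .pair (dominanceKeysE (sumE S U U) 0 (tupleE U (U ∩ L) domAtomE))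
    (.pair .nil (.pair (listE (tupleE U (U ∩ L) domAtomE)) (.pair .srZero
      (.pair (listE (tupleE U F domAtomE)) (.pair (listE (tupleE U F id)) (.snd (.var 0)))))))

/-- The conversion of the entries of the second factor. -/
def pointItemE (S : Fin k → Finset (Fin n)) (U L : Finset (Fin n)) : Expr :=
  .pair (dominanceKeysE (fun j => .realSub (.realConst 0) (sumE S L (L \ U) j)) 1
      (tupleE L (U ∩ L) domAtomE))
    (.pair .nil (.pair (listE (tupleE L (U ∩ L) domAtomE)) (.pair (.snd (.var 0)) .nil)))

/-! ### Correctness of the conversion -/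

variable {D : Type u} {Dom : Fin n → Type v}

/-- The restriction of a tuple. -/
def restrict {K K' : Finset (Fin n)} (h : K' ⊆ K) (x : Tuple Dom K) : Tuple Dom K' :=
  fun i => x ⟨i.1, h i.2⟩

/-- A tuple as a key. -/
def keyOf {K : Finset (Fin n)} (x : Tuple Dom K) : Key Dom :=
  (List.finRange n).filterMap fun i => if h : i ∈ K then some (Atom.dom i (x ⟨i, h⟩)) else none

/-- The entries `f` are arbitrary so that this serves both stored tuples and keys. -/
theorem getElem?_position {β : Type*} {K : Finset (Fin n)} (f : (i : Fin n) → i ∈ K → β)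
    {i : Fin n} (hi : i ∈ K) {l : List (Fin n)} (hl : i ∈ l) :
    (l.filterMap fun i => if h : i ∈ K then some (f i h) else none)[position K i l]? =
      some (f i hi) := by
  induction l with
  | nil => simp at hl
  | cons a l ih =>
    by_cases ha : a = i
    · subst ha
      simp [position, hi]
    · have ih := ih (by simpa [Ne.symm ha] using hl)
      by_cases haK : a ∈ K
      · simpa [position, ha, haK, add_comm 1] using ih
      · simpa [position, ha, haK] using ih

theorem keyOf_injective {K : Finset (Fin n)} :
    (keyOf : Tuple Dom K → Key Dom).Injective := by
  intro x y h
  funext ⟨i, hi⟩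
  have h1 := getElem?_position (fun i h => Atom.dom i (x ⟨i, h⟩)) hi (List.mem_finRange i)
  have h2 := getElem?_position (fun i h => Atom.dom i (y ⟨i, h⟩)) hi (List.mem_finRange i)
  unfold keyOf at h
  rw [h, h2] at h1
  exact (Atom.dom_injective (Option.some.inj h1)).symm

theorem keyOf_shape {K : Finset (Fin n)} (x y : Tuple Dom K) : SameShape (keyOf x) (keyOf y) := by
  unfold SameShape keyOf
  rw [List.map_filterMap, List.map_filterMap]
  congr 1
  funext i
  by_cases h : i ∈ K <;> simp [h]

theorem keyOf_length_le {K : Finset (Fin n)} (x : Tuple Dom K) : (keyOf x).length ≤ n :=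
  (List.length_filterMap_le _ _).trans (by simp)

variable [Semiring D] [(i : Fin n) → LinearOrder (Dom i)]
  (S : Fin k → Finset (Fin n)) (θ : (j : Fin k) → (i : {i // i ∈ S j}) → Dom i.1 → ℝ)
  (fs : List Expr)

/-- `e` evaluates to `w` without function calls. -/
def Evals (ρ : List (Val D Dom)) (e : Expr) (w : Val D Dom) : Prop :=
  wp S θ fs ρ e fun v t => v = w ∧ t ≤ e.size

/-- The part of the linear form `j` over the variables in `P`. -/
noncomputable def partialSum {K P : Finset (Fin n)} (h : P ⊆ K) (x : Tuple Dom K) (j : Fin k) : ℝ :=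
  ∑ i, if hi : i ∈ S j ∧ i ∈ P then θ j ⟨i, hi.1⟩ (x ⟨i, h hi.2⟩) else 0

variable {S θ fs} {ρ : List (Val D Dom)}

/-! ### Evaluation of straight-line expressions, with their size as time bound -/

theorem Evals.nil : Evals S θ fs ρ .nil .nil := ⟨_, _, .nil, rfl, by simp [Expr.size]⟩

theorem Evals.srZero : Evals S θ fs ρ .srZero (.sr 0) := ⟨_, _, .srZero, rfl, by simp [Expr.size]⟩

theorem Evals.realConst {z : ℤ} : Evals S θ fs ρ (.realConst z) (.real z) :=
  ⟨_, _, .realConst, rfl, by simp [Expr.size]⟩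

theorem Evals.var_zero {x : Val D Dom} : Evals S θ fs (x :: ρ) (.var 0) x :=
  ⟨_, _, .var rfl, rfl, by simp [Expr.size]⟩

theorem Evals.pair {a b : Expr} {x y : Val D Dom} (ha : Evals S θ fs ρ a x)
    (hb : Evals S θ fs ρ b y) : Evals S θ fs ρ (.pair a b) (.pair x y) := by
  obtain ⟨_, _, h1, rfl, h2⟩ := ha
  obtain ⟨_, _, h3, rfl, h4⟩ := hb
  exact ⟨_, _, .pair h1 h3, rfl, by simp only [Expr.size]; omega⟩

theorem Evals.fst {a : Expr} {x y : Val D Dom} (ha : Evals S θ fs ρ a (.pair x y)) :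
    Evals S θ fs ρ (.fst a) x := by
  obtain ⟨_, _, h1, rfl, h2⟩ := ha
  exact ⟨_, _, .fst h1, rfl, by simp only [Expr.size]; omega⟩

theorem Evals.snd {a : Expr} {x y : Val D Dom} (ha : Evals S θ fs ρ a (.pair x y)) :
    Evals S θ fs ρ (.snd a) y := by
  obtain ⟨_, _, h1, rfl, h2⟩ := ha
  exact ⟨_, _, .snd h1, rfl, by simp only [Expr.size]; omega⟩

theorem Evals.theta {a : Expr} {i : Fin n} {x : Dom i} {j : Fin k} (hi : i ∈ S j)
    (ha : Evals S θ fs ρ a (.dom i x)) :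
    Evals S θ fs ρ (.theta j a) (.real (θ j ⟨i, hi⟩ x)) := by
  obtain ⟨_, _, h1, rfl, h2⟩ := ha
  exact ⟨_, _, .theta hi h1, rfl, by simp only [Expr.size]; omega⟩

theorem Evals.realAdd {a b : Expr} {x y : ℝ} (ha : Evals S θ fs ρ a (.real x))
    (hb : Evals S θ fs ρ b (.real y)) : Evals S θ fs ρ (.realAdd a b) (.real (x + y)) := by
  obtain ⟨_, _, h1, rfl, h2⟩ := ha
  obtain ⟨_, _, h3, rfl, h4⟩ := hb
  exact ⟨_, _, .realAdd h1 h3, rfl, by simp only [Expr.size]; omega⟩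

theorem Evals.realSub {a b : Expr} {x y : ℝ} (ha : Evals S θ fs ρ a (.real x))
    (hb : Evals S θ fs ρ b (.real y)) : Evals S θ fs ρ (.realSub a b) (.real (x - y)) := by
  obtain ⟨_, _, h1, rfl, h2⟩ := ha
  obtain ⟨_, _, h3, rfl, h4⟩ := hb
  exact ⟨_, _, .realSub h1 h3, rfl, by simp only [Expr.size]; omega⟩

theorem Evals.listE {es : List Expr} {vs : List (Val D Dom)}
    (h : List.Forall₂ (Evals S θ fs ρ) es vs) : Evals S θ fs ρ (listE es) (.ofList vs) := by
  induction h with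
  | nil => exact .nil
  | cons h _ ih => exact h.pair ih

theorem Evals.getE {p : ℕ} {e : Expr} {l : List (Val D Dom)} {w : Val D Dom}
    (h : Evals S θ fs ρ e (.ofList l)) (hw : l[p]? = some w) : Evals S θ fs ρ (getE p e) w := by
  induction p generalizing e l with
  | zero =>
    obtain _ | ⟨x, l⟩ := l
    · simp at hw
    · obtain rfl : x = w := by simpa using hw
      exact h.fst
  | succ p ih =>
    obtain _ | ⟨x, l⟩ := l
    · simp at hw
    · exact ih h.snd (by simpa using hw)

variable {K : Finset (Fin n)} {x : Tuple Dom K} {d : Val D Dom}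

theorem Evals.varE {i : Fin n} (hi : i ∈ K) :
    Evals S θ fs (.pair (.ofTuple x) d :: ρ) (varE K i) (.dom i (x ⟨i, hi⟩)) :=
  (Evals.var_zero.fst).getE
    (getElem?_position (fun i h => Val.dom i (x ⟨i, h⟩)) hi (List.mem_finRange i))

theorem forall₂_tupleE {K' : Finset (Fin n)} (h : K' ⊆ K) {f : Expr → Expr}
    {f' : (i : Fin n) → Dom i → Val D Dom} (hf : ∀ ρ e i (y : Dom i),
      Evals S θ fs ρ e (.dom i y) → Evals S θ fs ρ (f e) (f' i y)) :
    List.Forall₂ (Evals S θ fs (.pair (.ofTuple x) d :: ρ)) (tupleE K K' f)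
      ((List.finRange n).filterMap fun i =>
        if hi : i ∈ K' then some (f' i (restrict h x ⟨i, hi⟩)) else none) := by
  unfold tupleE
  induction List.finRange n with
  | nil => exact .nil
  | cons i l ih =>
    by_cases hi : i ∈ K'
    · rw [List.filter_cons_of_pos (by simpa using hi), List.map_cons,
        List.filterMap_cons_some (dif_pos hi)]
      exact .cons (hf _ _ _ _ (Evals.varE (h hi))) ih
    · rw [List.filter_cons_of_neg (by simpa using hi), List.filterMap_cons_none (dif_neg hi)]
      exact ih

theorem forall₂_keyOf {K' : Finset (Fin n)} (h : K' ⊆ K) :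
    List.Forall₂ (Evals S θ fs (.pair (.ofTuple x) d :: ρ)) (tupleE K K' domAtomE)
      ((keyOf (restrict h x)).map Val.ofAtom) := by
  have := forall₂_tupleE (S := S) (θ := θ) (fs := fs) (ρ := ρ) (x := x) (d := d) h (f := domAtomE)
    (f' := fun i y => .pair .nil (.dom i y)) fun ρ e i y he => Evals.nil.pair he
  convert this using 1
  rw [keyOf, List.map_filterMap]
  congr 1
  funext i
  by_cases hi : i ∈ K' <;> simp [hi]

theorem evals_keyOf {K' : Finset (Fin n)} (h : K' ⊆ K) :
    Evals S θ fs (.pair (.ofTuple x) d :: ρ) (listE (tupleE K K' domAtomE))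
      (.ofKey (keyOf (restrict h x))) :=
  .listE (forall₂_keyOf h)

theorem evals_ofTuple {K' : Finset (Fin n)} (h : K' ⊆ K) :
    Evals S θ fs (.pair (.ofTuple x) d :: ρ) (listE (tupleE K K' id))
      (.ofTuple (restrict h x)) :=
  .listE (forall₂_tupleE h fun _ _ _ _ he => he)

/-- The sum is unrolled when the program is written, with membership in `S j` and `P` decided then,
so its cost does not depend on the data. -/
theorem evals_sumE {P : Finset (Fin n)} (h : P ⊆ K) (j : Fin k) :
    Evals S θ fs (.pair (.ofTuple x) d :: ρ) (sumE S K P j) (.real (partialSum S θ h x j)) := by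
  rw [sumE, partialSum, Fin.sum_univ_def]
  induction List.finRange n with
  | nil => simpa using Evals.realConst (z := 0)
  | cons i l ih =>
    by_cases hi : i ∈ S j ∧ i ∈ P
    · simpa [hi] using (Evals.theta hi.1 (Evals.varE (h hi.2))).realAdd ih
    · simpa [hi] using ih

theorem evals_dominanceKeysE {α : Type*} {cs : Fin k → α → ℝ} {fl : α → ℝ} {g : α → Key Dom}
    {c : Fin k → Expr} {z : ℤ} {ge : List Expr} {a : α} (hc : ∀ j, Evals S θ fs ρ (c j) (.real (cs j a)))
    (hz : fl a = z) (hg : List.Forall₂ (Evals S θ fs ρ) ge ((g a).map Val.ofAtom)) :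
    Evals S θ fs ρ (dominanceKeysE c z ge)
      (.ofList ((dominanceKeys cs fl g).map fun f => .ofKey (f a))) := by
  have hfl : Evals S θ fs ρ (realAtomE (.realConst z)) (.ofAtom (.real (fl a))) :=
    (Evals.nil.pair .nil).pair (hz ▸ .realConst)
  have hcs : ∀ j, Evals S θ fs ρ (realAtomE (c j)) (.ofAtom (.real (cs j a))) := fun j =>
    (Evals.nil.pair .nil).pair (hc j)
  refine .listE ?_
  rw [dominanceKeys, List.map_append, List.map_map]
  refine List.rel_append ?_ (.cons (.listE ?_) .nil)
  · rw [List.forall₂_map_left_iff, List.forall₂_map_right_iff, List.forall₂_same]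
    exact fun j _ => .listE (.cons (hcs j) (.cons hfl .nil))
  · rw [groupKey, List.map_append, List.map_append, List.map_map]
    refine List.rel_append hg (List.rel_append ?_ (.cons hfl .nil))
    rw [List.forall₂_map_left_iff, List.forall₂_map_right_iff, List.forall₂_same]
    exact fun j _ => hcs j

end Conversion

/-! ### The query as a sum over pairs of entries -/

section Query

variable {n k : ℕ} {D : Type u} [Semiring D] {Dom : Fin n → Type v}

theorem ind_mul_ind (P Q : Prop) : ind D P * ind D Q = ind D (P ∧ Q) := by
  by_cases hP : P <;> by_cases hQ : Q <;> simp [hP, hQ]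

/-- Zero and one commute with everything, so indicators can be moved through products in a
noncommutative semiring. -/
theorem ind_mul_comm (P : Prop) (a : D) : ind D P * a = a * ind D P := by
  by_cases hP : P <;> simp [hP]

theorem prod_ofFn_ind {m : ℕ} (P : Fin m → Prop) :
    (List.ofFn fun j => ind D (P j)).prod = ind D (∀ j, P j) := by
  induction m with
  | zero => simp
  | succ m ih => rw [List.ofFn_succ, List.prod_cons, ih, ind_mul_ind, Fin.forall_fin_succ]

theorem restrict_proj {K K' : Finset (Fin n)} (h : K' ⊆ K) (z : (i : Fin n) → Dom i) :
    restrict h (proj K z) = proj K' z := rfl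

theorem proj_glue (F : Finset (Fin n)) (f : Tuple Dom F) (y : (i : {i // i ∉ F}) → Dom i.1) :
    proj F (glue F f y) = f := by
  funext i
  simp [proj, glue]

theorem glue_injective (F : Finset (Fin n)) (f : Tuple Dom F) : (glue F f).Injective := by
  intro y y' h
  funext ⟨i, hi⟩
  simpa [glue, hi] using congrFun h i

theorem glue_proj (F : Finset (Fin n)) (z : (i : Fin n) → Dom i) :
    glue F (proj F z) (fun i => z i.1) = z := by
  funext i
  by_cases hi : i ∈ F <;> simp [proj, glue, hi]

theorem proj_proj_injective {U L : Finset (Fin n)} (hUL : U ∪ L = Finset.univ) :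
    Function.Injective fun z : (i : Fin n) → Dom i => (proj U z, proj L z) := by
  intro z z' h
  obtain ⟨h1, h2⟩ := Prod.mk.inj h
  funext i
  have hi : i ∈ U ∪ L := hUL ▸ Finset.mem_univ i
  rcases Finset.mem_union.1 hi with hi | hi
  · exact congrFun h1 ⟨i, hi⟩
  · exact congrFun h2 ⟨i, hi⟩

theorem exists_proj_eq {U L : Finset (Fin n)} (hUL : U ∪ L = Finset.univ) {x : Tuple Dom U}
    {y : Tuple Dom L}
    (h : restrict Finset.inter_subset_left x = restrict Finset.inter_subset_right y) :
    ∃ z : (i : Fin n) → Dom i, proj U z = x ∧ proj L z = y := by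
  have hL : ∀ i, i ∉ U → i ∈ L := fun i hi =>
    (Finset.mem_union.1 (hUL ▸ Finset.mem_univ i)).resolve_left hi
  refine ⟨fun i => if hi : i ∈ U then x ⟨i, hi⟩ else y ⟨i, hL i hi⟩, ?_, ?_⟩
  · funext ⟨i, hi⟩
    simp [proj, hi]
  · funext ⟨i, hi⟩
    by_cases hiU : i ∈ U
    · have := congrFun h ⟨i, Finset.mem_inter.2 ⟨hiU, hi⟩⟩
      simpa [proj, hiU, restrict] using this
    · simp [proj, hiU]

variable {S : Fin k → Finset (Fin n)} {θ : (j : Fin k) → (i : {i // i ∈ S j}) → Dom i.1 → ℝ}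
  {U L F : Finset (Fin n)}

/-- The common variables are charged to `U` alone: `U` and `L \ U` partition all variables. -/
theorem sum_eq_partialSum_add (hUL : U ∪ L = Finset.univ) (z : (i : Fin n) → Dom i) (j : Fin k) :
    ∑ i : {i // i ∈ S j}, θ j i (z i.1) =
      partialSum S θ subset_rfl (proj U z) j +
        partialSum S θ (Finset.sdiff_subset : L \ U ⊆ L) (proj L z) j := by
  have h1 : ∑ i : {i // i ∈ S j}, θ j i (z i.1) =
      ∑ i, if h : i ∈ S j then θ j ⟨i, h⟩ (z i) else 0 := by
    have h2 : ∀ i : {i // i ∈ S j}, θ j i (z i.1) =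
        if h : i.1 ∈ S j then θ j ⟨i.1, h⟩ (z i.1) else 0 := fun i => by
      rw [dif_pos i.2]
    rw [Finset.sum_congr rfl fun i _ => h2 i,
      Finset.sum_coe_sort (S j) fun i => if h : i ∈ S j then θ j ⟨i, h⟩ (z i) else 0]
    exact Finset.sum_subset (Finset.subset_univ _) fun i _ hi => dif_neg hi
  rw [h1, partialSum, partialSum, ← Finset.sum_add_distrib]
  refine Finset.sum_congr rfl fun i _ => ?_
  have hi : i ∉ U → i ∈ L :=
    (Finset.mem_union.1 (hUL ▸ Finset.mem_univ i : i ∈ U ∪ L)).resolve_left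
  by_cases hU : i ∈ U
  · by_cases hS : i ∈ S j <;> simp [hU, hS, proj]
  · by_cases hS : i ∈ S j <;> simp [hU, hS, proj, hi hU]

/-- Two tuples that agree on the common variables satisfy all inequalities. -/
def Matches (S : Fin k → Finset (Fin n))
    (θ : (j : Fin k) → (i : {i // i ∈ S j}) → Dom i.1 → ℝ) (x : Tuple Dom U) (y : Tuple Dom L) :
    Prop :=
  restrict Finset.inter_subset_left x = restrict Finset.inter_subset_right y ∧
    ∀ j, partialSum S θ subset_rfl x j ≤
      0 - partialSum S θ (Finset.sdiff_subset : L \ U ⊆ L) y j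

/-- Reindexing along the injective map from assignments outside `F` to pairs of projections, whose
range consists of the pairs that lie over `f` and agree on `U ∩ L`. Nonzero summands need both
factors nonzero, so the sum is finite. As `F ⊆ U`, the condition on `f` involves `x` alone, and the
inner sum does not depend on `f`. -/
theorem query_eq_sum (hUL : U ∪ L = Finset.univ) (hF : F ⊆ U) {Φ₁ : Tuple Dom U → D}
    {Φ₂ : Tuple Dom L → D} {l₁ : List (Tuple Dom U)} {l₂ : List (Tuple Dom L)} (h₁ : l₁.Nodup)
    (h₂ : l₂.Nodup) (hl₁ : ∀ x, Φ₁ x ≠ 0 → x ∈ l₁) (hl₂ : ∀ y, Φ₂ y ≠ 0 → y ∈ l₂)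
    (f : Tuple Dom F) :
    query U L F S Φ₁ Φ₂ θ f = (l₁.map fun x => ind D (restrict hF x = f) *
      (Φ₁ x * (l₂.map fun y => ind D (Matches S θ x y) * Φ₂ y).sum)).sum := by
  classical
  let φ : ((i : {i // i ∉ F}) → Dom i.1) → Tuple Dom U × Tuple Dom L := fun y =>
    (proj U (glue F f y), proj L (glue F f y))
  have hφ : φ.Injective := (proj_proj_injective hUL).comp (glue_injective F f)
  have hmem : ∀ p, p ∈ Set.range φ ↔ restrict hF p.1 = f ∧
      restrict Finset.inter_subset_left p.1 = restrict Finset.inter_subset_right p.2 := by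
    rintro ⟨x, y⟩
    constructor
    · rintro ⟨y, h⟩
      obtain ⟨rfl, rfl⟩ := Prod.mk.inj h
      exact ⟨by rw [restrict_proj, proj_glue], rfl⟩
    · rintro ⟨rfl, h⟩
      obtain ⟨z, rfl, rfl⟩ := exists_proj_eq hUL h
      refine ⟨fun i => z i.1, ?_⟩
      simp only [φ, restrict_proj, glue_proj]
  let h : Tuple Dom U × Tuple Dom L → D := fun p => Φ₁ p.1 * Φ₂ p.2 *
    ind D (∀ j, partialSum S θ subset_rfl p.1 j ≤
      0 - partialSum S θ (Finset.sdiff_subset : L \ U ⊆ L) p.2 j)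
  have hq : query U L F S Φ₁ Φ₂ θ f = ∑ᶠ y, h (φ y) := by
    refine finsum_congr fun y => ?_
    rw [prod_ofFn_ind]
    congr 2
    refine propext (forall_congr' fun j => ?_)
    rw [sum_eq_partialSum_add hUL]
    simp only [φ]
    constructor <;> intro h <;> linarith
  rw [hq, ← finsum_mem_range hφ, finsum_mem_def,
    finsum_eq_sum_of_support_subset (s := l₁.toFinset ×ˢ l₂.toFinset), Finset.sum_product,
    List.sum_toFinset _ h₁]
  · congr 1
    refine List.map_congr_left fun x _ => ?_
    rw [List.sum_toFinset _ h₂, ← List.sum_map_mul_left, ← List.sum_map_mul_left]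
    congr 1
    refine List.map_congr_left fun y _ => ?_
    simp only [Set.indicator_apply, hmem, h, Matches]
    by_cases h1 : restrict hF x = f <;>
      by_cases h2 : restrict (Finset.inter_subset_left : U ∩ L ⊆ U) x =
        restrict Finset.inter_subset_right y
    all_goals simp [h1, h2, ind_mul_comm, mul_assoc]
  · intro p hp
    have hp : h p ≠ 0 := fun h0 => hp (by simp [Set.indicator_apply, h0])
    have h1 : Φ₁ p.1 ≠ 0 := fun h0 => hp (by simp [h, h0])
    have h2 : Φ₂ p.2 ≠ 0 := fun h0 => hp (by simp [h, h0])
    simpa using ⟨hl₁ _ h1, hl₂ _ h2⟩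

end Query

/-! ### The items of the query -/

section Items

variable {n k : ℕ} {D : Type u} [Semiring D] {Dom : Fin n → Type v} {U L F : Finset (Fin n)}

/-- The common variables as a key. -/
def itemGroup : Tuple Dom U ⊕ Tuple Dom L → Key Dom :=
  Sum.elim (fun x => keyOf (restrict (Finset.inter_subset_left : U ∩ L ⊆ U) x))
    fun y => keyOf (restrict (Finset.inter_subset_right : U ∩ L ⊆ L) y)

/-- The weights are the values of the second factor. -/
def itemWeight (Φ₂ : Tuple Dom L → D) : Tuple Dom U ⊕ Tuple Dom L → D :=
  Sum.elim (fun _ => 0) Φ₂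

/-- Output tuples and values of the first factor. -/
def itemPay (hF : F ⊆ U) (Φ₁ : Tuple Dom U → D) :
    Tuple Dom U ⊕ Tuple Dom L → Option (Tuple Dom F × D) :=
  Sum.elim (fun x => some (restrict hF x, Φ₁ x)) fun _ => none

/-- The two sides of the inequalities. -/
noncomputable def itemCoord (S : Fin k → Finset (Fin n))
    (θ : (j : Fin k) → (i : {i // i ∈ S j}) → Dom i.1 → ℝ) (j : Fin k) :
    Tuple Dom U ⊕ Tuple Dom L → ℝ :=
  Sum.elim (fun x => partialSum S θ subset_rfl x j)
    fun y => 0 - partialSum S θ (Finset.sdiff_subset : L \ U ⊆ L) y j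

/-- The flag of an item. -/
def itemFlag : Tuple Dom U ⊕ Tuple Dom L → ℝ := Sum.elim (fun _ => 0) fun _ => 1

/-- The keys of the items. -/
noncomputable def itemKeys (S : Fin k → Finset (Fin n))
    (θ : (j : Fin k) → (i : {i // i ∈ S j}) → Dom i.1 → ℝ) :
    List (Tuple Dom U ⊕ Tuple Dom L → Key Dom) :=
  dominanceKeys (itemCoord S θ) itemFlag itemGroup

variable [(i : Fin n) → LinearOrder (Dom i)] {S : Fin k → Finset (Fin n)}
  {θ : (j : Fin k) → (i : {i // i ∈ S j}) → Dom i.1 → ℝ}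

theorem itemGroup_shape (x y : Tuple Dom U ⊕ Tuple Dom L) :
    SameShape (itemGroup x) (itemGroup y) := by
  rcases x with x | x <;> rcases y with y | y <;> exact keyOf_shape _ _

theorem itemGroup_length_le (x : Tuple Dom U ⊕ Tuple Dom L) : (itemGroup x).length ≤ n := by
  rcases x with x | x <;> exact keyOf_length_le _

/-- Equality of groups is the join condition, by injectivity of `keyOf`; since queries have flag 0
and points flag 1, the strict order of the keys is the system of inequalities. -/
theorem itemKeys_lt (x : Tuple Dom U) (y : Tuple Dom L) :
    (itemGroup (.inr y : Tuple Dom U ⊕ Tuple Dom L) =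
        itemGroup (.inl x : Tuple Dom U ⊕ Tuple Dom L) ∧
      ∀ f ∈ itemKeys S θ, f (.inl x) < f (.inr y)) ↔ Matches S θ x y := by
  have h1 : itemGroup (.inr y : Tuple Dom U ⊕ Tuple Dom L) =
      itemGroup (.inl x : Tuple Dom U ⊕ Tuple Dom L) ↔
      restrict (Finset.inter_subset_left : U ∩ L ⊆ U) x = restrict Finset.inter_subset_right y :=
    ⟨fun h => (keyOf_injective h).symm, fun h => (congrArg keyOf h).symm⟩
  rw [Matches, ← h1]
  refine and_congr_right fun h => ?_
  rw [itemKeys]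
  exact dominanceKeys_lt (x := (.inl x : Tuple Dom U ⊕ Tuple Dom L)) (y := .inr y)
    (by simp [itemFlag]) h

theorem strictSum_itemKeys (Φ₂ : Tuple Dom L → D) (l₁ : List (Tuple Dom U))
    (l₂ : List (Tuple Dom L)) (x : Tuple Dom U) :
    strictSum (itemKeys S θ) itemGroup (itemWeight Φ₂) (l₁.map .inl ++ l₂.map .inr) (.inl x) =
      (l₂.map fun y => ind D (Matches S θ x y) * Φ₂ y).sum := by
  rw [strictSum, List.map_append, List.sum_append, List.map_map, List.map_map,
    List.sum_eq_zero, zero_add]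
  · congr 1
    refine List.map_congr_left fun y _ => ?_
    simp only [Function.comp, itemKeys_lt]
    rfl
  · intro z hz
    obtain ⟨x, _, rfl⟩ := List.mem_map.1 hz
    simp [itemWeight]

/-- Points carry no payload and drop out of the entries; each query contributes its value times the
weight of the points that match it. -/
theorem total_itemPay (hUL : U ∪ L = Finset.univ) (hF : F ⊆ U) {Φ₁ : Tuple Dom U → D}
    {Φ₂ : Tuple Dom L → D} {l₁ : List (Tuple Dom U)} {l₂ : List (Tuple Dom L)} (h₁ : l₁.Nodup)
    (h₂ : l₂.Nodup) (hl₁ : ∀ x, Φ₁ x ≠ 0 → x ∈ l₁) (hl₂ : ∀ y, Φ₂ y ≠ 0 → y ∈ l₂)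
    (f : Tuple Dom F) :
    total ((l₁.map .inl ++ l₂.map .inr : List (Tuple Dom U ⊕ Tuple Dom L)).filterMap fun x => (itemPay hF Φ₁ x).map fun e =>
      (e.1, e.2 * strictSum (itemKeys S θ) itemGroup (itemWeight Φ₂)
        (l₁.map .inl ++ l₂.map .inr) x)) f = query U L F S Φ₁ Φ₂ θ f := by
  rw [query_eq_sum hUL hF h₁ h₂ hl₁ hl₂, total, List.filterMap_append, List.filterMap_map,
    List.filterMap_map]
  have h3 : ((fun x => (itemPay hF Φ₁ x).map fun e =>
      (e.1, e.2 * strictSum (itemKeys S θ) itemGroup (itemWeight Φ₂)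
        (l₁.map .inl ++ l₂.map .inr) x)) ∘ Sum.inr : Tuple Dom L → _) = fun _ => none := rfl
  have h4 : ((fun x => (itemPay hF Φ₁ x).map fun e =>
      (e.1, e.2 * strictSum (itemKeys S θ) itemGroup (itemWeight Φ₂)
        (l₁.map .inl ++ l₂.map .inr) x)) ∘ Sum.inl : Tuple Dom U → _) = fun x =>
      some (restrict hF x, Φ₁ x * (l₂.map fun y => ind D (Matches S θ x y) * Φ₂ y).sum) := by
    funext x
    rw [← strictSum_itemKeys (S := S) (θ := θ) Φ₂ l₁]
    rfl
  rw [h3, h4, List.filterMap_none, List.append_nil, List.filterMap_eq_map', List.map_map]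
  rfl

variable {c₁ c₂ : Expr} {key : Tuple Dom U ⊕ Tuple Dom L → Key Dom}
  {ks : List (Tuple Dom U ⊕ Tuple Dom L → Key Dom)}

theorem evals_queryItemE (hF : F ⊆ U) (hk : itemKeys S θ = key :: ks) (Φ₁ : Tuple Dom U → D)
    (Φ₂ : Tuple Dom L → D) (fs : List Expr) (x : Tuple Dom U) (ρ : List (Val D Dom)) :
    Evals S θ fs (.pair (.ofTuple x) (.sr (Φ₁ x)) :: ρ) (queryItemE S U L F)
      (Val.ofRanked key ks (fun _ => []) (Val.ofData keyOf Val.ofTuple itemGroup (itemWeight Φ₂)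
        (itemPay hF Φ₁)) (.inl x)) := by
  have h := evals_dominanceKeysE (S := S) (θ := θ) (fs := fs)
    (ρ := .pair (.ofTuple x) (.sr (Φ₁ x)) :: ρ) (cs := itemCoord S θ) (fl := itemFlag)
    (g := itemGroup) (c := sumE S U U) (z := 0) (ge := tupleE U (U ∩ L) domAtomE)
    (a := (.inl x : Tuple Dom U ⊕ Tuple Dom L)) (fun j => evals_sumE subset_rfl j)
    (by simp [itemFlag]) (forall₂_keyOf _)
  change Evals _ _ _ _ _ (.ofList ((itemKeys S θ).map _)) at h
  rw [hk] at h
  exact h.pair (Evals.nil.pair ((evals_keyOf _).pair (Evals.srZero.pair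
    ((evals_keyOf hF).pair ((evals_ofTuple hF).pair Evals.var_zero.snd)))))

theorem evals_pointItemE (hF : F ⊆ U) (hk : itemKeys S θ = key :: ks) (Φ₁ : Tuple Dom U → D)
    (Φ₂ : Tuple Dom L → D) (fs : List Expr) (y : Tuple Dom L) (ρ : List (Val D Dom)) :
    Evals S θ fs (.pair (.ofTuple y) (.sr (Φ₂ y)) :: ρ) (pointItemE S U L)
      (Val.ofRanked key ks (fun _ => []) (Val.ofData keyOf Val.ofTuple itemGroup (itemWeight Φ₂)
        (itemPay hF Φ₁)) (.inr y)) := by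
  have h := evals_dominanceKeysE (S := S) (θ := θ) (fs := fs)
    (ρ := .pair (.ofTuple y) (.sr (Φ₂ y)) :: ρ) (cs := itemCoord S θ) (fl := itemFlag)
    (g := itemGroup) (c := fun j => .realSub (.realConst 0) (sumE S L (L \ U) j)) (z := 1)
    (ge := tupleE L (U ∩ L) domAtomE) (a := (.inr y : Tuple Dom U ⊕ Tuple Dom L))
    (fun j => by
      have := (Evals.realConst (S := S) (θ := θ) (fs := fs)
        (ρ := .pair (.ofTuple y) (.sr (Φ₂ y)) :: ρ) (z := 0)).realSub
        (evals_sumE (Finset.sdiff_subset : L \ U ⊆ L) j)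
      rwa [Int.cast_zero] at this)
    (by simp [itemFlag]) (forall₂_keyOf _)
  change Evals _ _ _ _ _ (.ofList ((itemKeys S θ).map _)) at h
  rw [hk] at h
  exact h.pair (Evals.nil.pair ((evals_keyOf _).pair (Evals.var_zero.snd.pair Evals.nil)))

end Items

/-! ### The time bound -/

theorem log_time_le {A M H N d : ℕ} (hM : M ≤ 2 * N) (hH : H = Nat.log 2 M + 1) (hN : 2 ≤ N) :
    ((A * (M * (H + 2) ^ d + 1) : ℕ) : ℝ) ≤ (3 * A * 10 ^ d : ℕ) * N * Real.log N ^ d := by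
  have hN0 : (0 : ℝ) < N := by positivity
  have h1 : Nat.log 2 M ≤ Nat.log 2 N + 1 := by
    calc Nat.log 2 M ≤ Nat.log 2 (2 * N) := Nat.log_mono_right hM
      _ = Nat.log 2 (N * 2) := by rw [mul_comm]
      _ = Nat.log 2 N + 1 := Nat.log_mul_base (by norm_num) (by omega)
  have h2 : 1 ≤ Nat.log 2 N := Nat.log_pos (by norm_num) hN
  have h3 : (Nat.log 2 N : ℝ) * Real.log 2 ≤ Real.log N := by
    rw [← Real.log_pow]
    refine Real.log_le_log (by positivity) ?_
    exact_mod_cast Nat.pow_log_le_self 2 (by omega)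
  have h4 := Real.log_two_gt_d9
  have h5 : (1 : ℝ) ≤ Nat.log 2 N := by exact_mod_cast h2
  -- `H + 2` is at most `Nat.log 2 N + 4`, and `Nat.log 2 N` is at least 1.
  have h6 : (H : ℝ) + 2 ≤ 5 * Nat.log 2 N := by
    have : H + 2 ≤ 5 * Nat.log 2 N := by omega
    exact_mod_cast this
  -- As `Real.log 2` exceeds 1/2, passing to the natural logarithm at most doubles the constant.
  have h7 : (H : ℝ) + 2 ≤ 10 * Real.log N := by nlinarith
  have h8 : (1 : ℝ) ≤ (10 * Real.log N) ^ d := one_le_pow₀ (by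
    have : (0 : ℝ) ≤ H := by positivity
    linarith)
  have h9 : ((H : ℝ) + 2) ^ d ≤ (10 * Real.log N) ^ d := by gcongr
  have h10 : (1 : ℝ) ≤ N := by exact_mod_cast (by omega : 1 ≤ N)
  have h11 : (M : ℝ) ≤ 2 * N := by exact_mod_cast hM
  -- The constant 3 is 2 from `M ≤ 2 * N` and 1 for the additive one.
  have h12 : (M : ℝ) * (H + 2) ^ d + 1 ≤ 3 * N * (10 * Real.log N) ^ d := by
    have a1 : (M : ℝ) * (H + 2) ^ d ≤ 2 * N * (10 * Real.log N) ^ d := by gcongr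
    have a2 : (1 : ℝ) ≤ N * (10 * Real.log N) ^ d := one_le_mul_of_one_le_of_one_le h10 h8
    linarith
  push_cast
  calc (A : ℝ) * (M * (H + 2) ^ d + 1) ≤ A * (3 * N * (10 * Real.log N) ^ d) := by gcongr
    _ = _ := by rw [mul_pow]; ring

theorem size_eq_length {n : ℕ} {D : Type u} [Semiring D] {Dom : Fin n → Type v}
    {K : Finset (Fin n)} {Φ : Tuple Dom K → D} {l : List (Tuple Dom K)} (hl : l.Nodup)
    (h : ∀ x, x ∈ l ↔ Φ x ≠ 0) : size Φ = l.length := by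
  classical
  have : Function.support Φ = (l.toFinset : Set (Tuple Dom K)) := by
    ext x
    simp [h]
  rw [size, this, Set.ncard_coe_finset, List.toFinset_card_of_nodup hl]

/-! ### Assembling the program -/

theorem exists_runs {n k : ℕ} {D : Type u} [Semiring D] {Dom : Fin n → Type v}
    [(i : Fin n) → LinearOrder (Dom i)] {U L F : Finset (Fin n)} {S : Fin k → Finset (Fin n)}
    (hUL : U ∪ L = Finset.univ) (hF : F ⊆ U) (Φ₁ : Tuple Dom U → D) (Φ₂ : Tuple Dom L → D)
    (θ : (j : Fin k) → (i : {i // i ∈ S j}) → Dom i.1 → ℝ) {l₁ : List (Tuple Dom U)}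
    {l₂ : List (Tuple Dom L)} (h₁ : l₁.Nodup) (h₂ : l₂.Nodup) (hl₁ : ∀ x, x ∈ l₁ ↔ Φ₁ x ≠ 0)
    (hl₂ : ∀ y, y ∈ l₂ ↔ Φ₂ y ≠ 0) {H : ℕ} (hH : l₁.length + l₂.length < 2 ^ H) :
    ∃ out t, Program.Runs ⟨funs (queryItemE S U L F) (pointItemE S U L), mainE⟩ S θ
      (.pair (.ofList (l₁.map fun x => .pair (.ofTuple x) (.sr (Φ₁ x))))
        (.ofList (l₂.map fun y => .pair (.ofTuple y) (.sr (Φ₂ y))))) out t ∧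
      IsTable (query U L F S Φ₁ Φ₂ θ) out ∧
      t ≤ ((queryItemE S U L F).size + (pointItemE S U L).size + pipeConst (n + 2) (k - 1) + 200) *
        ((l₁.length + l₂.length) * (H + 2) ^ max (k - 1) 1 + 1) := by
  obtain ⟨key, ks, hk⟩ : ∃ key ks, itemKeys (U := U) (L := L) S θ = key :: ks :=
    List.exists_cons_of_ne_nil (List.ne_nil_of_length_pos (by
      rw [itemKeys, dominanceKeys_length]; omega))
  have hks : ks.length = k - 1 := by
    have := congrArg List.length hk
    rw [itemKeys, dominanceKeys_length, List.length_cons] at this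
    omega
  set c₁ := queryItemE S U L F
  set c₂ := pointItemE S U L
  -- The sum type keeps queries and points apart even if `U = L` and both factors contain the same
  -- tuple, so the joint list has no repetitions.
  set l : List (Tuple Dom U ⊕ Tuple Dom L) := l₁.map .inl ++ l₂.map .inr with hl
  have hlen : l.length = l₁.length + l₂.length := by simp [hl]
  have hlnd : l.Nodup := by
    refine List.Nodup.append (h₁.map Sum.inl_injective) (h₂.map Sum.inr_injective) ?_
    intro a ha hb
    obtain ⟨x, _, rfl⟩ := List.mem_map.1 ha
    obtain ⟨y, _, h⟩ := List.mem_map.1 hb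
    cases h
  let enc := Val.ofRanked key ks (fun _ => []) (Val.ofData keyOf Val.ofTuple itemGroup
    (itemWeight Φ₂) (itemPay hF Φ₁))
  have hm₁ : Call S θ (funs c₁ c₂) 20
      (.ofList (l₁.map fun x => .pair (.ofTuple x) (.sr (Φ₁ x))))
      (.ofList (l₁.map fun x => enc (.inl x))) ((c₁.size + 15) * l₁.length + 5) :=
    call_map rfl _ _ _ _ fun x _ ρ => evals_queryItemE hF hk Φ₁ Φ₂ _ x ρ
  have hm₂ : Call S θ (funs c₁ c₂) 21
      (.ofList (l₂.map fun y => .pair (.ofTuple y) (.sr (Φ₂ y))))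
      (.ofList (l₂.map fun y => enc (.inr y))) ((c₂.size + 15) * l₂.length + 5) :=
    call_map rfl _ _ _ _ fun y _ ρ => evals_pointItemE hF hk Φ₁ Φ₂ _ y ρ
  have happ := call_append (S := S) (θ := θ) (c₁ := c₁) (c₂ := c₂)
    (l₁.map fun x => enc (.inl x)) (l₂.map fun y => enc (.inr y))
  have hencl : (l₁.map fun x => enc (.inl x)) ++ (l₂.map fun y => enc (.inr y)) = l.map enc := by
    rw [hl, List.map_append, List.map_map, List.map_map]
    rfl
  rw [hencl, List.length_map] at happ
  have hpipe := wp_pipeline (S := S) (θ := θ) (c₁ := c₁) (c₂ := c₂)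
    (keyOf : Tuple Dom F → Key Dom) Val.ofTuple (B := n + 2) (H := H) keyOf_injective keyOf_shape
    (fun x => (keyOf_length_le x).trans (by omega)) itemGroup (itemWeight Φ₂) (itemPay hF Φ₁)
    key ks l hlnd (hlen ▸ hH)
    (by
      rw [← hk, List.forall_mem_cons]
      exact ⟨itemGroup_shape, dominanceKeys_shape itemGroup_shape⟩)
    (by
      rw [← hk, List.forall_mem_cons]
      exact ⟨fun x => (itemGroup_length_le x).trans (by omega),
        dominanceKeys_length_le itemGroup_length_le⟩)
    (by
      rintro (x | y) e h
      · rfl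
      · simp [itemPay] at h)
    (by
      rintro (x | x) (y | y) e h h'
      · simp [itemWeight] at h'
      · rw [← hk]
        exact dominanceKeys_ne (by simp [itemFlag])
      · simp [itemPay] at h
      · simp [itemPay] at h)
    (fun x y => dominanceKeys_getLast (by
      have := congrArg List.length (itemGroup_shape x y)
      simpa using this) hk.symm (by simp))
    [.pair (.ofList (l₁.map fun x => .pair (.ofTuple x) (.sr (Φ₁ x))))
        (.ofList (l₂.map fun y => .pair (.ofTuple y) (.sr (Φ₂ y))))]
  suffices h : wp S θ (funs c₁ c₂)
      [.pair (.ofList (l₁.map fun x => .pair (.ofTuple x) (.sr (Φ₁ x))))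
        (.ofList (l₂.map fun y => .pair (.ofTuple y) (.sr (Φ₂ y))))] mainE fun out t =>
      IsTable (query U L F S Φ₁ Φ₂ θ) out ∧
      t ≤ (c₁.size + c₂.size + pipeConst (n + 2) (k - 1) + 200) *
        ((l₁.length + l₂.length) * (H + 2) ^ max (k - 1) 1 + 1) by
    obtain ⟨out, t, h1, h2⟩ := h
    exact ⟨out, t, h1, h2⟩
  rw [mainE, ← tailE]
  simp only [wp_ifPair, wp_fst, wp_snd, wp_letIn, wp_var, wp_pair, wp_nil, wp_call,
    List.getElem?_cons_zero, List.getElem?_cons_succ, Option.some.injEq, exists_eq_left',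
    Val.fst?_pair, Val.snd?_pair, Val.isPair_pair, Val.isPair_nil, if_true, if_false,
    ]
  refine hm₁.wpCall fun t₁ ht₁ => ?_
  refine hm₂.wpCall fun t₂ ht₂ => ?_
  refine happ.wpCall fun t₃ ht₃ => ?_
  obtain ⟨b, y, t₄, hb, hy, h⟩ := hpipe
  refine ⟨b, y, t₄, hb, hy, h.mono ?_⟩
  rintro out s ⟨⟨E, hnd, hE, rfl⟩, ht⟩
  simp only [← hk, hl, total_itemPay hUL hF h₁ h₂ (fun x => (hl₁ x).2) fun y => (hl₂ y).2] at hE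
  refine ⟨⟨E.map Prod.fst, hnd, fun f => ?_, ?_⟩, ?_⟩
  · rw [List.mem_map]
    constructor
    · rintro ⟨e, he, rfl⟩
      obtain ⟨h1, h2⟩ := (hE e).1 he
      exact h2 ▸ h1
    · exact fun h => ⟨(f, _), (hE (f, _)).2 ⟨h, rfl⟩, rfl⟩
  · rw [List.map_map]
    congr 1
    refine List.map_congr_left fun e he => ?_
    rw [((hE e).1 he).2]
    rfl
  · rw [hks, hlen] at ht
    set M := l₁.length + l₂.length with hM
    set X := M * (H + 2) ^ max (k - 1) 1 + 1 with hX
    have hMX : M + 1 ≤ X := by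
      have := Nat.le_mul_of_pos_right M (show 0 < (H + 2) ^ max (k - 1) 1 by positivity)
      omega
    have b1 : c₁.size * l₁.length ≤ c₁.size * X := Nat.mul_le_mul_left _ (by omega)
    have b2 : c₂.size * l₂.length ≤ c₂.size * X := Nat.mul_le_mul_left _ (by omega)
    rw [add_mul] at ht₁ ht₂
    rw [add_mul, add_mul, add_mul]
    omega

end FAQAI

theorem mainTheorem6 (n k : ℕ) (U L F : Finset (Fin n)) (S : Fin k → Finset (Fin n))
    (hUL : U ∪ L = Finset.univ) (hF : F ⊆ U) :
    ∃ (p : FAQAI.Program) (C : ℝ),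
      ∀ (D : Type u) [Semiring D] (Dom : Fin n → Type v) [(i : Fin n) → LinearOrder (Dom i)]
        (Φ₁ : FAQAI.Tuple Dom U → D) (Φ₂ : FAQAI.Tuple Dom L → D)
        (θ : (j : Fin k) → (i : {i // i ∈ S j}) → Dom i.1 → ℝ)
        (w₁ w₂ : FAQAI.Val D Dom),
        FAQAI.IsTable Φ₁ w₁ → FAQAI.IsTable Φ₂ w₂ →
        ∃ (out : FAQAI.Val D Dom) (t : ℕ),
          p.Runs S θ (.pair w₁ w₂) out t ∧
          FAQAI.IsTable (FAQAI.query U L F S Φ₁ Φ₂ θ) out ∧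
          (2 ≤ max (FAQAI.size Φ₁) (FAQAI.size Φ₂) →
            (t : ℝ) ≤ C * (max (FAQAI.size Φ₁) (FAQAI.size Φ₂) : ℕ) *
              Real.log (max (FAQAI.size Φ₁) (FAQAI.size Φ₂) : ℕ) ^ max (k - 1) 1) := by
  -- Program and constant are built from the shape of the query alone, before any instance is
  -- introduced.
  refine ⟨⟨FAQAI.funs (FAQAI.queryItemE S U L F) (FAQAI.pointItemE S U L), FAQAI.mainE⟩,
    (3 * ((FAQAI.queryItemE S U L F).size + (FAQAI.pointItemE S U L).size +
      FAQAI.pipeConst (n + 2) (k - 1) + 200) * 10 ^ max (k - 1) 1 : ℕ), ?_⟩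
  rintro D _ Dom _ Φ₁ Φ₂ θ _ _ ⟨l₁, h₁, hl₁, rfl⟩ ⟨l₂, h₂, hl₂, rfl⟩
  -- The number of digits is bounded by `Nat.log 2 M + 1`, where `M`, the total number of entries,
  -- is at most twice the maximum of the sizes.
  obtain ⟨out, t, hrun, htab, ht⟩ := FAQAI.exists_runs hUL hF Φ₁ Φ₂ θ h₁ h₂ hl₁ hl₂
    (Nat.lt_pow_succ_log_self (b := 2) (by norm_num) _)
  refine ⟨out, t, hrun, htab, fun hN => ?_⟩
  rw [FAQAI.size_eq_length h₁ hl₁, FAQAI.size_eq_length h₂ hl₂] at hN ⊢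
  exact (Nat.cast_le.2 ht).trans (FAQAI.log_time_le (by omega) rfl hN)
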